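/- **Setting.** Let $n\ge 1$, let $D(\mathbb R^n)$ be the space of (real- or complex-valued) $C^\infty$ functions with compact support, and let $S'_e$ be the set of distributions $f\in D'(\mathbb R^n)$ for which there are $C_f,N_f$ with $|\langle f,\eta\rangle|\le C_f\sup\{|D^\beta\eta(x)|e^{N_f|x|}: x\in\mathbb R^n,\ |\beta|\le N_f\}$ for all $\eta\in D(\mathbb R^n)$. For $k\in\mathbb N_0$, $m\in\mathbb Z^n$ put $Q_{k,m}=\prod_{i=1}^n(\frac{m_i}{2^k},\frac{m_i+1}{2^k})$ and $\widetilde Q_{k,m}=\prod_{i=1}^n[\frac{m_i}{2^k},\frac{m_i+1}{2^k})$. A sequence $\{t_k\}_{k\ge0}$ of measurable functions on $\mathbb R^n$ that are positive almost everywhere is called $p$-admissible if $t_k\in L_p^{\rm loc}(\mathbb R^n)$ for all $k$. In that case set $t_{k,m}=\|t_k|L_p(Q_{k,m})\|$ and $$\overline t_k(x)=2^{kn/p}\sum_{m\in\mathbb Z^n}t_{k,m}\,\chi_{\widetilde Q_{k,m}}(x).$$ For $p,\sigma_1,\sigma_2\in(0,\infty]$, $\alpha_3\ge0$ and sequences of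 positive numbers $\alpha^1=\{\alpha^1_k\}$, $\alpha^2=\{\alpha^2_k\}$, with $\sigma=(\sigma_1,\sigma_2)$ and $\alpha=(\alpha^1,\alpha^2)$, the class $X^{\alpha_3}_{\alpha,\sigma,p}$ consists of the $p$-admissible $\{t_k\}$ such that for some $C_1,C_2>0$, for all $0\le k\le j$ and $m\in\mathbb Z^n$, 1. $\bigl(2^{kn}\int_{Q_{k,m}}t_k^p\bigr)^{1/p}\bigl(2^{kn}\int_{Q_{k,m}}t_j^{-\sigma_1}\bigr)^{1/\sigma_1}\le C_1\,\alpha^1_k/\alpha^1_j$; 2. $\bigl(2^{kn}\int_{Q_{k,m}}t_k^p\bigr)^{-1/p}\bigl(2^{kn}\int_{Q_{k,m}}t_j^{\sigma_2}\bigr)^{1/\sigma_2}\le C_2\,\alpha^2_j/\alpha^2_k$; 3. $0<t_{k,m}\le 2^{\alpha_3}t_{k,\widetilde m}$ whenever $|m_i-\widetilde m_i|\le1$ for $i=1,\dots,n$ (with essential suprema for infinite exponents). For $\varphi_0\in D(\mathbb R^n)$ put $\varphi=\varphi_0-2^{-n}\varphi_0(\cdot/2)$ and $\varphi_k=2^{kn}\varphi(2^k\cdot)$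 for $k\ge1$; let $L_\varphi$ be the largest integer $L\ge 0$ such that $\int x^\beta\varphi(x)\,dx=0$ for all $|\beta|\le L$. The space $B^{\varphi_0}_{p,q}(\mathbb R^n,\{t_k\})$ is the set of all $f\in S'_e$ with finite quasi-norm $$\|f|B^{\varphi_0}_{p,q}(\mathbb R^n,\{t_k\})\|=\Bigl(\sum_{k=0}^\infty\|t_k(\varphi_k*f)|L_p(\mathbb R^n)\|^q\Bigr)^{1/q}$$ (the supremum over $k$ if $q=\infty$). **Theorem 3.3.** Let $p,q\in(0,\infty]$, $r\in(0,p]$ and let $\sigma_1=r\,p_r'$, where $p_r=p/r$ ($p_r=1$ if $r=p$) and $p_r'$ is its conjugate exponent; let $\sigma_2=p$. Let $\{\alpha^1_k\}$, $\{\alpha^2_k\}$ be sequences of positive real numbers, $\alpha_3\ge0$, $\{t_k\}\in X^{\alpha_3}_{\alpha,\sigma,p}$, and let $\varphi_0\in D(\mathbb R^n)$ with $\int\varphi_0\,dx=1$. Assume that for some real $A>0$ and real $\mu$ with $0<\mu\le\min\{1,q,r\}$, with $s=q/\mu$ and $s'$ the conjugate exponent of $s$, $$\sup_{N\in\mathbb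 N}\Bigl(\sum_{k=0}^N\beta_k^s\Bigr)^{1/s}\Bigl(\sum_{k=N}^\infty\beta_k^{-s'}\Bigr)^{1/s'}<\infty\quad\text{for }\beta_k=(2^{kA}\alpha^1_k)^\mu,$$ $$\sup_{N\in\mathbb N}\Bigl(\sum_{k=N}^\infty\beta_k^s\Bigr)^{1/s}\Bigl(\sum_{k=0}^N\beta_k^{-s'}\Bigr)^{1/s'}<\infty\quad\text{for }\beta_k=(2^{-k(1+L_\varphi)}\alpha^2_k)^\mu$$ (with suprema in place of sums for infinite exponents). Then $$B^{\varphi_0}_{p,q}(\mathbb R^n,\{t_k\})=B^{\varphi_0}_{p,q}(\mathbb R^n,\{\overline t_k\}),$$ and the two quasi-norms are equivalent on this space: there are constants $c,C>0$ such that, for every $f$ in it, $$c\,\|f|B^{\varphi_0}_{p,q}(\mathbb R^n,\{t_k\})\|\le\|f|B^{\varphi_0}_{p,q}(\mathbb R^n,\{\overline t_k\})\|\le C\,\|f|B^{\varphi_0}_{p,q}(\mathbb R^n,\{t_k\})\|.$$ -/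

import Mathlib

open MeasureTheory TopologicalSpace
open scoped ENNReal NNReal Distributions ContDiff

noncomputable section

namespace VarBesov

/-- The Euclidean space `ℝⁿ`. -/
abbrev E (n : ℕ) : Type := EuclideanSpace ℝ (Fin n)

/-! ### Exponents -/

/-- The exponent `p_r = p / r` for `0 < r ≤ p ≤ ∞`, with the convention `p_r = 1` if `r = p`
(this matters only for `r = p = ∞`). -/
def ratioExp (p r : ℝ≥0∞) : ℝ≥0∞ := if p = r then 1 else p / r

/-- The exponent `σ₁ = r p'_r`, where `p'_r` is the Hölder conjugate of `p_r`. -/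
def sigmaOne (p r : ℝ≥0∞) : ℝ≥0∞ := r * (ratioExp p r).conjExponent

/-- The `l_s` quasi-norm of the restriction to `I ⊆ ℕ` of a nonnegative sequence
(the supremum if `s = ∞`). -/
def lqNorm (s : ℝ≥0∞) (I : Set ℕ) (a : ℕ → ℝ≥0∞) : ℝ≥0∞ :=
  if s = ⊤ then ⨆ k ∈ I, a k else (∑' k : I, a k ^ s.toReal) ^ (1 / s.toReal)

/-- The condition
`sup_{N ∈ ℕ} (∑_{k=0}^{N} β_k^s)^{1/s} (∑_{k=N}^{∞} β_k^{-s'})^{1/s'} < ∞`. -/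
def HardyTail (s : ℝ≥0∞) (β : ℕ → ℝ) : Prop :=
  (⨆ N ∈ Set.Ici 1, lqNorm s (Set.Iic N) (fun k => ENNReal.ofReal (β k)) *
    lqNorm s.conjExponent (Set.Ici N) (fun k => ENNReal.ofReal (β k)⁻¹)) < ⊤

/-- The condition
`sup_{N ∈ ℕ} (∑_{k=N}^{∞} β_k^s)^{1/s} (∑_{k=0}^{N} β_k^{-s'})^{1/s'} < ∞`. -/
def HardyHead (s : ℝ≥0∞) (β : ℕ → ℝ) : Prop :=
  (⨆ N ∈ Set.Ici 1, lqNorm s (Set.Ici N) (fun k => ENNReal.ofReal (β k)) *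
    lqNorm s.conjExponent (Set.Iic N) (fun k => ENNReal.ofReal (β k)⁻¹)) < ⊤

/-! ### Dyadic cubes and weight sequences -/

/-- The open dyadic cube `Q_{k,m}`. -/
def openCube {n : ℕ} (k : ℕ) (m : Fin n → ℤ) : Set (E n) :=
  {x | ∀ i, (m i : ℝ) / 2 ^ k < x i ∧ x i < ((m i : ℝ) + 1) / 2 ^ k}

/-- The half-open dyadic cube `Q̃_{k,m}`. -/
def halfOpenCube {n : ℕ} (k : ℕ) (m : Fin n → ℤ) : Set (E n) :=
  {x | ∀ i, (m i : ℝ) / 2 ^ k ≤ x i ∧ x i < ((m i : ℝ) + 1) / 2 ^ k}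

/-- The normalized quasi-norm `(2^{kn} ∫_{Q_{k,m}} |g|^s)^{1/s}`
(the essential supremum over `Q_{k,m}` if `s = ∞`). -/
def avgNorm {n : ℕ} (s : ℝ≥0∞) (k : ℕ) (m : Fin n → ℤ) (g : E n → ℝ) : ℝ≥0∞ :=
  eLpNorm g s ((2 : ℝ≥0∞) ^ (k * n) • volume.restrict (openCube k m))

/-- `t_{k,m} = ‖t_k | L_p(Q_{k,m})‖`. -/
def cubeNorm {n : ℕ} (p : ℝ≥0∞) (t : ℕ → E n → ℝ) (k : ℕ) (m : Fin n → ℤ) : ℝ≥0∞ :=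
  eLpNorm (t k) p (volume.restrict (openCube k m))

/-- The sequence `t̄_k(x) = 2^{kn/p} ∑_m t_{k,m} χ_{Q̃_{k,m}}(x)`. -/
def tbar {n : ℕ} (p : ℝ≥0∞) (t : ℕ → E n → ℝ) (k : ℕ) (x : E n) : ℝ :=
  (2 : ℝ) ^ ((k : ℝ) * n * p⁻¹.toReal) *
    ∑' m : Fin n → ℤ, (halfOpenCube k m).indicator (fun _ => (cubeNorm p t k m).toReal) x

/-- The class `X^{α₃}_{α,σ,p}` of `p`-admissible weight sequences. -/
structure MemX {n : ℕ} (p σ₁ σ₂ : ℝ≥0∞) (α₁ α₂ : ℕ → ℝ) (α₃ : ℝ) (t : ℕ → E n → ℝ) :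
    Prop where
  measurable : ∀ k, AEMeasurable (t k) volume
  pos : ∀ k, ∀ᵐ x, 0 < t k x
  admissible : ∀ k, ∀ K : Set (E n), IsCompact K → MemLp (t k) p (volume.restrict K)
  lower : ∃ C₁ : ℝ, 0 < C₁ ∧ ∀ k j : ℕ, k ≤ j → ∀ m : Fin n → ℤ,
    avgNorm p k m (t k) * avgNorm σ₁ k m (fun x => (t j x)⁻¹)
      ≤ ENNReal.ofReal (C₁ * (α₁ k / α₁ j))
  upper : ∃ C₂ : ℝ, 0 < C₂ ∧ ∀ k j : ℕ, k ≤ j → ∀ m : Fin n → ℤ,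
    (avgNorm p k m (t k))⁻¹ * avgNorm σ₂ k m (t j)
      ≤ ENNReal.ofReal (C₂ * (α₂ j / α₂ k))
  neighbour : ∀ k : ℕ, ∀ m m' : Fin n → ℤ, (∀ i, |m i - m' i| ≤ 1) →
    0 < cubeNorm p t k m ∧ cubeNorm p t k m ≤ (2 : ℝ≥0∞) ^ α₃ * cubeNorm p t k m'

/-! ### Distributions and Besov spaces -/

variable {𝕜 : Type*} [RCLike 𝕜] {n : ℕ}

variable (𝕜 n) in
/-- The distributions `D'(ℝⁿ)`: continuous linear functionals on `D(ℝⁿ)`, where test functions and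
functionals have real (`𝕜 = ℝ`) or complex (`𝕜 = ℂ`) values. -/
abbrev Distr : Type _ := 𝓓((⊤ : Opens (E n)), 𝕜) →L[𝕜] 𝕜

/-- The class `S'_e` of distributions of at most exponential growth: for some `C` and `N`, and for
all `η ∈ D(ℝⁿ)`, one has `|⟨f, η⟩| ≤ C sup {|D^i η(x)| exp(N|x|) : x ∈ ℝⁿ, i ≤ N}`.
The norm of the full `i`-th derivative is comparable, with constants depending on `i` and `n`,
with the maximum of the partial derivatives of order `i`. -/
def IsExpGrowth (f : Distr 𝕜 n) : Prop :=
  ∃ (C : ℝ≥0) (N : ℕ), ∀ η : 𝓓((⊤ : Opens (E n)), 𝕜),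
    ‖f η‖ₑ ≤ C * ⨆ (x : E n) (i : ℕ) (_ : i ≤ N),
      ‖iteratedFDeriv ℝ i η x‖ₑ * ENNReal.ofReal (Real.exp (N * ‖x‖))

/-- `φ(x) = φ₀(x) - 2^{-n} φ₀(x/2)`. -/
def phi (φ₀ : 𝓓((⊤ : Opens (E n)), 𝕜)) (x : E n) : 𝕜 :=
  φ₀ x - ((2 : ℝ) ^ n)⁻¹ • φ₀ ((2 : ℝ)⁻¹ • x)

/-- The functions `φ_k`: `φ₀` is given and `φ_k(x) = 2^{kn} φ(2^k x)` for `k ≥ 1`. -/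
def phiSeq (φ₀ : 𝓓((⊤ : Opens (E n)), 𝕜)) (k : ℕ) (x : E n) : 𝕜 :=
  if k = 0 then φ₀ x else ((2 : ℝ) ^ (k * n)) • phi φ₀ ((2 : ℝ) ^ k • x)

theorem contDiff_phiSeq (φ₀ : 𝓓((⊤ : Opens (E n)), 𝕜)) (k : ℕ) :
    ContDiff ℝ ∞ (phiSeq φ₀ k) := by
  have h : ContDiff ℝ ∞ (φ₀ : E n → 𝕜) := φ₀.contDiff
  have h2 : ContDiff ℝ ∞ (phi φ₀) :=
    h.sub ((h.comp (contDiff_id.const_smul (2 : ℝ)⁻¹)).const_smul ((2 : ℝ) ^ n)⁻¹)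
  unfold phiSeq
  by_cases hk : k = 0
  · simpa [hk] using h
  · simpa [hk] using (h2.comp (contDiff_id.const_smul ((2 : ℝ) ^ k))).const_smul
      ((2 : ℝ) ^ (k * n))

theorem hasCompactSupport_phiSeq (φ₀ : 𝓓((⊤ : Opens (E n)), 𝕜)) (k : ℕ) :
    HasCompactSupport (phiSeq φ₀ k) := by
  have h : HasCompactSupport (φ₀ : E n → 𝕜) := φ₀.hasCompactSupport
  have h2 : HasCompactSupport (phi φ₀) := by
    have h3 : HasCompactSupport (fun x : E n => φ₀ ((2 : ℝ)⁻¹ • x)) :=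
      h.comp_smul (by norm_num)
    have h4 : HasCompactSupport (fun x : E n => ((2 : ℝ) ^ n)⁻¹ • φ₀ ((2 : ℝ)⁻¹ • x)) :=
      h3.smul_left (f := fun _ => ((2 : ℝ) ^ n)⁻¹)
    exact h.sub h4
  unfold phiSeq
  by_cases hk : k = 0
  · simpa [hk] using h
  · have h3 : HasCompactSupport (fun x : E n => phi φ₀ ((2 : ℝ) ^ k • x)) :=
      h2.comp_smul (by positivity)
    have h4 : HasCompactSupport
        (fun x : E n => ((2 : ℝ) ^ (k * n)) • phi φ₀ ((2 : ℝ) ^ k • x)) :=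
      h3.smul_left (f := fun _ => ((2 : ℝ) ^ (k * n)))
    simpa only [hk, if_false] using h4

/-- The test function `y ↦ φ_k(x - y)`. -/
def shifted (φ₀ : 𝓓((⊤ : Opens (E n)), 𝕜)) (k : ℕ) (x : E n) : 𝓓((⊤ : Opens (E n)), 𝕜) where
  toFun y := phiSeq φ₀ k (x - y)
  contDiff' := (contDiff_phiSeq φ₀ k).comp (contDiff_const.sub contDiff_id)
  hasCompactSupport' :=
    (hasCompactSupport_phiSeq φ₀ k).comp_homeomorph (Homeomorph.subLeft x)
  tsupport_subset' := fun _ _ => trivial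

/-- The convolution `(φ_k * f)(x) = ⟨f, φ_k(x - ·)⟩`. -/
def conv (φ₀ : 𝓓((⊤ : Opens (E n)), 𝕜)) (f : Distr 𝕜 n) (k : ℕ) (x : E n) : 𝕜 :=
  f (shifted φ₀ k x)

/-- `ψ` has vanishing moments `∫ x^β ψ(x) dx = 0` for all multi-indices `|β| ≤ L`. -/
def VanishingMoments (ψ : E n → 𝕜) (L : ℕ) : Prop :=
  ∀ β : Fin n → ℕ, ∑ i, β i ≤ L → ∫ x : E n, (∏ i, x i ^ β i) • ψ x = 0

/-- `L_ψ = L`, where `L_ψ` is the largest `L` such that all moments of `ψ` of order at most `L`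
vanish. -/
def IsMomentOrder (ψ : E n → 𝕜) (L : ℕ) : Prop :=
  IsGreatest {L' : ℕ | VanishingMoments ψ L'} L

/-- The quasi-norm `(∑_k ‖t_k (φ_k * f) | L_p(ℝⁿ)‖^q)^{1/q}`, as an element of `[0, ∞]`. -/
def besovNorm (φ₀ : 𝓓((⊤ : Opens (E n)), 𝕜)) (p q : ℝ≥0∞) (t : ℕ → E n → ℝ)
    (f : Distr 𝕜 n) : ℝ≥0∞ :=
  lqNorm q Set.univ (fun k => eLpNorm (fun x => t k x • conv φ₀ f k x) p volume)

/-- The space `B^{φ₀}_{p,q}(ℝⁿ, {t_k})` of all `f ∈ S'_e` with finite quasi-norm. -/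
def besovSpace (φ₀ : 𝓓((⊤ : Opens (E n)), 𝕜)) (p q : ℝ≥0∞) (t : ℕ → E n → ℝ) :
    Set (Distr 𝕜 n) :=
  {f | IsExpGrowth f ∧ besovNorm φ₀ p q t f < ⊤}

end VarBesov

end

open VarBesov

noncomputable section
namespace VarBesov
variable {𝕜 : Type*} [RCLike 𝕜] {n : ℕ}

/-! Write F_k = φ_k * f, let V_k be convolution with 2^{kn} φ₀(2^k ·), and T_k = 1 - V_k. Since ∫ φ₀
= 1, T_k annihilates constants, so T_{k+i} applied to a function that is smooth at scale 2^{-k}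
gains a factor 2^{-i}. Telescoping T_{k+i}^{M+1} - T_{k+i+1}^{M+1} and using φ_{k+i+1} * F_k = φ_k *
F_{k+i+1} expresses F_k through the F_j with j ≥ k (`telescoped_reproducing`). Each kernel consists
of products of M factors T_{k+i}, T_{k+i+1} applied to φ_k; it has size about 2^{kn} 2^{-Mi} and
support radius about 2^{-k}. Here M is arbitrary. The result is a bound of |F_k| by local means of
the |F_{k+i}| with decay 2^{-Mi}.

The Strömberg–Torchinsky argument (`rpow_le_meanSum`) turns this into a bound by μ-means for small
μ. It divides by a power of a Peetre maximal function, whose finiteness comes from the exponential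
growth of f; the final constant does not depend on f. The weights are exponential because both S'_e
and condition 3 allow exponential growth.

For two weight sequences v, u, `exists_level_estimate` works cube by cube: v_k enters only through
its L_p mean on Q_{k,m}, Hölder splits u_{k+i}^{-1} off the μ-mean of F_{k+i}, the mixed form of
condition 1 produces α_k/α_{k+i}, and the exponential weight beats the growth of the means of v_k
from cube to cube. The Hardy tail condition forces geometric growth of (2^{kA} α_k)^μ, so a large M
makes the coefficients summable, and Minkowski in ℓ_{q/μ} gives `exists_besovNorm_le`.

This comparison is used for (t̄, t) and for (t, t̄). Condition 1 passes to both pairs because t̄_k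
and t_k have the same L_p mean on Q_{k,m}, and because Hölder applied to 1 = t_j^{-1} t_j shows that
the σ₁-mean of t̄_j^{-1} over a cube of level j, hence over any larger dyadic cube, is at most that
of t_j^{-1}. -/

open scoped Convolution
open ContinuousLinearMap (mul lsmul)


/-! ### Convolution operators and the telescoped reproducing formula -/

/-- Convolution with a compactly supported continuous kernel. -/
def convOp (u : C(E n, 𝕜)) : Module.End 𝕜 C(E n, 𝕜) :=
  open Classical in
  if h : HasCompactSupport u then
    { toFun := fun F => ⟨u ⋆[mul ℝ 𝕜, volume] F,
        h.continuous_convolution_left _ u.continuous F.continuous.locallyIntegrable⟩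
      map_add' := fun F G => by
        ext1 x
        exact (h.convolutionExists_left _ u.continuous F.continuous.locallyIntegrable x).distrib_add
          (h.convolutionExists_left _ u.continuous G.continuous.locallyIntegrable x)
      map_smul' := fun c F => by
        ext1 x
        simp only [convolution_def, ContinuousMap.coe_mk, ContinuousMap.smul_apply,
          ContinuousLinearMap.mul_apply', RingHom.id_apply, smul_eq_mul,
          ContinuousMap.coe_smul, Pi.smul_apply]
        rw [← integral_const_mul]
        congr 1; ext y; ring }
  else 0

theorem convOp_apply {u : C(E n, 𝕜)} (hu : HasCompactSupport u) (F : C(E n, 𝕜)) (x : E n) :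
    convOp u F x = ∫ y, u y * F (x - y) := by
  simp only [convOp, hu, dif_pos]; rfl

theorem coe_convOp {u : C(E n, 𝕜)} (hu : HasCompactSupport u) (F : C(E n, 𝕜)) :
    (convOp u F : E n → 𝕜) = u ⋆[mul ℝ 𝕜, volume] F := by
  simp only [convOp, hu, dif_pos]; rfl

theorem hasCompactSupport_convOp {u v : C(E n, 𝕜)} (hu : HasCompactSupport u)
    (hv : HasCompactSupport v) : HasCompactSupport (convOp u v) := by
  rw [coe_convOp hu]; exact HasCompactSupport.convolution _ hu hv

theorem convOp_comm {u v : C(E n, 𝕜)} (hu : HasCompactSupport u)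
    (hv : HasCompactSupport v) : convOp u v = convOp v u := by
  ext1 x
  rw [coe_convOp hu, coe_convOp hv, ← convolution_flip]
  congr 2
  ext
  simp

theorem convOp_assoc {u v : C(E n, 𝕜)} (hu : HasCompactSupport u)
    (hv : HasCompactSupport v) (F : C(E n, 𝕜)) :
    convOp (convOp u v) F = convOp u (convOp v F) := by
  ext1 x
  rw [coe_convOp (hasCompactSupport_convOp hu hv), coe_convOp hu, coe_convOp hu, coe_convOp hv]
  have hv' : HasCompactSupport fun x => ‖v x‖ := hv.norm
  have hu' : HasCompactSupport fun x => ‖u x‖ := hu.norm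
  refine convolution_assoc (L := mul ℝ 𝕜) (L₂ := mul ℝ 𝕜) (L₃ := mul ℝ 𝕜) (L₄ := mul ℝ 𝕜)
    (fun x y z => by simp [mul_assoc])
    u.continuous.aestronglyMeasurable v.continuous.aestronglyMeasurable
    F.continuous.aestronglyMeasurable ?_ ?_ ?_
  · exact Filter.Eventually.of_forall fun y =>
      hu.convolutionExists_left _ u.continuous v.continuous.locallyIntegrable y
  · exact Filter.Eventually.of_forall fun y =>
      hv'.convolutionExists_left _ v.continuous.norm F.continuous.norm.locallyIntegrable y
  · exact hu'.convolutionExists_left _ u.continuous.norm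
      (hv'.continuous_convolution_left _ v.continuous.norm
        F.continuous.norm.locallyIntegrable).locallyIntegrable x

theorem convOp_add {u v : C(E n, 𝕜)} (hu : HasCompactSupport u) (hv : HasCompactSupport v)
    (F : C(E n, 𝕜)) : convOp (u + v) F = convOp u F + convOp v F := by
  ext1 x
  have huv : HasCompactSupport (u + v : C(E n, 𝕜)) := HasCompactSupport.add hu hv
  rw [ContinuousMap.add_apply, coe_convOp huv, coe_convOp hu, coe_convOp hv]
  exact (hu.convolutionExists_left _ u.continuous F.continuous.locallyIntegrable x).add_distrib
    (hv.convolutionExists_left _ v.continuous F.continuous.locallyIntegrable x)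

theorem commute_convOp {u v : C(E n, 𝕜)} (hu : HasCompactSupport u)
    (hv : HasCompactSupport v) : Commute (convOp u) (convOp v) := by
  refine LinearMap.ext fun F => ?_
  change convOp u (convOp v F) = convOp v (convOp u F)
  rw [← convOp_assoc hu hv, convOp_comm hu hv, convOp_assoc hv hu]

/-- Operators on continuous functions that commute with convolutions. -/
structure IsConvLinear (P : Module.End 𝕜 C(E n, 𝕜)) : Prop where
  compact : ∀ u : C(E n, 𝕜), HasCompactSupport u → HasCompactSupport (P u)
  apply_convOp : ∀ u : C(E n, 𝕜), HasCompactSupport u → ∀ F, P (convOp u F) = convOp (P u) F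

namespace IsConvLinear

variable {P Q : Module.End 𝕜 C(E n, 𝕜)}

theorem one : IsConvLinear (1 : Module.End 𝕜 C(E n, 𝕜)) := ⟨fun _ h => h, fun _ _ _ => rfl⟩

theorem convOp {v : C(E n, 𝕜)} (hv : HasCompactSupport v) : IsConvLinear (convOp v) :=
  ⟨fun _ hu => hasCompactSupport_convOp hv hu, fun _ hu F => (convOp_assoc hv hu F).symm⟩

theorem add (hP : IsConvLinear P) (hQ : IsConvLinear Q) : IsConvLinear (P + Q) :=
  ⟨fun u hu => HasCompactSupport.add (hP.compact u hu) (hQ.compact u hu), fun u hu F => by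
    simp only [LinearMap.add_apply]
    rw [hP.apply_convOp u hu, hQ.apply_convOp u hu,
      convOp_add (hP.compact u hu) (hQ.compact u hu)]⟩

theorem mul (hP : IsConvLinear P) (hQ : IsConvLinear Q) : IsConvLinear (P * Q) :=
  ⟨fun u hu => hP.compact _ (hQ.compact u hu), fun u hu F => by
    simp only [Module.End.mul_apply]
    rw [hQ.apply_convOp u hu, hP.apply_convOp _ (hQ.compact u hu)]⟩

theorem neg (hP : IsConvLinear P) : IsConvLinear (-P) :=
  ⟨fun u hu => HasCompactSupport.neg (hP.compact u hu), fun u hu F => by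
    have h : HasCompactSupport (-P u : C(E n, 𝕜)) := HasCompactSupport.neg (hP.compact u hu)
    simp only [LinearMap.neg_apply]
    rw [hP.apply_convOp u hu, neg_eq_iff_add_eq_zero, ← convOp_add (hP.compact u hu) h]
    have h0 : HasCompactSupport ((0 : C(E n, 𝕜)) : E n → 𝕜) := HasCompactSupport.zero
    ext x
    simp [convOp_apply h0]⟩

theorem sub (hP : IsConvLinear P) (hQ : IsConvLinear Q) : IsConvLinear (P - Q) := by
  have h : P - Q = P + -Q := LinearMap.ext fun F => sub_eq_add_neg (P F) (Q F)
  rw [h]; exact hP.add hQ.neg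

theorem pow (hP : IsConvLinear P) (i : ℕ) : IsConvLinear (P ^ i) := by
  induction i with
  | zero => simpa using one
  | succ i ih => rw [pow_succ]; exact ih.mul hP

theorem sum {ι : Type*} (s : Finset ι) (f : ι → Module.End 𝕜 C(E n, 𝕜))
    (h : ∀ i ∈ s, IsConvLinear (f i)) : IsConvLinear (∑ i ∈ s, f i) := by
  classical
  induction s using Finset.induction_on with
  | empty =>
    refine ⟨fun _ _ => HasCompactSupport.zero, fun u hu F => ?_⟩
    have h0 : HasCompactSupport ((0 : C(E n, 𝕜)) : E n → 𝕜) := HasCompactSupport.zero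
    ext x
    simp [convOp_apply h0]
  | insert a s ha ih =>
    rw [Finset.sum_insert ha]
    exact (h a (by simp)).add (ih fun i hi => h i (by simp [hi]))

end IsConvLinear

/-- The telescoped Calderón formula: if `v_{j+1} = V_{j+1} - V_j` and `v_j * F_k = v_k * F_j`, then
`F_k` is recovered from the `F_j` with `k ≤ j ≤ J`, up to `(1 - V_J *)^m F_k`. -/
theorem telescoped_reproducing (V v : ℕ → C(E n, 𝕜)) (F : ℕ → C(E n, 𝕜))
    (hV : ∀ j, HasCompactSupport (V j)) (hv : ∀ j, HasCompactSupport (v j))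
    (hVv : ∀ j, V (j + 1) = V j + v (j + 1))
    (hF : ∀ j k, convOp (v j) (F k) = convOp (v k) (F j)) (m k I : ℕ) :
    F k = convOp ((∑ i ∈ Finset.range m, (1 - convOp (V k)) ^ i) (V k)) (F k) +
      ∑ i ∈ Finset.range I, convOp ((∑ l ∈ Finset.range m, (1 - convOp (V (k + i))) ^ l *
        (1 - convOp (V (k + i + 1))) ^ (m - 1 - l)) (v k)) (F (k + i + 1)) +
      ((1 - convOp (V (k + I))) ^ m) (F k) := by
  have hT : ∀ j, IsConvLinear (1 - convOp (V j)) := fun j =>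
    IsConvLinear.one.sub (IsConvLinear.convOp (hV j))
  have hcomm : ∀ i j, Commute (1 - convOp (V i)) (1 - convOp (V j)) := fun i j => by
    have := commute_convOp (hV i) (hV j)
    change (1 - convOp (V i)) * (1 - convOp (V j)) = (1 - convOp (V j)) * (1 - convOp (V i))
    have h' : convOp (V i) * convOp (V j) = convOp (V j) * convOp (V i) := this
    refine LinearMap.ext fun G => ?_
    have h3 := congrArg (fun P : Module.End 𝕜 C(E n, 𝕜) => P G) h'
    simp only [Module.End.mul_apply, LinearMap.sub_apply, Module.End.one_apply, map_sub] at h3 ⊢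
    rw [h3]; abel
  induction I with
  | zero =>
    have h1 := (IsConvLinear.sum (Finset.range m) (fun i => (1 - convOp (V k)) ^ i)
      fun i _ => (hT k).pow i).apply_convOp (V k) (hV k) (F k)
    -- Geometric sum (∑ T^i)(T - 1) = T^m - 1 with T = 1 - V_k, so that T - 1 = -V_k.
    have h2 := geom_sum_mul (1 - convOp (V k)) m
    have h3 := congrArg (fun P : Module.End 𝕜 C(E n, 𝕜) => P (F k)) h2
    simp only [Module.End.mul_apply, LinearMap.sub_apply, Module.End.one_apply] at h3
    rw [sub_sub_cancel_left, map_neg, h1] at h3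
    simp only [Finset.range_zero, Finset.sum_empty, add_zero]
    rw [neg_eq_iff_eq_neg] at h3
    rw [h3]; abel
  | succ I ih =>
    rw [Finset.sum_range_succ]
    have h1 := (IsConvLinear.sum (Finset.range m) (fun l => (1 - convOp (V (k + I))) ^ l *
        (1 - convOp (V (k + I + 1))) ^ (m - 1 - l))
      fun i _ => ((hT _).pow i).mul ((hT _).pow _)).apply_convOp (v k) (hv k) (F (k + I + 1))
    -- The two remainders differ by (∑ S^l T^{m-1-l})(S - T) = S^m - T^m, valid as S and T commute.
    have h2 := Commute.geom_sum₂_mul (R := Module.End 𝕜 C(E n, 𝕜)) (hcomm (k + I) (k + I + 1)) m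
    have h3 := congrArg (fun P : Module.End 𝕜 C(E n, 𝕜) => P (F k)) h2
    simp only [Module.End.mul_apply, LinearMap.sub_apply, Module.End.one_apply] at h3
    -- S - T is convolution with v_{k+I+1}; the symmetry `hF` moves the high frequency onto F and
    -- leaves the kernel v_k, which is smooth at the coarse scale.
    have h4 : (F k - convOp (V (k + I)) (F k)) - (F k - convOp (V (k + I + 1)) (F k)) =
        convOp (v k) (F (k + I + 1)) := by
      rw [← hF, hVv, convOp_add (hV _) (hv _)]; abel
    rw [h4, h1] at h3
    rw [h3]
    conv_lhs => rw [ih]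
    rw [← add_assoc k I 1]
    abel


/-! ### Kernel bounds: trading derivatives for decay -/

theorem iteratedFDeriv_convolution {u g : E n → 𝕜} (hu : LocallyIntegrable u volume)
    (hg : ContDiff ℝ ∞ g) (hgc : HasCompactSupport g) (l : ℕ) (x : E n) :
    iteratedFDeriv ℝ l (u ⋆[mul ℝ 𝕜, volume] g) x =
      ∫ y, u y • iteratedFDeriv ℝ l g (x - y) := by
  induction l generalizing x with
  | zero =>
    simp only [iteratedFDeriv_zero_eq_comp, Function.comp_apply]
    rw [convolution_def]
    have h := (continuousMultilinearCurryFin0 ℝ (E n)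
      𝕜).symm.toContinuousLinearEquiv.integral_comp_comm
      (μ := volume) (fun y => (mul ℝ 𝕜) (u y) (g (x - y)))
    exact h.symm
  | succ l ih =>
    rw [iteratedFDeriv_succ_eq_comp_left, Function.comp_apply]
    have h1 : iteratedFDeriv ℝ l (u ⋆[mul ℝ 𝕜, volume] g) =
        u ⋆[lsmul ℝ 𝕜, volume] (iteratedFDeriv ℝ l g) := by
      ext1 y; rw [ih]; rfl
    have h2 : ContDiff ℝ 1 (iteratedFDeriv ℝ l g) :=
      hg.iteratedFDeriv_right (i := l) (m := 1) (by norm_cast; exact le_top)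
    have h3 := (hgc.iteratedFDeriv (𝕜 := ℝ) l).hasFDerivAt_convolution_right
      (lsmul ℝ 𝕜) hu h2 x
    rw [h1, h3.fderiv, convolution_def, iteratedFDeriv_succ_eq_comp_left]
    have h := (continuousMultilinearCurryLeftEquiv ℝ (fun _ : Fin (l + 1) => E n)
      𝕜).symm.toContinuousLinearEquiv.integral_comp_comm
      (μ := volume) (fun y => ((lsmul ℝ 𝕜).precompR (E n)) (u y)
        (fderiv ℝ (iteratedFDeriv ℝ l g) (x - y)))
    exact h.symm

/-- Smooth functions with `‖D^l u‖ ≤ c d^l` for `l ≤ m`, supported in the ball of radius `ρ`. -/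
structure KernelBound (d : ℝ) (m : ℕ) (c ρ : ℝ) (u : E n → 𝕜) : Prop where
  smooth : ContDiff ℝ ∞ u
  eq_zero : ∀ x, ρ < ‖x‖ → u x = 0
  bound : ∀ l ≤ m, ∀ x, ‖iteratedFDeriv ℝ l u x‖ ≤ c * d ^ l

/-- Kernels of integral one and `L¹` norm at most `I`, supported in the ball of radius `ε`. -/
structure UnitKernel (I ε : ℝ) (v : E n → 𝕜) : Prop where
  continuous : Continuous v
  eq_zero : ∀ x, ε < ‖x‖ → v x = 0
  integral_eq : ∫ x, v x = 1
  integral_norm : ∫ x, ‖v x‖ ≤ I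

theorem hasCompactSupport_of_eq_zero {u : E n → 𝕜} {ρ : ℝ} (h : ∀ x, ρ < ‖x‖ → u x = 0) :
    HasCompactSupport u :=
  HasCompactSupport.intro (isCompact_closedBall (0 : E n) ρ) fun x hx => h x (by simpa using hx)

theorem KernelBound.hasCompactSupport {d c ρ : ℝ} {m : ℕ} {u : E n → 𝕜}
    (h : KernelBound d m c ρ u) : HasCompactSupport u := hasCompactSupport_of_eq_zero h.eq_zero

theorem UnitKernel.hasCompactSupport {I ε : ℝ} {v : E n → 𝕜}
    (h : UnitKernel I ε v) : HasCompactSupport v := hasCompactSupport_of_eq_zero h.eq_zero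

theorem UnitKernel.integrable {I ε : ℝ} {v : E n → 𝕜} (h : UnitKernel I ε v) : Integrable v :=
  h.continuous.integrable_of_hasCompactSupport h.hasCompactSupport

theorem UnitKernel.mono {I ε ε' : ℝ} {v : E n → 𝕜} (h : UnitKernel I ε v) (hε : ε ≤ ε') :
    UnitKernel I ε' v :=
  ⟨h.continuous, fun x hx => h.eq_zero x (hε.trans_lt hx), h.integral_eq, h.integral_norm⟩

theorem UnitKernel.nonneg {I ε : ℝ} {v : E n → 𝕜} (h : UnitKernel I ε v) : 0 ≤ I :=
  (integral_nonneg fun _ => norm_nonneg _).trans h.integral_norm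

/-- The difference of `G x` and an average of `G` near `x`. -/
theorem UnitKernel.norm_sub_integral_le {V : Type*} [NormedAddCommGroup V] [NormedSpace ℝ V]
    [NormedSpace 𝕜 V] [IsScalarTower ℝ 𝕜 V] [CompleteSpace V] {I ε : ℝ} {v : E n → 𝕜}
    (h : UnitKernel I ε v) {G : E n → V} (hG : Continuous G) (x : E n) {a : ℝ}
    (ha : ∀ y, ‖y‖ ≤ ε → ‖G x - G (x - y)‖ ≤ a) :
    ‖G x - ∫ y, v y • G (x - y)‖ ≤ I * a := by
  have h1 : Integrable fun y => v y • G (x - y) :=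
    (h.continuous.smul (hG.comp (continuous_const.sub continuous_id))).integrable_of_hasCompactSupport
      h.hasCompactSupport.smul_right
  have h2 : Integrable fun y => v y • G x :=
    (h.continuous.smul continuous_const).integrable_of_hasCompactSupport
      h.hasCompactSupport.smul_right
  -- Integral one is what turns G(x) minus its average into an average of differences.
  have h3 : G x = ∫ y, v y • G x := by
    rw [integral_smul_const, h.integral_eq, one_smul]
  have h4 : G x - ∫ y, v y • G (x - y) = ∫ y, v y • (G x - G (x - y)) := by
    conv_lhs => rw [h3]
    rw [← integral_sub h2 h1]
    simp_rw [smul_sub]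
  rw [h4]
  by_cases hε : 0 ≤ ε
  · have ha0 : 0 ≤ a := (norm_nonneg _).trans (ha 0 (by simpa using hε))
    calc ‖∫ y, v y • (G x - G (x - y))‖ ≤ ∫ y, ‖v y‖ * a := by
          refine norm_integral_le_of_norm_le (h.integrable.norm.mul_const a)
            (Filter.Eventually.of_forall fun y => ?_)
          rw [norm_smul]
          by_cases hy : ‖y‖ ≤ ε
          · exact mul_le_mul_of_nonneg_left (ha y hy) (norm_nonneg _)
          · simp [h.eq_zero y (not_le.mp hy)]
      _ = (∫ y, ‖v y‖) * a := integral_mul_const _ _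
      _ ≤ I * a := mul_le_mul_of_nonneg_right h.integral_norm ha0
  -- A negative radius would force v = 0, against integral one.
  · exfalso
    have : v = 0 := by ext y; exact h.eq_zero y ((not_le.mp hε).trans_le (norm_nonneg _))
    have h5 := h.integral_eq
    simp [this] at h5

/-- Every D^l(u - v * u) is an average of D^l u(x) - D^l u(x - y) over |y| ≤ ε. The mean value
inequality bounds it by ε times the next derivative, so one order of control is spent to gain the
factor I ε d. -/
theorem KernelBound.sub_convOp {d c ρ I ε g : ℝ} {m : ℕ} {u v : C(E n, 𝕜)}
    (h : KernelBound d (m + 1) c ρ u) (hv : UnitKernel I ε v)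
    (hd : 0 ≤ d) (hc : 0 ≤ c) (hε : 0 ≤ ε) (hg : I * (ε * d) ≤ g) :
    KernelBound d m (g * c) (ρ + ε) ((1 - convOp v) u : C(E n, 𝕜)) := by
  have hu := h.hasCompactSupport
  have hvc := hv.hasCompactSupport
  have hcoe : (((1 - convOp v) u : C(E n, 𝕜)) : E n → 𝕜) =
      (u : E n → 𝕜) - (v ⋆[mul ℝ 𝕜, volume] u) := by
    rw [← coe_convOp hvc]; rfl
  have hsm : ContDiff ℝ ∞ ((v : E n → 𝕜) ⋆[mul ℝ 𝕜, volume] u) :=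
    hu.contDiff_convolution_right _ v.continuous.locallyIntegrable h.smooth
  rw [hcoe]
  refine ⟨h.smooth.sub hsm, fun x hx => ?_, fun l hl x => ?_⟩
  · rw [Pi.sub_apply, h.eq_zero x (by linarith), zero_sub, neg_eq_zero, convolution_def]
    refine integral_eq_zero_of_ae (Filter.Eventually.of_forall fun y => ?_)
    by_cases hy : ε < ‖y‖
    · simp [hv.eq_zero y hy]
    · have : ρ < ‖x - y‖ := by
        have := norm_sub_norm_le x y
        linarith [not_lt.mp hy]
      simp [h.eq_zero _ this]
  · have hl' : (l : WithTop ℕ∞) ≤ ((⊤ : ℕ∞) : WithTop ℕ∞) := by norm_cast; exact le_top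
    rw [iteratedFDeriv_sub_apply ((h.smooth.of_le hl').contDiffAt) ((hsm.of_le hl').contDiffAt),
      iteratedFDeriv_convolution v.continuous.locallyIntegrable h.smooth hu]
    have hcont : Continuous (iteratedFDeriv ℝ l (u : E n → 𝕜)) :=
      h.smooth.continuous_iteratedFDeriv hl'
    refine (hv.norm_sub_integral_le (a := ε * (c * d ^ (l + 1))) hcont x fun y hy => ?_).trans ?_
    · have h2 : ContDiff ℝ 1 (iteratedFDeriv ℝ l (u : E n → 𝕜)) :=
        h.smooth.iteratedFDeriv_right (i := l) (m := 1) (by norm_cast; exact le_top)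
      have h3 := Convex.norm_image_sub_le_of_norm_fderiv_le (𝕜 := ℝ) (s := Set.univ)
        (f := iteratedFDeriv ℝ l (u : E n → 𝕜)) (C := c * d ^ (l + 1)) (x := x - y) (y := x)
        (fun z _ => (h2.differentiable (by norm_num)) z)
        (fun z _ => by
          rw [norm_fderiv_iteratedFDeriv]
          exact h.bound (l + 1) (by omega) z) convex_univ trivial trivial
      refine h3.trans ?_
      rw [sub_sub_cancel, mul_comm]
      gcongr
    · calc I * (ε * (c * d ^ (l + 1))) = (I * (ε * d)) * (c * d ^ l) := by ring
        _ ≤ g * (c * d ^ l) := by gcongr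
        _ = g * c * d ^ l := by ring

theorem KernelBound.sub_convOp_pow {d c ρ I ε g : ℝ} {m : ℕ} {u v : C(E n, 𝕜)} (a : ℕ)
    (h : KernelBound d (m + a) c ρ u) (hv : UnitKernel I ε v)
    (hd : 0 ≤ d) (hc : 0 ≤ c) (hε : 0 ≤ ε) (hg : I * (ε * d) ≤ g) :
    KernelBound d m (g ^ a * c) (ρ + a * ε) (((1 - convOp v) ^ a) u : C(E n, 𝕜)) := by
  have hg0 : 0 ≤ g := (mul_nonneg hv.nonneg (mul_nonneg hε hd)).trans hg
  induction a generalizing m with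
  | zero => simpa using h
  | succ a ih =>
    have h1 := ih (m := m + 1) (by rwa [add_assoc, add_comm 1 a])
    have h2 := h1.sub_convOp hv hd (by positivity) hε hg
    have h3 : ((1 - convOp v) ^ (a + 1)) u = (1 - convOp v) (((1 - convOp v) ^ a) u) := by
      rw [pow_succ', Module.End.mul_apply]
    rw [h3]
    convert h2 using 1
    · ring
    · push_cast; ring

theorem KernelBound.mono {d c c' ρ ρ' : ℝ} {m m' : ℕ} {u : E n → 𝕜}
    (h : KernelBound d m c ρ u) (hd : 0 ≤ d) (hm : m' ≤ m) (hc : c ≤ c') (hρ : ρ ≤ ρ') :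
    KernelBound d m' c' ρ' u :=
  ⟨h.smooth, fun x hx => h.eq_zero x (hρ.trans_lt hx), fun l hl x =>
    (h.bound l (hl.trans hm) x).trans (by gcongr)⟩

theorem KernelBound.norm_le {d c ρ : ℝ} {m : ℕ} {u : E n → 𝕜} (h : KernelBound d m c ρ u)
    (x : E n) : ‖u x‖ ≤ c := by
  simpa using h.bound 0 (Nat.zero_le _) x

theorem enorm_convOp_le {u : C(E n, 𝕜)} {a ρ : ℝ} (hb : ∀ x, ‖u x‖ ≤ a)
    (hz : ∀ x, ρ < ‖x‖ → u x = 0) (F : C(E n, 𝕜)) (x : E n) :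
    ‖convOp u F x‖ₑ ≤ ENNReal.ofReal a * ∫⁻ y in Metric.closedBall x ρ, ‖F y‖ₑ := by
  rw [convOp_apply (hasCompactSupport_of_eq_zero hz),
    ← integral_sub_left_eq_self (fun y => u y * F (x - y)) volume x]
  simp only [sub_sub_cancel]
  refine (enorm_integral_le_lintegral_enorm _).trans ?_
  rw [← lintegral_const_mul' _ _ ENNReal.ofReal_ne_top,
    ← lintegral_indicator Metric.isClosed_closedBall.measurableSet]
  refine lintegral_mono fun y => ?_
  by_cases hy : y ∈ Metric.closedBall x ρ
  · rw [Set.indicator_of_mem hy, enorm_mul]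
    gcongr
    rw [← ofReal_norm]
    exact ENNReal.ofReal_le_ofReal (hb _)
  · rw [Set.indicator_of_notMem hy, hz (x - y)]
    · simp
    · rw [Metric.mem_closedBall, dist_comm, dist_eq_norm] at hy
      exact not_le.mp hy

theorem UnitKernel.norm_sub_convOp_le {I ε a : ℝ} {v : C(E n, 𝕜)} (h : UnitKernel I ε v)
    (G : C(E n, 𝕜)) (x : E n) (ha : ∀ y, ‖y‖ ≤ ε → ‖G x - G (x - y)‖ ≤ a) :
    ‖((1 - convOp v) G) x‖ ≤ I * a := by
  have := h.norm_sub_integral_le G.continuous x ha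
  rwa [LinearMap.sub_apply, Module.End.one_apply, ContinuousMap.sub_apply,
    convOp_apply h.hasCompactSupport]

/-- Crude bound without any smoothness: each factor at most doubles the supremum, up to I, and
enlarges the neighbourhood by ε. -/
theorem UnitKernel.norm_sub_convOp_pow_le {I ε a : ℝ} {v : C(E n, 𝕜)} (h : UnitKernel I ε v)
    (hε : 0 ≤ ε) (m : ℕ) (G : C(E n, 𝕜)) (x : E n) (ha : ∀ y, ‖y - x‖ ≤ m * ε → ‖G y‖ ≤ a) :
    ‖(((1 - convOp v) ^ m) G) x‖ ≤ (2 * I) ^ m * a := by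
  induction m generalizing G a with
  | zero => simpa using ha x (by simp)
  | succ m ih =>
    rw [pow_succ, Module.End.mul_apply]
    refine (ih (a := I * (2 * a)) _ fun y hy => ?_).trans (le_of_eq (by ring))
    refine h.norm_sub_convOp_le G y fun z hz => (norm_sub_le _ _).trans ?_
    have h1 := ha y (by push_cast; linarith)
    have h2 := ha (y - z) (by
      have := norm_sub_le (y - x) z
      rw [show y - z - x = y - x - z by abel]
      push_cast; linarith)
    linarith

/-- One factor 1 - v* already annihilates the constant G(x), so oscillation replaces size; the
remaining m factors are handled crudely. -/
theorem UnitKernel.norm_sub_convOp_pow_succ_le {I ε η : ℝ} {v : C(E n, 𝕜)}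
    (h : UnitKernel I ε v) (hε : 0 ≤ ε) (m : ℕ) (G : C(E n, 𝕜)) (x : E n)
    (ha : ∀ y, ‖y - x‖ ≤ (m + 1) * ε → ‖G y - G x‖ ≤ η) :
    ‖(((1 - convOp v) ^ (m + 1)) G) x‖ ≤ (2 * I) ^ (m + 1) * η := by
  rw [pow_succ, Module.End.mul_apply]
  refine (h.norm_sub_convOp_pow_le (a := I * (2 * η)) hε m _ x fun y hy => ?_).trans
    (le_of_eq (by ring))
  refine h.norm_sub_convOp_le G y fun z hz => ?_
  have h1 := ha y (by linarith)
  have h2 := ha (y - z) (by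
    have := norm_sub_le (y - x) z
    rw [show y - z - x = y - x - z by abel]
    linarith)
  rw [show G y - G (y - z) = (G y - G x) - (G (y - z) - G x) by abel]
  exact (norm_sub_le _ _).trans (by linarith)

/-- The remainder of the reproducing formula vanishes pointwise: the supports shrink to 0 while the
L¹ norms stay below I, so continuity of G at x suffices. -/
theorem tendsto_sub_convOp_pow {I R : ℝ} (hR : 0 ≤ R) {V : ℕ → C(E n, 𝕜)}
    (hV : ∀ j, UnitKernel I (R * (1 / 2) ^ j) (V j)) (m k : ℕ) (G : C(E n, 𝕜)) (x : E n) :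
    Filter.Tendsto (fun i : ℕ => (((1 - convOp (V (k + i))) ^ (m + 1)) G) x) Filter.atTop
      (nhds 0) := by
  rw [Metric.tendsto_atTop]
  intro e he
  have hI : 0 ≤ I := (hV 0).nonneg
  obtain ⟨δ, hδ, hG⟩ := Metric.continuous_iff.mp G.continuous x (e / (2 * ((2 * I) ^ (m + 1) + 1)))
    (by positivity)
  have h0 : Filter.Tendsto (fun i : ℕ => (m + 1 : ℝ) * (R * (1 / 2) ^ (k + i))) Filter.atTop
      (nhds 0) := by
    have h1 : Filter.Tendsto (fun i : ℕ => (1 / 2 : ℝ) ^ i) Filter.atTop (nhds 0) :=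
      tendsto_pow_atTop_nhds_zero_of_lt_one (by norm_num) (by norm_num)
    have := h1.const_mul ((m + 1 : ℝ) * (R * (1 / 2) ^ k))
    rw [mul_zero] at this
    refine this.congr fun i => ?_
    rw [pow_add]; ring
  obtain ⟨N, hN⟩ := Filter.eventually_atTop.mp (h0.eventually_lt_const hδ)
  refine ⟨N, fun i hi => ?_⟩
  rw [dist_zero_right]
  refine ((hV (k + i)).norm_sub_convOp_pow_succ_le (by positivity) m G x
    (η := e / (2 * ((2 * I) ^ (m + 1) + 1))) fun y hy => ?_).trans_lt ?_
  · rw [← dist_eq_norm]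
    exact (hG y (by rw [dist_eq_norm]; exact hy.trans_lt (hN i hi))).le
  · have hp : 0 ≤ (2 * I) ^ (m + 1) := by positivity
    rw [← mul_div_assoc, div_lt_iff₀ (by positivity)]
    nlinarith


/-! ### The local means estimate -/

/-- Pointwise estimate of `F_k` by local means of the `F_j` with `j ≥ k`. -/
theorem exists_enorm_le_tsum_lintegral_closedBall {I R c : ℝ} (hR : 0 ≤ R) (hc : 0 ≤ c) (M : ℕ)
    {V v : ℕ → C(E n, 𝕜)} (hVU : ∀ j, UnitKernel I (R * (1 / 2) ^ j) (V j))
    (hVK : ∀ k, KernelBound (2 ^ k) M (c * 2 ^ (k * n)) (R * (1 / 2) ^ k) (V k))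
    (hvK : ∀ k, KernelBound (2 ^ k) M (c * 2 ^ (k * n)) (R * (1 / 2) ^ k) (v k))
    (hVv : ∀ j, V (j + 1) = V j + v (j + 1)) :
    ∃ C : ℝ≥0, ∀ F : ℕ → C(E n, 𝕜),
      (∀ j k, convOp (v j) (F k) = convOp (v k) (F j)) → ∀ k x,
      ‖F k x‖ₑ ≤ C * ∑' i : ℕ, ((2 : ℝ≥0∞)⁻¹) ^ (M * i) * 2 ^ (k * n) *
        ∫⁻ y in Metric.closedBall x ((M + 1) * R * (1 / 2) ^ k), ‖F (k + i) y‖ₑ := by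
  have hI : 0 ≤ I := (hVU 0).nonneg
  -- `g ≥ 1` lets g^M dominate the lower powers g^i. The factor 2 pays for an index shift: term i of
  -- the telescoped sum involves F_{k+i+1}, so it must decay like 2^{-M(i+1)}.
  set g : ℝ := max 1 (2 * (I * R)) with hg
  have hg1 : 1 ≤ g := le_max_left _ _
  have hg2 : 2 * (I * R) ≤ g := le_max_right _ _
  set C : ℝ := (M + 1) * (g ^ M * c) with hC
  have hC0 : 0 ≤ C := by positivity
  refine ⟨C.toNNReal, fun F hF k x => ?_⟩
  -- Support radius of the starting kernel plus at most M enlargements, each by at most R 2^{-k}.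
  set ρ : ℝ := (M + 1) * R * (1 / 2) ^ k with hρ
  set a : ℕ → ℝ≥0∞ := fun i => (C.toNNReal : ℝ≥0∞) * (((2 : ℝ≥0∞)⁻¹) ^ (M * i) * 2 ^ (k * n) *
    ∫⁻ y in Metric.closedBall x ρ, ‖F (k + i) y‖ₑ) with ha
  rw [← ENNReal.tsum_mul_left]
  have hof : ∀ i : ℕ, ENNReal.ofReal (C * (1 / 2) ^ (M * i) * 2 ^ (k * n)) =
      (C.toNNReal : ℝ≥0∞) * (((2 : ℝ≥0∞)⁻¹) ^ (M * i) * 2 ^ (k * n)) := fun i => by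
    rw [ENNReal.ofReal_mul (by positivity), ENNReal.ofReal_mul hC0,
      ENNReal.ofReal_pow (by norm_num), ENNReal.ofReal_pow (by norm_num), one_div,
      ENNReal.ofReal_inv_of_pos (by norm_num), mul_assoc]
    simp [ENNReal.ofReal]
  -- the two kinds of kernels
  have hker0 : ‖convOp ((∑ i ∈ Finset.range (M + 1), (1 - convOp (V k)) ^ i) (V k)) (F k) x‖ₑ
      ≤ a 0 := by
    have hpart : ∀ i ∈ Finset.range (M + 1), KernelBound (2 ^ k) 0 (g ^ M * (c * 2 ^ (k * n))) ρ
        (((1 - convOp (V k)) ^ i) (V k) : C(E n, 𝕜)) := fun i hi => by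
      have hi' : i ≤ M := by simpa [Nat.lt_succ_iff] using hi
      have h1 := ((hVK k).mono (m' := 0 + i) (by positivity) (by omega) le_rfl le_rfl).sub_convOp_pow
        i (hVU k) (by positivity) (by positivity) (by positivity) (g := g) (by
          have : I * (R * (1 / 2) ^ k * 2 ^ k) = I * R := by
            rw [mul_assoc R, ← mul_pow]; norm_num
          rw [this]; nlinarith [mul_nonneg hI hR])
      refine h1.mono (by positivity) le_rfl ?_ ?_
      · gcongr
      · have : (i : ℝ) ≤ M := by exact_mod_cast hi'
        have h3 : (i : ℝ) * (R * (1 / 2) ^ k) ≤ M * (R * (1 / 2) ^ k) := by gcongr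
        rw [hρ]; linarith
    refine (enorm_convOp_le (a := C * (1 / 2) ^ (M * 0) * 2 ^ (k * n)) (ρ := ρ) (fun y => ?_)
      (fun y hy => ?_) _ x).trans ?_
    · rw [LinearMap.sum_apply, ContinuousMap.sum_apply]
      refine (norm_sum_le_of_le _ fun i hi => (hpart i hi).norm_le y).trans ?_
      rw [Finset.sum_const, Finset.card_range, nsmul_eq_mul]
      push_cast
      rw [hC]; apply le_of_eq; ring
    · rw [LinearMap.sum_apply, ContinuousMap.sum_apply]
      exact Finset.sum_eq_zero fun i hi => (hpart i hi).eq_zero y hy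
    · rw [hof, ha, mul_assoc]; simp
  have hker : ∀ i, ‖convOp ((∑ l ∈ Finset.range (M + 1), (1 - convOp (V (k + i))) ^ l *
        (1 - convOp (V (k + i + 1))) ^ (M + 1 - 1 - l)) (v k)) (F (k + i + 1)) x‖ₑ
      ≤ a (i + 1) := fun i => by
    set b : ℝ := I * (R * (1 / 2) ^ (k + i) * 2 ^ k) with hb
    have hbe : b = I * R * (1 / 2) ^ i := by
      have : (1 / 2 : ℝ) ^ (k + i) * 2 ^ k = (1 / 2) ^ i := by
        rw [pow_add, mul_right_comm, ← mul_pow]; norm_num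
      rw [hb, mul_assoc R, this]; ring
    have hb0 : 0 ≤ b := by rw [hbe]; positivity
    have hbg : b ≤ g * (1 / 2) ^ (i + 1) := by
      rw [hbe, pow_succ]
      have : 2 * (I * R) * ((1 / 2) ^ i * (1 / 2)) ≤ g * ((1 / 2 : ℝ) ^ i * (1 / 2)) := by gcongr
      linarith
    have hpart : ∀ l ∈ Finset.range (M + 1), KernelBound (2 ^ k) 0 (b ^ M * (c * 2 ^ (k * n))) ρ
        (((1 - convOp (V (k + i))) ^ l * (1 - convOp (V (k + i + 1))) ^ (M + 1 - 1 - l)) (v k) :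
          C(E n, 𝕜)) := fun l hl => by
      have hl' : l ≤ M := by simpa [Nat.lt_succ_iff] using hl
      -- Both unit kernels are treated with the larger of their two radii, so all M factors gain the
      -- same `b`.
      have hεmono : R * (1 / 2 : ℝ) ^ (k + i + 1) ≤ R * (1 / 2) ^ (k + i) := by
        have : (1 / 2 : ℝ) ^ (k + i + 1) ≤ (1 / 2) ^ (k + i) :=
          pow_le_pow_of_le_one (by norm_num) (by norm_num) (Nat.le_succ _)
        gcongr
      have h1 := ((hvK k).mono (m' := l + (M - l)) (by positivity) (by omega) le_rfl
        le_rfl).sub_convOp_pow (M - l) ((hVU (k + i + 1)).mono hεmono) (by positivity)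
        (by positivity) (by positivity) (g := b) le_rfl
      have h2 := (h1.mono (m' := 0 + l) (by positivity) (by omega) le_rfl le_rfl).sub_convOp_pow l
        (hVU (k + i)) (by positivity) (by positivity) (by positivity) (g := b) le_rfl
      rw [Module.End.mul_apply, Nat.add_sub_cancel]
      refine h2.mono (by positivity) le_rfl ?_ ?_
      · rw [← mul_assoc, ← pow_add, Nat.add_sub_of_le hl']
      · have h3 : (1 / 2 : ℝ) ^ (k + i) ≤ (1 / 2) ^ k :=
          pow_le_pow_of_le_one (by norm_num) (by norm_num) (Nat.le_add_right _ _)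
        have h4 : (M : ℝ) * (R * (1 / 2 : ℝ) ^ (k + i)) ≤ M * (R * (1 / 2) ^ k) := by gcongr
        rw [add_assoc, ← add_mul, Nat.cast_sub hl', sub_add_cancel, hρ]
        linarith
    refine (enorm_convOp_le (a := C * (1 / 2) ^ (M * (i + 1)) * 2 ^ (k * n)) (ρ := ρ)
      (fun y => ?_) (fun y hy => ?_) _ x).trans ?_
    · rw [LinearMap.sum_apply, ContinuousMap.sum_apply]
      refine (norm_sum_le_of_le _ fun i hi => (hpart i hi).norm_le y).trans ?_
      rw [Finset.sum_const, Finset.card_range, nsmul_eq_mul]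
      push_cast
      have h5 : b ^ M ≤ g ^ M * (1 / 2) ^ (M * (i + 1)) := by
        rw [mul_comm M, pow_mul, ← mul_pow]
        exact pow_le_pow_left₀ hb0 hbg M
      calc ((M : ℝ) + 1) * (b ^ M * (c * 2 ^ (k * n)))
          ≤ ((M : ℝ) + 1) * (g ^ M * (1 / 2) ^ (M * (i + 1)) * (c * 2 ^ (k * n))) := by gcongr
        _ = _ := by rw [hC]; ring
    · rw [LinearMap.sum_apply, ContinuousMap.sum_apply]
      exact Finset.sum_eq_zero fun i hi => (hpart i hi).eq_zero y hy
    · rw [hof, ha, mul_assoc]; simp [add_assoc]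
  have hbound : ∀ J : ℕ, ‖F k x‖ₑ ≤ (∑' i, a i) +
      ‖(((1 - convOp (V (k + J))) ^ (M + 1)) (F k)) x‖ₑ := fun J => by
    have hid := telescoped_reproducing V v F (fun j => (hVU j).hasCompactSupport)
      (fun j => (hvK j).hasCompactSupport) hVv hF (M + 1) k J
    have hidx := congrArg (fun G : C(E n, 𝕜) => G x) hid
    simp only [ContinuousMap.add_apply] at hidx
    rw [hidx]
    refine (enorm_add_le _ _).trans (add_le_add ((enorm_add_le _ _).trans ?_) le_rfl)
    rw [tsum_eq_zero_add' ENNReal.summable]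
    refine add_le_add hker0 ?_
    rw [ContinuousMap.sum_apply]
    refine (enorm_sum_le _ _).trans ((Finset.sum_le_sum fun i _ => hker i).trans ?_)
    exact ENNReal.sum_le_tsum (f := fun i => a (i + 1)) _
  -- The bound holds for every truncation J; letting J tend to infinity removes the remainder.
  have hlim := (tendsto_sub_convOp_pow hR hVU M k (F k) x).enorm
  rw [enorm_zero] at hlim
  have hlim2 := hlim.const_add (∑' i, a i)
  rw [add_zero] at hlim2
  exact ge_of_tendsto' hlim2 hbound


/-! ### The kernels generated by φ₀ -/

theorem exists_kernelBound {ψ : E n → 𝕜} (hs : ContDiff ℝ ∞ ψ) (hψ : HasCompactSupport ψ) (M : ℕ) :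
    ∃ c ρ : ℝ, 0 ≤ c ∧ 0 ≤ ρ ∧ KernelBound 1 M c ρ ψ := by
  have h1 : ∀ l : ℕ, ∃ C : ℝ, ∀ x, ‖iteratedFDeriv ℝ l ψ x‖ ≤ C := fun l =>
    (hψ.iteratedFDeriv (𝕜 := ℝ) l).exists_bound_of_continuous
      (hs.continuous_iteratedFDeriv (by norm_cast; exact le_top))
  choose C hC using h1
  have hC0 : ∀ l, 0 ≤ C l := fun l => (norm_nonneg _).trans (hC l 0)
  obtain ⟨ρ, hρ⟩ := (hψ.isCompact.isBounded).subset_closedBall (0 : E n)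
  refine ⟨∑ l ∈ Finset.range (M + 1), C l, max ρ 0, Finset.sum_nonneg fun l _ => hC0 l,
    le_max_right _ _, hs, fun x hx => ?_, fun l hl x => ?_⟩
  · by_contra h
    have := hρ (subset_tsupport _ (Function.mem_support.mpr h))
    rw [mem_closedBall_zero_iff] at this
    exact absurd (this.trans (le_max_left ρ 0)) (not_le.mpr hx)
  · rw [one_pow, mul_one]
    exact (hC l x).trans (Finset.single_le_sum (f := C) (fun i _ => hC0 i)
      (Finset.mem_range.mpr (Nat.lt_succ_of_le hl)))

theorem KernelBound.dilate {ψ : E n → 𝕜} {c ρ : ℝ} {M : ℕ} (h : KernelBound 1 M c ρ ψ) (k : ℕ) :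
    KernelBound (2 ^ k) M (c * 2 ^ (k * n)) (ρ * (1 / 2) ^ k)
      (fun x => ((2 : ℝ) ^ (k * n)) • ψ ((2 : ℝ) ^ k • x)) := by
  have hs : ContDiff ℝ ∞ fun x => ψ ((2 : ℝ) ^ k • x) := h.smooth.comp (contDiff_id.const_smul _)
  refine ⟨hs.const_smul _, fun x hx => ?_, fun l hl x => ?_⟩
  · rw [h.eq_zero, smul_zero]
    rw [norm_smul, norm_pow, Real.norm_ofNat]
    calc ρ = 2 ^ k * (ρ * (1 / 2) ^ k) := by
          rw [mul_left_comm, ← mul_pow]; norm_num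
      _ < 2 ^ k * ‖x‖ := by gcongr
  · have hl' : (l : WithTop ℕ∞) ≤ ((⊤ : ℕ∞) : WithTop ℕ∞) := by norm_cast; exact le_top
    rw [iteratedFDeriv_const_smul_apply' ((hs.of_le hl').contDiffAt), norm_smul,
      iteratedFDeriv_comp_const_smul _ (h.smooth.of_le hl'), norm_smul]
    have h1 := h.bound l hl ((2 : ℝ) ^ k • x)
    rw [one_pow, mul_one] at h1
    rw [norm_pow, norm_pow, norm_pow, Real.norm_ofNat]
    calc (2 : ℝ) ^ (k * n) * ((2 ^ k) ^ l * ‖iteratedFDeriv ℝ l ψ ((2 : ℝ) ^ k • x)‖)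
        ≤ (2 : ℝ) ^ (k * n) * ((2 ^ k) ^ l * c) := by gcongr
      _ = _ := by ring

/-- The dilated low-pass kernel `2^{kn} φ₀(2^k x)`. -/
def lowPass (φ₀ : 𝓓((⊤ : Opens (E n)), 𝕜)) (k : ℕ) : C(E n, 𝕜) where
  toFun x := ((2 : ℝ) ^ (k * n)) • φ₀ ((2 : ℝ) ^ k • x)
  continuous_toFun := by
    have h : Continuous (φ₀ : E n → 𝕜) := φ₀.continuous
    fun_prop

/-- `φ_k` as a continuous map. -/
def bandPass (φ₀ : 𝓓((⊤ : Opens (E n)), 𝕜)) (k : ℕ) : C(E n, 𝕜) where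
  toFun := phiSeq φ₀ k
  continuous_toFun := (contDiff_phiSeq φ₀ k).continuous

/-- The definition of φ is made for this: after dilation, φ_{j+1} is the difference of two
consecutive low-pass kernels. -/
theorem lowPass_succ (φ₀ : 𝓓((⊤ : Opens (E n)), 𝕜)) (j : ℕ) :
    lowPass φ₀ (j + 1) = lowPass φ₀ j + bandPass φ₀ (j + 1) := by
  ext x
  have h1 : (2 : ℝ)⁻¹ • (2 : ℝ) ^ (j + 1) • x = (2 : ℝ) ^ j • x := by
    rw [smul_smul, pow_succ]; congr 1; ring
  have h2 : (2 : ℝ) ^ ((j + 1) * n) * ((2 : ℝ) ^ n)⁻¹ = 2 ^ (j * n) := by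
    rw [add_mul, one_mul, pow_add]; field_simp
  simp only [lowPass, bandPass, phiSeq, phi, ContinuousMap.coe_mk, ContinuousMap.add_apply,
    Nat.succ_ne_zero, if_false, h1, smul_sub, smul_smul, h2]
  abel

theorem contDiff_phi (φ₀ : 𝓓((⊤ : Opens (E n)), 𝕜)) : ContDiff ℝ ∞ (phi φ₀) := by
  have h : ContDiff ℝ ∞ (φ₀ : E n → 𝕜) := φ₀.contDiff
  exact h.sub ((h.comp (contDiff_id.const_smul (2 : ℝ)⁻¹)).const_smul ((2 : ℝ) ^ n)⁻¹)

theorem hasCompactSupport_phi (φ₀ : 𝓓((⊤ : Opens (E n)), 𝕜)) : HasCompactSupport (phi φ₀) := by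
  have h : HasCompactSupport (φ₀ : E n → 𝕜) := φ₀.hasCompactSupport
  have h3 : HasCompactSupport (fun x : E n => φ₀ ((2 : ℝ)⁻¹ • x)) := h.comp_smul (by norm_num)
  exact h.sub (h3.smul_left (f := fun _ => ((2 : ℝ) ^ n)⁻¹))

theorem exists_kernelBound_lowPass_bandPass (φ₀ : 𝓓((⊤ : Opens (E n)), 𝕜)) (M : ℕ) :
    ∃ c R : ℝ, 0 ≤ c ∧ 0 ≤ R ∧
      (∀ k, KernelBound (2 ^ k) M (c * 2 ^ (k * n)) (R * (1 / 2) ^ k) (lowPass φ₀ k)) ∧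
      ∀ k, KernelBound (2 ^ k) M (c * 2 ^ (k * n)) (R * (1 / 2) ^ k) (bandPass φ₀ k) := by
  obtain ⟨c₁, R₁, hc₁, hR₁, h₁⟩ := exists_kernelBound φ₀.contDiff φ₀.hasCompactSupport M
  obtain ⟨c₂, R₂, hc₂, hR₂, h₂⟩ := exists_kernelBound (contDiff_phi φ₀) (hasCompactSupport_phi φ₀) M
  have h₁' := h₁.mono (m' := M) (c' := max c₁ c₂) (ρ' := max R₁ R₂) zero_le_one le_rfl
    (le_max_left _ _) (le_max_left _ _)
  have h₂' := h₂.mono (m' := M) (c' := max c₁ c₂) (ρ' := max R₁ R₂) zero_le_one le_rfl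
    (le_max_right _ _) (le_max_right _ _)
  refine ⟨max c₁ c₂, max R₁ R₂, le_max_of_le_left hc₁, le_max_of_le_left hR₁,
    fun k => h₁'.dilate k, fun k => ?_⟩
  rcases Nat.eq_zero_or_pos k with rfl | hk
  · convert h₁'.dilate 0 using 1
    ext x; simp [bandPass, phiSeq]
  · convert h₂'.dilate k using 1
    ext x; simp [bandPass, phiSeq, hk.ne']

theorem unitKernel_lowPass (φ₀ : 𝓓((⊤ : Opens (E n)), 𝕜)) (hφ₀ : ∫ x, φ₀ x = 1) {c R : ℝ} {M j : ℕ}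
    (h : KernelBound (2 ^ j) M (c * 2 ^ (j * n)) (R * (1 / 2) ^ j) (lowPass φ₀ j)) :
    UnitKernel (∫ x, ‖φ₀ x‖) (R * (1 / 2) ^ j) (lowPass φ₀ j) := by
  have hcast : |((2 : ℝ) ^ j) ^ n|⁻¹ = ((2 : ℝ) ^ (j * n))⁻¹ := by
    rw [abs_of_pos (by positivity), ← pow_mul]
  refine ⟨(lowPass φ₀ j).continuous, h.eq_zero, ?_, le_of_eq ?_⟩
  · simp only [lowPass, ContinuousMap.coe_mk]
    rw [integral_smul, Measure.integral_comp_smul, finrank_euclideanSpace_fin, hφ₀, abs_inv, hcast,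
      smul_smul, mul_inv_cancel₀ (by positivity), one_smul]
  · simp only [lowPass, ContinuousMap.coe_mk, norm_smul, norm_pow, Real.norm_ofNat]
    rw [integral_const_mul, Measure.integral_comp_smul volume (fun x => ‖φ₀ x‖),
      finrank_euclideanSpace_fin, abs_inv, hcast, smul_eq_mul, ← mul_assoc,
      mul_inv_cancel₀ (by positivity), one_mul]

theorem exists_enorm_le_tsum_lintegral_bandPass (φ₀ : 𝓓((⊤ : Opens (E n)), 𝕜))
    (hφ₀ : ∫ x, φ₀ x = 1) (M : ℕ) :
    ∃ (C : ℝ≥0) (ρ : ℝ), 0 ≤ ρ ∧ ∀ F : ℕ → C(E n, 𝕜),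
      (∀ j k, convOp (bandPass φ₀ j) (F k) = convOp (bandPass φ₀ k) (F j)) → ∀ k x,
      ‖F k x‖ₑ ≤ C * ∑' i : ℕ, ((2 : ℝ≥0∞)⁻¹) ^ (M * i) * 2 ^ (k * n) *
        ∫⁻ y in Metric.closedBall x (ρ * (1 / 2) ^ k), ‖F (k + i) y‖ₑ := by
  obtain ⟨c, R, hc, hR, h₁, h₂⟩ := exists_kernelBound_lowPass_bandPass φ₀ M
  obtain ⟨C, hC⟩ := exists_enorm_le_tsum_lintegral_closedBall hR hc M
    (fun j => unitKernel_lowPass φ₀ hφ₀ (h₁ j)) h₁ h₂ (lowPass_succ φ₀)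
  exact ⟨C, (M + 1) * R, by positivity, hC⟩


/-! ### Distributions of exponential growth: jets, continuity, commutation -/

theorem KernelBound.comp_neg {d c ρ : ℝ} {m : ℕ} {u : E n → 𝕜} (h : KernelBound d m c ρ u) :
    KernelBound d m c ρ (fun x => u (-x)) := by
  refine ⟨h.smooth.comp contDiff_neg, fun x hx => h.eq_zero _ (by rwa [norm_neg]),
    fun l hl x => ?_⟩
  have h1 : (fun x : E n => u (-x)) = fun x => u ((-1 : ℝ) • x) := by ext x; simp
  have hl' : (l : WithTop ℕ∞) ≤ ((⊤ : ℕ∞) : WithTop ℕ∞) := by norm_cast; exact le_top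
  rw [h1, iteratedFDeriv_comp_const_smul _ (h.smooth.of_le hl'), norm_smul]
  simpa using h.bound l hl (-x)

theorem iteratedFDeriv_eq_zero_of_lt_norm {u : E n → 𝕜} {ρ : ℝ}
    (h : ∀ x, ρ < ‖x‖ → u x = 0) (i : ℕ) {x : E n} (hx : ρ < ‖x‖) :
    iteratedFDeriv ℝ i u x = 0 := by
  have h1 : tsupport u ⊆ Metric.closedBall 0 ρ := by
    refine closure_minimal (fun y hy => ?_) Metric.isClosed_closedBall
    rw [mem_closedBall_zero_iff]
    by_contra hc
    exact hy (h y (not_le.mp hc))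
  by_contra hc
  have h2 := h1 (support_iteratedFDeriv_subset (𝕜 := ℝ) i (Function.mem_support.mpr hc))
  rw [mem_closedBall_zero_iff] at h2
  exact absurd h2 (not_le.mpr hx)

instance compactSpace_closedBall (R : ℝ) : CompactSpace (Metric.closedBall (0 : E n) R) :=
  isCompact_iff_compactSpace.mp (isCompact_closedBall _ _)

variable (𝕜 n) in
/-- Jets of order at most `N` on the closed ball of radius `R`. -/
def JetSpace (N : ℕ) (R : ℝ) : Type _ :=
  ∀ i : Fin (N + 1), C(Metric.closedBall (0 : E n) R, E n [×i]→L[ℝ] 𝕜)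

instance (N : ℕ) (R : ℝ) : NormedAddCommGroup (JetSpace 𝕜 n N R) :=
  inferInstanceAs (NormedAddCommGroup
    (∀ i : Fin (N + 1), C(Metric.closedBall (0 : E n) R, E n [×i]→L[ℝ] 𝕜)))

instance (N : ℕ) (R : ℝ) : NormedSpace 𝕜 (JetSpace 𝕜 n N R) :=
  inferInstanceAs (NormedSpace 𝕜
    (∀ i : Fin (N + 1), C(Metric.closedBall (0 : E n) R, E n [×i]→L[ℝ] 𝕜)))

instance (N : ℕ) (R : ℝ) : NormedSpace ℝ (JetSpace 𝕜 n N R) := NormedSpace.restrictScalars ℝ 𝕜 _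

instance (N : ℕ) (R : ℝ) : CompleteSpace (JetSpace 𝕜 n N R) :=
  inferInstanceAs (CompleteSpace
    (∀ i : Fin (N + 1), C(Metric.closedBall (0 : E n) R, E n [×i]→L[ℝ] 𝕜)))

/-- Evaluation of a jet. -/
def JetSpace.eval {N : ℕ} {R : ℝ} (i : Fin (N + 1)) (z : Metric.closedBall (0 : E n) R) :
    JetSpace 𝕜 n N R →L[𝕜] E n [×i]→L[ℝ] 𝕜 :=
  LinearMap.mkContinuous { toFun := fun J => J i z, map_add' := fun _ _ => rfl,
                           map_smul' := fun _ _ => rfl } 1 fun J => by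
    rw [one_mul]
    exact ((J i).norm_coe_le_norm z).trans (norm_le_pi_norm (ι := Fin (N + 1)) (f := J) i)

variable (𝕜 n) in
/-- Test functions supported in the closed ball of radius `R`. -/
def testBall (R : ℝ) : Submodule 𝕜 𝓓((⊤ : Opens (E n)), 𝕜) where
  carrier := {η | ∀ x, R < ‖x‖ → η x = 0}
  add_mem' := fun {a b} ha hb x hx => by
    change a x + b x = 0
    rw [ha x hx, hb x hx, add_zero]
  zero_mem' := fun x _ => rfl
  smul_mem' := fun c a ha x hx => by
    change c • a x = 0
    rw [ha x hx, smul_zero]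

/-- The jet of a test function. -/
def jet (N : ℕ) (R : ℝ) : 𝓓((⊤ : Opens (E n)), 𝕜) →ₗ[𝕜] JetSpace 𝕜 n N R where
  toFun η i := ⟨fun z => iteratedFDeriv ℝ i η z,
    (η.contDiff.continuous_iteratedFDeriv (by norm_cast; exact le_top)).comp continuous_subtype_val⟩
  map_add' η ζ := by
    refine funext fun i => ContinuousMap.ext fun z => ?_
    have hl : ((i : ℕ) : WithTop ℕ∞) ≤ ((⊤ : ℕ∞) : WithTop ℕ∞) := by norm_cast; exact le_top
    exact iteratedFDeriv_add_apply ((η.contDiff.of_le hl).contDiffAt)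
      ((ζ.contDiff.of_le hl).contDiffAt)
  map_smul' c η := by
    refine funext fun i => ContinuousMap.ext fun z => ?_
    have hl : ((i : ℕ) : WithTop ℕ∞) ≤ ((⊤ : ℕ∞) : WithTop ℕ∞) := by norm_cast; exact le_top
    exact iteratedFDeriv_const_smul_apply ((η.contDiff.of_le hl).contDiffAt)

/-- Distributions of exponential growth act on test functions with support in a fixed ball through
a continuous functional on jets. -/
theorem IsExpGrowth.exists_jet_functional {f : Distr 𝕜 n} (hf : IsExpGrowth f) :
    ∃ N : ℕ, ∀ R : ℝ, ∃ Λ : JetSpace 𝕜 n N R →L[𝕜] 𝕜, ∀ η ∈ testBall 𝕜 n R, f η = Λ (jet N R η) := by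
  obtain ⟨C, N, hN⟩ := hf
  refine ⟨N, fun R => ?_⟩
  set J : testBall 𝕜 n R →ₗ[𝕜] JetSpace 𝕜 n N R := (jet N R).comp (testBall 𝕜 n R).subtype with hJ
  set g : testBall 𝕜 n R →ₗ[𝕜] 𝕜 := f.toLinearMap.comp (testBall 𝕜 n R).subtype with hg
  -- Derivatives of η vanish outside the ball, and inside it the exponential weight is at most
  -- e^{NR}.
  have hbound : ∀ η : testBall 𝕜 n R, ‖g η‖ ≤ (C * Real.exp (N * R)) * ‖J η‖ := fun η => by
    have h1 : ‖f η.1‖ₑ ≤ C * ENNReal.ofReal (‖J η‖ * Real.exp (N * R)) := by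
      refine (hN η.1).trans (mul_le_mul_right (iSup_le fun x => iSup_le fun i => iSup_le fun hi => ?_) _)
      by_cases hx : R < ‖x‖
      · rw [iteratedFDeriv_eq_zero_of_lt_norm η.2 i hx]; simp
      · rw [not_lt] at hx
        rw [ENNReal.ofReal_mul (norm_nonneg _), ← ofReal_norm]
        have h2 : ‖iteratedFDeriv ℝ i η.1 x‖ ≤ ‖J η‖ := by
          have h3 := (J η ⟨i, Nat.lt_succ_of_le hi⟩).norm_coe_le_norm ⟨x, by simpa using hx⟩
          exact h3.trans (norm_le_pi_norm (ι := Fin (N + 1)) (f := J η) _)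
        gcongr
    have h4 := ENNReal.toReal_mono (by finiteness) h1
    rw [ENNReal.toReal_mul, ENNReal.toReal_ofReal (by positivity), toReal_enorm] at h4
    refine h4.trans (le_of_eq ?_)
    simp only [ENNReal.coe_toReal]; ring
  -- By the bound, f depends on η only through its jet; the induced bounded functional on the range
  -- of `J` is then extended by Hahn–Banach.
  have hker : LinearMap.ker J ≤ LinearMap.ker g := fun η hη => by
    rw [LinearMap.mem_ker] at hη ⊢
    have := hbound η
    rw [hη, norm_zero (E := JetSpace 𝕜 n N R), mul_zero] at this
    exact norm_le_zero_iff.mp this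
  set g' : LinearMap.range J →ₗ[𝕜] 𝕜 :=
    ((LinearMap.ker J).liftQ g hker).comp J.quotKerEquivRange.symm.toLinearMap with hg'
  have hg'J : ∀ η, g' ⟨J η, LinearMap.mem_range_self J η⟩ = g η := fun η => by
    have : J.quotKerEquivRange.symm ⟨J η, LinearMap.mem_range_self J η⟩ =
        (LinearMap.ker J).mkQ η := by
      rw [LinearEquiv.symm_apply_eq]; rfl
    rw [hg', LinearMap.comp_apply, LinearEquiv.coe_coe, this]
    rfl
  obtain ⟨Λ, hΛ, -⟩ := exists_extension_norm_eq (LinearMap.range J)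
    (g'.mkContinuous (C * Real.exp (N * R)) (by
      rintro ⟨_, η, rfl⟩
      rw [hg'J]
      exact hbound η))
  refine ⟨Λ, fun η hη => ?_⟩
  have h5 := hΛ ⟨J ⟨η, hη⟩, LinearMap.mem_range_self J ⟨η, hη⟩⟩
  rw [LinearMap.mkContinuous_apply, hg'J] at h5
  exact h5.symm

/-- `φ_k(-x)` as a continuous map. -/
def reflected (φ₀ : 𝓓((⊤ : Opens (E n)), 𝕜)) (k : ℕ) (x : E n) : 𝕜 := phiSeq φ₀ k (-x)

theorem contDiff_reflected (φ₀ : 𝓓((⊤ : Opens (E n)), 𝕜)) (k : ℕ) :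
    ContDiff ℝ ∞ (reflected φ₀ k) := (contDiff_phiSeq φ₀ k).comp contDiff_neg

theorem hasCompactSupport_reflected (φ₀ : 𝓓((⊤ : Opens (E n)), 𝕜)) (k : ℕ) :
    HasCompactSupport (reflected φ₀ k) :=
  (hasCompactSupport_phiSeq φ₀ k).comp_homeomorph (Homeomorph.neg (E n))

theorem iteratedFDeriv_shifted (φ₀ : 𝓓((⊤ : Opens (E n)), 𝕜)) (k i : ℕ) (x z : E n) :
    iteratedFDeriv ℝ i (shifted φ₀ k x) z = iteratedFDeriv ℝ i (reflected φ₀ k) (z - x) := by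
  have h : (shifted φ₀ k x : E n → 𝕜) = fun z => reflected φ₀ k (z - x) := by
    ext z
    change phiSeq φ₀ k (x - z) = phiSeq φ₀ k (-(z - x))
    rw [neg_sub]
  rw [h, iteratedFDeriv_comp_sub']

theorem continuous_jet_shifted (φ₀ : 𝓓((⊤ : Opens (E n)), 𝕜)) (k N : ℕ) (R : ℝ) :
    Continuous fun x => jet N R (shifted φ₀ k x) := by
  refine continuous_pi (ι := Fin (N + 1))
    (A := fun i => C(Metric.closedBall (0 : E n) R, E n [×i]→L[ℝ] 𝕜)) fun i => ?_
  have h1 : Continuous (iteratedFDeriv ℝ i (reflected φ₀ k)) :=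
    (contDiff_reflected φ₀ k).continuous_iteratedFDeriv (by norm_cast; exact le_top)
  refine ContinuousMap.continuous_of_continuous_uncurry _ ?_
  have h2 : (Function.uncurry fun (x : E n) (z : Metric.closedBall (0 : E n) R) =>
      (jet N R (shifted φ₀ k x) i) z) = fun p : E n × Metric.closedBall (0 : E n) R =>
      iteratedFDeriv ℝ i (reflected φ₀ k) (p.2 - p.1) := by
    ext1 p
    exact iteratedFDeriv_shifted φ₀ k i p.1 p.2
  exact h2 ▸ h1.comp ((continuous_subtype_val.comp continuous_snd).sub continuous_fst)

theorem shifted_mem_testBall {φ₀ : 𝓓((⊤ : Opens (E n)), 𝕜)} {k : ℕ} {ρ R : ℝ}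
    (h : ∀ x, ρ < ‖x‖ → phiSeq φ₀ k x = 0) {x : E n} (hx : ‖x‖ + ρ ≤ R) :
    shifted φ₀ k x ∈ testBall 𝕜 n R := fun z hz => by
  refine h (x - z) ?_
  have := norm_sub_norm_le z x
  rw [norm_sub_rev] at this
  linarith

theorem integrable_smul_jet_shifted (φ₀ : 𝓓((⊤ : Opens (E n)), 𝕜)) (j k N : ℕ) (R : ℝ)
    (x : E n) : Integrable fun y => phiSeq φ₀ j y • jet N R (shifted φ₀ k (x - y)) :=
  ((contDiff_phiSeq φ₀ j).continuous.smul ((continuous_jet_shifted φ₀ k N R).comp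
    (continuous_const.sub continuous_id))).integrable_of_hasCompactSupport
      (hasCompactSupport_phiSeq φ₀ j).smul_right

/-- At each point z and order i, both integrals are the i-th derivative at z - x of the convolution
of the two reflected kernels, which is commutative. -/
theorem integral_smul_jet_shifted_comm (φ₀ : 𝓓((⊤ : Opens (E n)), 𝕜)) (j k N : ℕ) (R : ℝ)
    (x : E n) :
    ∫ y, phiSeq φ₀ j y • jet N R (shifted φ₀ k (x - y)) =
      ∫ y, phiSeq φ₀ k y • jet N R (shifted φ₀ j (x - y)) := by
  refine funext fun i => ContinuousMap.ext fun z => ?_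
  have heval : ∀ j k, (∫ y, phiSeq φ₀ j y • jet N R (shifted φ₀ k (x - y))) i z =
      iteratedFDeriv ℝ i (reflected φ₀ j ⋆[mul ℝ 𝕜, volume] reflected φ₀ k) (z - x) := by
    intro j k
    have h1 := (JetSpace.eval (𝕜 := 𝕜) i z).integral_comp_comm (integrable_smul_jet_shifted φ₀ j k N R x)
    refine h1.symm.trans ?_
    rw [iteratedFDeriv_convolution (contDiff_reflected φ₀ j).continuous.locallyIntegrable
      (contDiff_reflected φ₀ k) (hasCompactSupport_reflected φ₀ k), ← integral_neg_eq_self]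
    refine integral_congr_ae (Filter.Eventually.of_forall fun y => ?_)
    change phiSeq φ₀ j (-y) • iteratedFDeriv ℝ i (shifted φ₀ k (x - -y)) z = _
    rw [iteratedFDeriv_shifted]
    change phiSeq φ₀ j (-y) • _ = phiSeq φ₀ j (-y) • _
    congr 2
    abel
  rw [heval, heval, ← convolution_flip]
  congr 2
  ext
  simp

theorem exists_phiSeq_eq_zero (φ₀ : 𝓓((⊤ : Opens (E n)), 𝕜)) (k : ℕ) :
    ∃ ρ : ℝ, ∀ x, ρ < ‖x‖ → phiSeq φ₀ k x = 0 := by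
  obtain ⟨c, ρ, -, -, h⟩ := exists_kernelBound (contDiff_phiSeq φ₀ k) (hasCompactSupport_phiSeq φ₀ k) 0
  exact ⟨ρ, h.eq_zero⟩

theorem IsExpGrowth.continuous_conv {f : Distr 𝕜 n} (hf : IsExpGrowth f)
    (φ₀ : 𝓓((⊤ : Opens (E n)), 𝕜)) (k : ℕ) : Continuous (conv φ₀ f k) := by
  obtain ⟨N, hN⟩ := hf.exists_jet_functional
  obtain ⟨ρ, hρ⟩ := exists_phiSeq_eq_zero φ₀ k
  rw [continuous_iff_continuousAt]
  intro x
  obtain ⟨Λ, hΛ⟩ := hN (‖x‖ + 1 + ρ)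
  have h1 : ContinuousAt (fun y => Λ (jet N (‖x‖ + 1 + ρ) (shifted φ₀ k y))) x :=
    (Λ.continuous.comp (continuous_jet_shifted φ₀ k N _)).continuousAt
  refine h1.congr ?_
  -- For y near x all translated kernels lie in one ball, so a single functional `Λ` represents f on
  -- them.
  filter_upwards [continuous_norm.continuousAt.eventually_lt (continuousAt_const (y := ‖x‖ + 1))
    (by linarith : ‖x‖ < ‖x‖ + 1)] with y hy
  exact (hΛ _ (shifted_mem_testBall hρ (by linarith))).symm

/-- The symmetry required by `telescoped_reproducing`. A continuous functional on the Banach space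
of jets commutes with the Bochner integral, which reduces the claim to the commutation of the
kernels. -/
theorem IsExpGrowth.integral_phiSeq_mul_conv_comm {f : Distr 𝕜 n} (hf : IsExpGrowth f)
    (φ₀ : 𝓓((⊤ : Opens (E n)), 𝕜)) (j k : ℕ) (x : E n) :
    ∫ y, phiSeq φ₀ j y * conv φ₀ f k (x - y) = ∫ y, phiSeq φ₀ k y * conv φ₀ f j (x - y) := by
  obtain ⟨N, hN⟩ := hf.exists_jet_functional
  obtain ⟨ρ₁, h₁⟩ := exists_phiSeq_eq_zero φ₀ j
  obtain ⟨ρ₂, h₂⟩ := exists_phiSeq_eq_zero φ₀ k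
  obtain ⟨Λ, hΛ⟩ := hN (‖x‖ + ρ₁ + ρ₂)
  -- Stated with free radii of fixed sum, so that both orders of the kernels use the same ball and
  -- the same `Λ`.
  have key : ∀ (j k : ℕ) (ρ₁' ρ₂' : ℝ), ρ₁' + ρ₂' = ρ₁ + ρ₂ →
      (∀ x, ρ₁' < ‖x‖ → phiSeq φ₀ j x = 0) → (∀ x, ρ₂' < ‖x‖ → phiSeq φ₀ k x = 0) →
      ∫ y, phiSeq φ₀ j y * conv φ₀ f k (x - y) =
        Λ (∫ y, phiSeq φ₀ j y • jet N (‖x‖ + ρ₁ + ρ₂) (shifted φ₀ k (x - y))) := by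
    intro j k ρ₁' ρ₂' hs h₁ h₂
    rw [← Λ.integral_comp_comm (integrable_smul_jet_shifted φ₀ j k N _ x)]
    refine integral_congr_ae (Filter.Eventually.of_forall fun y => ?_)
    beta_reduce
    rw [map_smul, smul_eq_mul]
    by_cases hy : ρ₁' < ‖y‖
    · rw [h₁ y hy, zero_mul, zero_mul]
    · congr 1
      refine hΛ _ (shifted_mem_testBall h₂ ?_)
      have := norm_sub_le x y
      linarith [not_lt.mp hy]
  rw [key j k ρ₁ ρ₂ rfl h₁ h₂, key k j ρ₂ ρ₁ (add_comm _ _) h₂ h₁,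
    integral_smul_jet_shifted_comm]

/-- A priori growth, needed only to know that maximal functions are finite. The kernel φ_k has size
2^{kn} and each of at most N derivatives costs 2^k; one exponent n + N serves both for k and for
|x|. -/
theorem IsExpGrowth.exists_enorm_conv_le {f : Distr 𝕜 n} (hf : IsExpGrowth f)
    (φ₀ : 𝓓((⊤ : Opens (E n)), 𝕜)) :
    ∃ (C : ℝ≥0) (N : ℕ), ∀ k x,
      ‖conv φ₀ f k x‖ₑ ≤ C * 2 ^ (k * N) * ENNReal.ofReal (Real.exp (N * ‖x‖)) := by
  obtain ⟨C, N, hN⟩ := hf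
  obtain ⟨c, R, hc, hR, -, h⟩ := exists_kernelBound_lowPass_bandPass φ₀ N
  refine ⟨C * (c * Real.exp (N * R)).toNNReal, n + N, fun k x => ?_⟩
  have hk := (h k).comp_neg
  have h1 : ∀ i ≤ N, ∀ z, ‖iteratedFDeriv ℝ i (shifted φ₀ k x) z‖ₑ *
      ENNReal.ofReal (Real.exp (N * ‖z‖)) ≤
      ENNReal.ofReal (c * Real.exp (N * R) * 2 ^ (k * (n + N)) * Real.exp ((n + N) * ‖x‖)) := by
    intro i hi z
    rw [iteratedFDeriv_shifted, ← ofReal_norm, ← ENNReal.ofReal_mul (norm_nonneg _)]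
    refine ENNReal.ofReal_le_ofReal ?_
    by_cases hz : R * (1 / 2) ^ k < ‖z - x‖
    · have h0 : iteratedFDeriv ℝ i (reflected φ₀ k) (z - x) = 0 :=
        iteratedFDeriv_eq_zero_of_lt_norm hk.eq_zero i hz
      rw [h0, norm_zero, zero_mul]
      positivity
    · have hb : ‖iteratedFDeriv ℝ i (reflected φ₀ k) (z - x)‖ ≤ c * 2 ^ (k * n) * (2 ^ k) ^ i :=
        hk.bound i hi (z - x)
      have hzx : ‖z‖ ≤ R + ‖x‖ := by
        have h2 := norm_sub_norm_le z x
        have h3 : R * (1 / 2) ^ k ≤ R * 1 := by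
          gcongr; exact pow_le_one₀ (by norm_num) (by norm_num)
        linarith [not_lt.mp hz]
      have he : Real.exp (N * ‖z‖) ≤ Real.exp (N * R) * Real.exp ((n + N) * ‖x‖) := by
        rw [← Real.exp_add]
        refine Real.exp_le_exp.mpr ?_
        have h4 : (N : ℝ) * ‖z‖ ≤ N * (R + ‖x‖) := by gcongr
        nlinarith [norm_nonneg x, (Nat.cast_nonneg n : (0 : ℝ) ≤ n)]
      have h2k : ((2 : ℝ) ^ k) ^ i ≤ 2 ^ (k * N) := by
        rw [← pow_mul]
        exact pow_le_pow_right₀ (by norm_num) (Nat.mul_le_mul_left k hi)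
      calc _ ≤ (c * 2 ^ (k * n) * 2 ^ (k * N)) * (Real.exp (N * R) * Real.exp ((n + N) * ‖x‖)) := by
            gcongr
            exact hb.trans (by gcongr)
        _ = _ := by rw [mul_add k, pow_add]; ring
  refine (hN _).trans ((mul_le_mul_right (iSup_le fun z => iSup_le fun i => iSup_le fun hi =>
    h1 i hi z) _).trans (le_of_eq ?_))
  rw [ENNReal.ofReal_mul (by positivity), ENNReal.ofReal_mul (by positivity),
    ENNReal.ofReal_pow (by norm_num)]
  push_cast
  simp only [ENNReal.ofReal, Real.toNNReal_ofNat, ENNReal.coe_ofNat]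
  ring

/-- `φ_k * f` as a continuous map. -/
def IsExpGrowth.convMap {f : Distr 𝕜 n} (hf : IsExpGrowth f) (φ₀ : 𝓓((⊤ : Opens (E n)), 𝕜))
    (k : ℕ) : C(E n, 𝕜) := ⟨conv φ₀ f k, hf.continuous_conv φ₀ k⟩

/-- Local means estimate for distributions of exponential growth. -/
theorem exists_enorm_conv_le_tsum_lintegral (φ₀ : 𝓓((⊤ : Opens (E n)), 𝕜))
    (hφ₀ : ∫ x, φ₀ x = 1) (M : ℕ) :
    ∃ (C : ℝ≥0) (ρ : ℝ), 0 ≤ ρ ∧ ∀ f : Distr 𝕜 n, IsExpGrowth f → ∀ k x,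
      ‖conv φ₀ f k x‖ₑ ≤ C * ∑' i : ℕ, ((2 : ℝ≥0∞)⁻¹) ^ (M * i) * 2 ^ (k * n) *
        ∫⁻ y in Metric.closedBall x (ρ * (1 / 2) ^ k), ‖conv φ₀ f (k + i) y‖ₑ := by
  obtain ⟨C, ρ, hρ, h⟩ := exists_enorm_le_tsum_lintegral_bandPass φ₀ hφ₀ M
  refine ⟨C, ρ, hρ, fun f hf k x => ?_⟩
  have hcoe : ∀ k x, hf.convMap φ₀ k x = conv φ₀ f k x := fun _ _ => rfl
  have hbp : ∀ k x, bandPass φ₀ k x = phiSeq φ₀ k x := fun _ _ => rfl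
  have hbc : ∀ k, HasCompactSupport (bandPass φ₀ k) := hasCompactSupport_phiSeq φ₀
  have h1 := h (hf.convMap φ₀) (fun j k => by
    ext x
    rw [convOp_apply (hbc j), convOp_apply (hbc k)]
    simp only [hcoe, hbp]
    exact hf.integral_phiSeq_mul_conv_comm φ₀ j k x) k x
  simpa only [hcoe] using h1


/-! ### Peetre maximal functions and passage to μ-means -/

/-- The exponential weight `exp (-B 2^k |x - y|)`. -/
def expWeight (B : ℝ) (k : ℕ) (x y : E n) : ℝ≥0∞ :=
  ENNReal.ofReal (Real.exp (-(B * 2 ^ k * ‖x - y‖)))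

theorem expWeight_ne_top (B : ℝ) (k : ℕ) (x y : E n) : expWeight B k x y ≠ ⊤ := ENNReal.ofReal_ne_top

theorem expWeight_self (B : ℝ) (k : ℕ) (x : E n) : expWeight B k x x = 1 := by simp [expWeight]

theorem expWeight_le_mul {B ρ : ℝ} (hB : 0 ≤ B) {k : ℕ} {x y z : E n}
    (h : 2 ^ k * ‖y - z‖ ≤ ρ) :
    expWeight B k x y ≤ ENNReal.ofReal (Real.exp (B * ρ)) * expWeight B k x z := by
  rw [expWeight, expWeight, ← ENNReal.ofReal_mul (Real.exp_nonneg _), ← Real.exp_add]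
  refine ENNReal.ofReal_le_ofReal (Real.exp_le_exp.mpr ?_)
  have h1 : ‖x - z‖ ≤ ‖x - y‖ + ‖y - z‖ := norm_sub_le_norm_sub_add_norm_sub x y z
  have h2 : B * (2 ^ k * ‖x - z‖) ≤ B * (2 ^ k * ‖x - y‖ + ρ) := by
    refine mul_le_mul_of_nonneg_left ?_ hB
    calc (2 : ℝ) ^ k * ‖x - z‖ ≤ 2 ^ k * (‖x - y‖ + ‖y - z‖) := by gcongr
      _ ≤ _ := by rw [mul_add]; gcongr
  linarith

theorem expWeight_mul_expWeight_le {B B' : ℝ} (hB : 0 ≤ B) (hB' : B ≤ B') (k i : ℕ) (x y z : E n) :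
    expWeight B k x y * expWeight B' (k + i) y z ≤ expWeight B k x z := by
  rw [expWeight, expWeight, expWeight, ← ENNReal.ofReal_mul (Real.exp_nonneg _), ← Real.exp_add]
  refine ENNReal.ofReal_le_ofReal (Real.exp_le_exp.mpr ?_)
  have h1 : ‖x - z‖ ≤ ‖x - y‖ + ‖y - z‖ := norm_sub_le_norm_sub_add_norm_sub x y z
  have h2 : B * 2 ^ k * ‖x - z‖ ≤ B * 2 ^ k * (‖x - y‖ + ‖y - z‖) := by gcongr
  have h3 : B * 2 ^ k * ‖y - z‖ ≤ B' * 2 ^ (k + i) * ‖y - z‖ := by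
    have h5 : (2 : ℝ) ^ k ≤ 2 ^ (k + i) := pow_le_pow_right₀ (by norm_num) (Nat.le_add_right _ _)
    have : 0 ≤ B' := hB.trans hB'
    gcongr
  linarith

/-- Peetre-type maximal function of a sequence. -/
def peetreMax (a : ℕ → E n → ℝ≥0∞) (M : ℕ) (B : ℝ) (k : ℕ) (x : E n) : ℝ≥0∞ :=
  ⨆ (i : ℕ) (y : E n), (2 : ℝ≥0∞)⁻¹ ^ (M * i) * a (k + i) y * expWeight B k x y

/-- Weighted sum of `μ`-means of a sequence. -/
def meanSum (a : ℕ → E n → ℝ≥0∞) (μ : ℝ) (M : ℕ) (B : ℝ) (k : ℕ) (x : E n) : ℝ≥0∞ :=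
  ∑' i : ℕ, (2 : ℝ≥0∞) ^ ((k + i) * n) *
    ∫⁻ z, ((2 : ℝ≥0∞)⁻¹ ^ (M * i) * a (k + i) z * expWeight B k x z) ^ μ

theorem le_peetreMax (a : ℕ → E n → ℝ≥0∞) (M : ℕ) (B : ℝ) (k i : ℕ) (x y : E n) :
    (2 : ℝ≥0∞)⁻¹ ^ (M * i) * a (k + i) y * expWeight B k x y ≤ peetreMax a M B k x :=
  le_iSup₂ (f := fun (i : ℕ) (y : E n) =>
    (2 : ℝ≥0∞)⁻¹ ^ (M * i) * a (k + i) y * expWeight B k x y) i y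

theorem apply_le_peetreMax (a : ℕ → E n → ℝ≥0∞) (M : ℕ) (B : ℝ) (k : ℕ) (x : E n) :
    a k x ≤ peetreMax a M B k x := by
  have := le_peetreMax a M B k 0 x x
  simpa [expWeight_self] using this

/-- Local means estimate with decay rate `M`. -/
def LocalMeansBound (a : ℕ → E n → ℝ≥0∞) (M : ℕ) (C : ℝ≥0) (ρ : ℝ) : Prop :=
  ∀ k x, a k x ≤ C * ∑' i : ℕ, ((2 : ℝ≥0∞)⁻¹) ^ (M * i) * 2 ^ (k * n) *
    ∫⁻ y in Metric.closedBall x (ρ * (1 / 2) ^ k), a (k + i) y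

/-- Inside the local means, each weighted value t satisfies t = t^{1-μ} t^μ ≤ G^{1-μ} t^μ, where G
is the maximal function; what remains of the integral is a μ-mean. -/
theorem LocalMeansBound.peetreMax_le {a : ℕ → E n → ℝ≥0∞} {M : ℕ} {C : ℝ≥0} {ρ B μ : ℝ}
    (h : LocalMeansBound a M C ρ) (hρ : 0 ≤ ρ) (hB : 0 ≤ B) (hμ : 0 < μ) (hμ1 : μ ≤ 1) (k : ℕ)
    (x : E n) (hG : peetreMax a M B k x ≠ ⊤) :
    peetreMax a M B k x ≤ C * ENNReal.ofReal (Real.exp (B * ρ)) *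
      (peetreMax a M B k x ^ (1 - μ) * meanSum a μ M B k x) := by
  set G := peetreMax a M B k x with hGdef
  have hG1 : G ^ (1 - μ) ≠ ⊤ := ENNReal.rpow_ne_top_of_nonneg (by linarith) hG
  set e := ENNReal.ofReal (Real.exp (B * ρ)) with he
  refine iSup₂_le fun i y => ?_
  have hterm : ∀ l : ℕ, (2 : ℝ≥0∞)⁻¹ ^ (M * i) * expWeight B k x y *
      (((2 : ℝ≥0∞)⁻¹) ^ (M * l) * 2 ^ ((k + i) * n) *
        ∫⁻ z in Metric.closedBall y (ρ * (1 / 2) ^ (k + i)), a (k + i + l) z) ≤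
      e * (G ^ (1 - μ) * (2 ^ ((k + (i + l)) * n) *
        ∫⁻ z, ((2 : ℝ≥0∞)⁻¹ ^ (M * (i + l)) * a (k + (i + l)) z * expWeight B k x z) ^ μ)) := by
    intro l
    have hpt : ∀ z ∈ Metric.closedBall y (ρ * (1 / 2) ^ (k + i)),
        (2 : ℝ≥0∞)⁻¹ ^ (M * i) * expWeight B k x y * ((2 : ℝ≥0∞)⁻¹) ^ (M * l) * a (k + i + l) z ≤
        e * G ^ (1 - μ) *
          ((2 : ℝ≥0∞)⁻¹ ^ (M * (i + l)) * a (k + (i + l)) z * expWeight B k x z) ^ μ := by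
      intro z hz
      set t := (2 : ℝ≥0∞)⁻¹ ^ (M * (i + l)) * a (k + (i + l)) z * expWeight B k x z with ht
      have htG : t ≤ G := le_peetreMax a M B k (i + l) x z
      have h1 : t ≤ G ^ (1 - μ) * t ^ μ := by
        calc t = t ^ ((1 - μ) + μ) := by simp
          _ = t ^ (1 - μ) * t ^ μ := ENNReal.rpow_add_of_nonneg _ _ (by linarith) hμ.le
          _ ≤ _ := by gcongr
      -- Moving the weight from y to a point z with |y - z| ≤ ρ 2^{-(k+i)} costs only e^{Bρ}.
      have h2 : expWeight B k x y ≤ e * expWeight B k x z := by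
        refine expWeight_le_mul hB ?_
        rw [Metric.mem_closedBall, dist_comm, dist_eq_norm] at hz
        calc (2 : ℝ) ^ k * ‖y - z‖ ≤ 2 ^ k * (ρ * (1 / 2) ^ (k + i)) := by gcongr
          _ = ρ * (1 / 2) ^ i := by
            rw [pow_add, mul_left_comm, ← mul_assoc (2 ^ k : ℝ), ← mul_pow]; norm_num
          _ ≤ ρ * 1 := by gcongr; exact pow_le_one₀ (by norm_num) (by norm_num)
          _ = ρ := mul_one ρ
      calc _ ≤ (2 : ℝ≥0∞)⁻¹ ^ (M * i) * (e * expWeight B k x z) * ((2 : ℝ≥0∞)⁻¹) ^ (M * l) *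
            a (k + i + l) z := by gcongr
        _ = e * t := by rw [ht, mul_add M, pow_add, add_assoc k]; ring
        _ ≤ e * (G ^ (1 - μ) * t ^ μ) := by gcongr
        _ = _ := by ring
    have hc1 : (2 : ℝ≥0∞)⁻¹ ^ (M * i) * expWeight B k x y * ((2 : ℝ≥0∞)⁻¹) ^ (M * l) ≠ ⊤ := by
      have := expWeight_ne_top B k x y
      finiteness
    have hc2 : e * G ^ (1 - μ) ≠ ⊤ := ENNReal.mul_ne_top ENNReal.ofReal_ne_top hG1
    calc _ = 2 ^ ((k + i) * n) * ((2 : ℝ≥0∞)⁻¹ ^ (M * i) * expWeight B k x y *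
          ((2 : ℝ≥0∞)⁻¹) ^ (M * l) *
          ∫⁻ z in Metric.closedBall y (ρ * (1 / 2) ^ (k + i)), a (k + i + l) z) := by ring
      _ ≤ 2 ^ ((k + i) * n) * (e * G ^ (1 - μ) * ∫⁻ z,
          ((2 : ℝ≥0∞)⁻¹ ^ (M * (i + l)) * a (k + (i + l)) z * expWeight B k x z) ^ μ) := by
        rw [← lintegral_const_mul' _ _ hc1, ← lintegral_const_mul' _ _ hc2]
        gcongr 2 ^ ((k + i) * n) * ?_
        exact (setLIntegral_mono' Metric.isClosed_closedBall.measurableSet hpt).trans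
          (setLIntegral_le_lintegral _ _)
      _ ≤ 2 ^ ((k + (i + l)) * n) * (e * G ^ (1 - μ) * ∫⁻ z,
          ((2 : ℝ≥0∞)⁻¹ ^ (M * (i + l)) * a (k + (i + l)) z * expWeight B k x z) ^ μ) := by
        gcongr
        · norm_num
        · omega
      _ = _ := by ring
  calc (2 : ℝ≥0∞)⁻¹ ^ (M * i) * a (k + i) y * expWeight B k x y
      = (2 : ℝ≥0∞)⁻¹ ^ (M * i) * expWeight B k x y * a (k + i) y := by ring
    _ ≤ (2 : ℝ≥0∞)⁻¹ ^ (M * i) * expWeight B k x y * (C * ∑' l : ℕ, ((2 : ℝ≥0∞)⁻¹) ^ (M * l) *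
        2 ^ ((k + i) * n) *
        ∫⁻ z in Metric.closedBall y (ρ * (1 / 2) ^ (k + i)), a (k + i + l) z) := by
      gcongr; exact h (k + i) y
    _ = C * ∑' l : ℕ, (2 : ℝ≥0∞)⁻¹ ^ (M * i) * expWeight B k x y * (((2 : ℝ≥0∞)⁻¹) ^ (M * l) *
        2 ^ ((k + i) * n) *
        ∫⁻ z in Metric.closedBall y (ρ * (1 / 2) ^ (k + i)), a (k + i + l) z) := by
      rw [ENNReal.tsum_mul_left]; ring
    _ ≤ C * ∑' l : ℕ, e * (G ^ (1 - μ) * (2 ^ ((k + (i + l)) * n) *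
        ∫⁻ z, ((2 : ℝ≥0∞)⁻¹ ^ (M * (i + l)) * a (k + (i + l)) z * expWeight B k x z) ^ μ)) := by
      exact mul_le_mul_right (ENNReal.tsum_le_tsum hterm) _
    _ = C * (e * (G ^ (1 - μ) * ∑' l : ℕ, (2 ^ ((k + (i + l)) * n) *
        ∫⁻ z, ((2 : ℝ≥0∞)⁻¹ ^ (M * (i + l)) * a (k + (i + l)) z * expWeight B k x z) ^ μ))) := by
      rw [ENNReal.tsum_mul_left, ENNReal.tsum_mul_left]
    _ ≤ C * (e * (G ^ (1 - μ) * meanSum a μ M B k x)) := by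
      gcongr
      -- The levels k + i + l form part of those summed in `meanSum` at level k.
      exact ENNReal.tsum_comp_le_tsum_of_injective (add_right_injective i) fun l =>
        (2 : ℝ≥0∞) ^ ((k + l) * n) *
          ∫⁻ z, ((2 : ℝ≥0∞)⁻¹ ^ (M * l) * a (k + l) z * expWeight B k x z) ^ μ
    _ = _ := by ring

/-- Cancel G^{1-μ}, which is legitimate once G is finite and nonzero. -/
theorem LocalMeansBound.peetreMax_rpow_le {a : ℕ → E n → ℝ≥0∞} {M : ℕ} {C : ℝ≥0} {ρ B μ : ℝ}
    (h : LocalMeansBound a M C ρ) (hρ : 0 ≤ ρ) (hB : 0 ≤ B) (hμ : 0 < μ) (hμ1 : μ ≤ 1) (k : ℕ)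
    (x : E n) (hG : peetreMax a M B k x ≠ ⊤) :
    peetreMax a M B k x ^ μ ≤ C * ENNReal.ofReal (Real.exp (B * ρ)) * meanSum a μ M B k x := by
  have h1 := h.peetreMax_le hρ hB hμ hμ1 k x hG
  set G := peetreMax a M B k x
  by_cases hG0 : G = 0
  · rw [hG0, ENNReal.zero_rpow_of_pos hμ]; exact zero_le
  have h2 : G = G ^ (1 - μ) * G ^ μ := by
    rw [← ENNReal.rpow_add_of_nonneg _ _ (by linarith) hμ.le]; simp
  have h3 : G ^ (1 - μ) ≠ ⊤ := ENNReal.rpow_ne_top_of_nonneg (by linarith) hG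
  have h4 : G ^ (1 - μ) ≠ 0 := (ENNReal.rpow_pos (pos_iff_ne_zero.mpr hG0) hG).ne'
  rw [← ENNReal.mul_le_mul_iff_right h4 h3, ← h2]
  refine h1.trans (le_of_eq (by ring))

/-- For M and B at least the growth order N, the factor 2^{-Mi} absorbs 2^{iN} and the exponential
weight absorbs e^{N|y|} up to e^{N|x|}. -/
theorem peetreMax_ne_top {a : ℕ → E n → ℝ≥0∞} {C : ℝ≥0} {N M : ℕ} {B : ℝ}
    (h : ∀ k x, a k x ≤ C * 2 ^ (k * N) * ENNReal.ofReal (Real.exp (N * ‖x‖)))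
    (hM : N ≤ M) (hB : N ≤ B) (k : ℕ) (x : E n) : peetreMax a M B k x ≠ ⊤ := by
  refine ne_top_of_le_ne_top (b := C * 2 ^ (k * N) * ENNReal.ofReal (Real.exp (N * ‖x‖)))
    (by finiteness) (iSup₂_le fun i y => ?_)
  have h1 : ENNReal.ofReal (Real.exp (N * ‖y‖)) * expWeight B k x y ≤
      ENNReal.ofReal (Real.exp (N * ‖x‖)) := by
    rw [expWeight, ← ENNReal.ofReal_mul (Real.exp_nonneg _), ← Real.exp_add]
    refine ENNReal.ofReal_le_ofReal (Real.exp_le_exp.mpr ?_)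
    have h2 : ‖y‖ ≤ ‖x‖ + ‖x - y‖ := by
      have := norm_sub_norm_le y x
      rw [norm_sub_rev] at this; linarith
    have h3 : (N : ℝ) * ‖y‖ ≤ N * (‖x‖ + ‖x - y‖) := by gcongr
    have h4 : (N : ℝ) * 1 * ‖x - y‖ ≤ B * 2 ^ k * ‖x - y‖ := by
      have : (0 : ℝ) ≤ B := (Nat.cast_nonneg N).trans hB
      gcongr
      exact one_le_pow₀ (by norm_num)
    linarith
  have h2 : (2 : ℝ≥0∞)⁻¹ ^ (M * i) * 2 ^ (i * N) ≤ 1 := by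
    calc (2 : ℝ≥0∞)⁻¹ ^ (M * i) * 2 ^ (i * N) ≤ (2 : ℝ≥0∞)⁻¹ ^ (M * i) * 2 ^ (M * i) := by
          rw [mul_comm i]
          gcongr
          norm_num
      _ = 1 := by
        rw [← mul_pow, ENNReal.inv_mul_cancel (by norm_num) (by norm_num), one_pow]
  calc (2 : ℝ≥0∞)⁻¹ ^ (M * i) * a (k + i) y * expWeight B k x y
      ≤ (2 : ℝ≥0∞)⁻¹ ^ (M * i) * (C * 2 ^ ((k + i) * N) * ENNReal.ofReal (Real.exp (N * ‖y‖))) *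
        expWeight B k x y := by gcongr; exact h _ _
    _ = ((2 : ℝ≥0∞)⁻¹ ^ (M * i) * 2 ^ (i * N)) * (C * 2 ^ (k * N)) *
        (ENNReal.ofReal (Real.exp (N * ‖y‖)) * expWeight B k x y) := by
      rw [add_mul k, pow_add]; ring
    _ ≤ 1 * (C * 2 ^ (k * N)) * ENNReal.ofReal (Real.exp (N * ‖x‖)) := by gcongr
    _ = _ := by rw [one_mul]

/-- The weights compose by the triangle inequality. Hence one mean sum at (k, x) controls those at
all (k + i, y), even when the latter carry faster decay M', B'. -/
theorem rpow_mul_meanSum_le {a : ℕ → E n → ℝ≥0∞} {μ : ℝ} (hμ : 0 < μ) {M M' : ℕ} (hM : M ≤ M')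
    {B B' : ℝ} (hB : 0 ≤ B) (hB' : B ≤ B') (k i : ℕ) (x y : E n) :
    ((2 : ℝ≥0∞)⁻¹ ^ (M * i) * expWeight B k x y) ^ μ * meanSum a μ M' B' (k + i) y ≤
      meanSum a μ M B k x := by
  have hc : ((2 : ℝ≥0∞)⁻¹ ^ (M * i) * expWeight B k x y) ^ μ ≠ ⊤ :=
    ENNReal.rpow_ne_top_of_nonneg hμ.le (by have := expWeight_ne_top B k x y; finiteness)
  refine le_trans ?_ (ENNReal.tsum_comp_le_tsum_of_injective (add_right_injective i) fun l =>
        (2 : ℝ≥0∞) ^ ((k + l) * n) *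
          ∫⁻ z, ((2 : ℝ≥0∞)⁻¹ ^ (M * l) * a (k + l) z * expWeight B k x z) ^ μ)
  rw [meanSum, ← ENNReal.tsum_mul_left]
  refine ENNReal.tsum_le_tsum fun l => ?_
  rw [mul_left_comm, ← lintegral_const_mul' _ _ hc]
  rw [add_assoc]
  refine mul_le_mul_right (lintegral_mono fun z => ?_) _
  rw [← ENNReal.mul_rpow_of_nonneg _ _ hμ.le]
  refine ENNReal.rpow_le_rpow ?_ hμ.le
  have h2 : (2 : ℝ≥0∞)⁻¹ ^ (M' * l) ≤ (2 : ℝ≥0∞)⁻¹ ^ (M * l) :=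
    pow_le_pow_right_of_le_one' (by norm_num) (Nat.mul_le_mul_right l hM)
  calc (2 : ℝ≥0∞)⁻¹ ^ (M * i) * expWeight B k x y *
        ((2 : ℝ≥0∞)⁻¹ ^ (M' * l) * a (k + (i + l)) z * expWeight B' (k + i) y z)
      = (2 : ℝ≥0∞)⁻¹ ^ (M * i) * (2 : ℝ≥0∞)⁻¹ ^ (M' * l) * a (k + (i + l)) z *
        (expWeight B k x y * expWeight B' (k + i) y z) := by ring
    _ ≤ (2 : ℝ≥0∞)⁻¹ ^ (M * i) * (2 : ℝ≥0∞)⁻¹ ^ (M * l) * a (k + (i + l)) z *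
        expWeight B k x z := by
      gcongr
      exact expWeight_mul_expWeight_le hB hB' k i x y z
    _ = _ := by rw [mul_add M, pow_add]

/-- Strömberg–Torchinsky estimate: the local means bound self-improves to `μ`-means, with a constant
that does not depend on the growth of the sequence. -/
theorem rpow_le_meanSum {a : ℕ → E n → ℝ≥0∞} {μ : ℝ} (hμ : 0 < μ) (hμ1 : μ ≤ 1)
    (hloc : ∀ M, ∃ (C : ℝ≥0) (ρ : ℝ), 0 ≤ ρ ∧ LocalMeansBound a M C ρ)
    (hgr : ∃ (C : ℝ≥0) (N : ℕ), ∀ k x,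
      a k x ≤ C * 2 ^ (k * N) * ENNReal.ofReal (Real.exp (N * ‖x‖)))
    {M : ℕ} {B : ℝ} (hB : 0 ≤ B) {C : ℝ≥0} {ρ : ℝ} (hρ : 0 ≤ ρ) (hM : LocalMeansBound a M C ρ)
    (k : ℕ) (x : E n) :
    a k x ^ μ ≤ (C + 1 : ℝ≥0) * ENNReal.ofReal (Real.exp (B * ρ)) * meanSum a μ M B k x := by
  -- The trivial case needs a nonzero constant, whence `C + 1` in place of `C`.
  by_cases hJ : meanSum a μ M B k x = ⊤
  · rw [hJ, ENNReal.mul_top]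
    · exact le_top
    · refine mul_ne_zero (by simp) ?_
      rw [Ne, ENNReal.ofReal_eq_zero, not_le]
      exact Real.exp_pos _
  obtain ⟨Cg, N, hg⟩ := hgr
  obtain ⟨C', ρ', hρ', hM'⟩ := hloc (max M N)
  have hB' : 0 ≤ max B N := hB.trans (le_max_left _ _)
  have hG : peetreMax a M B k x ≠ ⊤ := by
    -- The parameters raised to the growth order N give constants `C'`, `ρ'` depending on the
    -- sequence. They serve only to show that the maximal function for M, B is finite; the division
    -- is then repeated with `C`, `ρ`.
    have hle : peetreMax a M B k x ≤ (C' * ENNReal.ofReal (Real.exp (max B N * ρ')) *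
        meanSum a μ M B k x) ^ (1 / μ) := by
      refine iSup₂_le fun i y => ?_
      rw [one_div, ENNReal.le_rpow_inv_iff hμ]
      have h1 := hM'.peetreMax_rpow_le hρ' hB' hμ hμ1 (k + i) y
        (peetreMax_ne_top hg (le_max_right _ _) (le_max_right _ _) _ _)
      calc ((2 : ℝ≥0∞)⁻¹ ^ (M * i) * a (k + i) y * expWeight B k x y) ^ μ
          = ((2 : ℝ≥0∞)⁻¹ ^ (M * i) * expWeight B k x y) ^ μ * a (k + i) y ^ μ := by
            rw [← ENNReal.mul_rpow_of_nonneg _ _ hμ.le]; congr 1; ring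
        _ ≤ ((2 : ℝ≥0∞)⁻¹ ^ (M * i) * expWeight B k x y) ^ μ * (C' *
            ENNReal.ofReal (Real.exp (max B N * ρ')) *
            meanSum a μ (max M N) (max B N) (k + i) y) := by
          gcongr
          refine le_trans ?_ h1
          gcongr
          exact apply_le_peetreMax a _ _ _ _
        _ = C' * ENNReal.ofReal (Real.exp (max B N * ρ')) *
            (((2 : ℝ≥0∞)⁻¹ ^ (M * i) * expWeight B k x y) ^ μ *
              meanSum a μ (max M N) (max B N) (k + i) y) := by ring
        _ ≤ _ := by
          gcongr
          exact rpow_mul_meanSum_le hμ (le_max_left _ _) hB (le_max_left _ _) k i x y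
    exact ne_top_of_le_ne_top (ENNReal.rpow_ne_top_of_nonneg (by positivity) (by finiteness)) hle
  calc a k x ^ μ ≤ peetreMax a M B k x ^ μ := by gcongr; exact apply_le_peetreMax a _ _ _ _
    _ ≤ C * ENNReal.ofReal (Real.exp (B * ρ)) * meanSum a μ M B k x :=
      hM.peetreMax_rpow_le hρ hB hμ hμ1 k x hG
    _ ≤ _ := by
      gcongr
      simp

theorem exists_enorm_conv_rpow_le_meanSum (φ₀ : 𝓓((⊤ : Opens (E n)), 𝕜))
    (hφ₀ : ∫ x, φ₀ x = 1) {μ : ℝ} (hμ : 0 < μ) (hμ1 : μ ≤ 1) (M : ℕ) {B : ℝ} (hB : 0 ≤ B) :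
    ∃ C : ℝ≥0, ∀ f : Distr 𝕜 n, IsExpGrowth f → ∀ k x,
      ‖conv φ₀ f k x‖ₑ ^ μ ≤ C * meanSum (fun k x => ‖conv φ₀ f k x‖ₑ) μ M B k x := by
  obtain ⟨C, ρ, hρ, h⟩ := exists_enorm_conv_le_tsum_lintegral φ₀ hφ₀ M
  refine ⟨(C + 1) * (Real.exp (B * ρ)).toNNReal, fun f hf k x => ?_⟩
  rw [ENNReal.coe_mul]
  refine rpow_le_meanSum (a := fun k x => ‖conv φ₀ f k x‖ₑ) hμ hμ1 (fun M' => ?_)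
    (hf.exists_enorm_conv_le φ₀) hB hρ (h f hf) k x
  obtain ⟨C', ρ', hρ', h'⟩ := exists_enorm_conv_le_tsum_lintegral φ₀ hφ₀ M'
  exact ⟨C', ρ', hρ', h' f hf⟩


/-! ### Sequence quasi-norms and Minkowski's inequality -/

/-- The `ℓ_p` quasi-norm of a family in `[0, ∞]`. -/
def seqNorm {ι : Type*} (p : ℝ≥0∞) (a : ι → ℝ≥0∞) : ℝ≥0∞ :=
  if p = ⊤ then ⨆ i, a i else (∑' i, a i ^ p.toReal) ^ (1 / p.toReal)

theorem seqNorm_top {ι : Type*} (a : ι → ℝ≥0∞) : seqNorm ⊤ a = ⨆ i, a i := if_pos rfl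

theorem seqNorm_of_ne_top {ι : Type*} {p : ℝ≥0∞} (hp : p ≠ ⊤) (a : ι → ℝ≥0∞) :
    seqNorm p a = (∑' i, a i ^ p.toReal) ^ (1 / p.toReal) := if_neg hp

theorem lqNorm_univ (s : ℝ≥0∞) (a : ℕ → ℝ≥0∞) : lqNorm s Set.univ a = seqNorm s a := by
  unfold lqNorm seqNorm
  split_ifs
  · simp
  · rw [tsum_univ (fun k => a k ^ s.toReal)]

theorem seqNorm_mono {ι : Type*} (p : ℝ≥0∞) {a b : ι → ℝ≥0∞} (h : ∀ i, a i ≤ b i) :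
    seqNorm p a ≤ seqNorm p b := by
  unfold seqNorm
  split_ifs
  · exact iSup_mono h
  · gcongr with i
    exact h i

theorem seqNorm_const_mul {ι : Type*} {p : ℝ≥0∞} (hp : p ≠ 0) (c : ℝ≥0∞) (a : ι → ℝ≥0∞) :
    seqNorm p (fun i => c * a i) = c * seqNorm p a := by
  unfold seqNorm
  split_ifs with h
  · rw [ENNReal.mul_iSup]
  · have h0 : 0 < p.toReal := ENNReal.toReal_pos hp h
    simp_rw [ENNReal.mul_rpow_of_nonneg _ _ h0.le]
    rw [ENNReal.tsum_mul_left, ENNReal.mul_rpow_of_nonneg _ _ (by positivity), ← ENNReal.rpow_mul,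
      mul_one_div_cancel h0.ne', ENNReal.rpow_one]

theorem seqNorm_comp_equiv {ι κ : Type*} (p : ℝ≥0∞) (e : ι ≃ κ) (a : κ → ℝ≥0∞) :
    seqNorm p (fun i => a (e i)) = seqNorm p a := by
  unfold seqNorm
  split_ifs
  · exact e.iSup_comp
  · rw [e.tsum_eq (fun i => a i ^ p.toReal)]

theorem seqNorm_comp_le {ι κ : Type*} (p : ℝ≥0∞) {e : ι → κ} (he : Function.Injective e)
    (a : κ → ℝ≥0∞) : seqNorm p (fun i => a (e i)) ≤ seqNorm p a := by
  unfold seqNorm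
  split_ifs
  · exact iSup_comp_le a e
  · gcongr
    exact ENNReal.tsum_comp_le_tsum_of_injective he fun i => a i ^ p.toReal

/-- Passing to μ-th powers replaces the exponents p, q by p/μ, q/μ, which are at least one, so that
Minkowski's inequality becomes available. -/
theorem seqNorm_rpow {ι : Type*} {p : ℝ≥0∞} (hp : p ≠ 0) {μ : ℝ} (hμ : 0 < μ) (a : ι → ℝ≥0∞) :
    seqNorm (p / ENNReal.ofReal μ) (fun i => a i ^ μ) = seqNorm p a ^ μ := by
  by_cases h : p = ⊤
  · subst h
    rw [ENNReal.top_div_of_ne_top ENNReal.ofReal_ne_top, seqNorm_top, seqNorm_top]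
    exact ((ENNReal.orderIsoRpow μ hμ).map_iSup a).symm
  · have h1 : p / ENNReal.ofReal μ ≠ ⊤ :=
      ENNReal.div_ne_top h (by simpa using hμ)
    have h0 : 0 < p.toReal := ENNReal.toReal_pos hp h
    have h2 : (p / ENNReal.ofReal μ).toReal = p.toReal / μ := by
      rw [ENNReal.toReal_div, ENNReal.toReal_ofReal hμ.le]
    rw [seqNorm_of_ne_top h, seqNorm_of_ne_top h1, h2]
    simp_rw [← ENNReal.rpow_mul]
    congr 1
    · congr 1
      ext i
      congr 1
      field_simp
    · field_simp

theorem seqNorm_sum_le {ι κ : Type*} {p : ℝ} (hp : 1 ≤ p) (s : Finset κ) (t : Finset ι)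
    (a : ι → κ → ℝ≥0∞) :
    (∑ k ∈ s, (∑ i ∈ t, a i k) ^ p) ^ (1 / p) ≤ ∑ i ∈ t, (∑ k ∈ s, a i k ^ p) ^ (1 / p) := by
  classical
  have hp0 : 0 < p := by linarith
  induction t using Finset.induction_on with
  | empty => simp [ENNReal.zero_rpow_of_pos, hp0]
  | insert j t hj ih =>
    rw [Finset.sum_insert hj]
    simp_rw [Finset.sum_insert hj]
    exact (ENNReal.Lp_add_le s _ _ hp).trans (by gcongr)

/-- Minkowski's inequality for infinite sums. -/
theorem seqNorm_tsum_le {ι κ : Type*} {p : ℝ≥0∞} (hp : 1 ≤ p) (a : ι → κ → ℝ≥0∞) :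
    seqNorm p (fun k => ∑' i, a i k) ≤ ∑' i, seqNorm p (a i) := by
  by_cases h : p = ⊤
  · subst h
    simp only [seqNorm_top]
    exact iSup_le fun k => ENNReal.tsum_le_tsum fun i => le_iSup (a i) k
  have hp1 : 1 ≤ p.toReal := by
    rw [← ENNReal.toReal_one]; exact ENNReal.toReal_mono h hp
  have hp0 : 0 < p.toReal := by linarith
  simp only [seqNorm_of_ne_top h]
  rw [one_div, ENNReal.rpow_inv_le_iff hp0, ENNReal.tsum_eq_iSup_sum]
  refine iSup_le fun s => ?_
  rw [← ENNReal.rpow_inv_le_iff hp0]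
  -- With finitely many k retained, the sum over i is a limit of finite sums, to which the finite
  -- inequality applies.
  have hlim : Filter.Tendsto (fun t : Finset ι => (∑ k ∈ s, (∑ i ∈ t, a i k) ^ p.toReal) ^
      p.toReal⁻¹) Filter.atTop (nhds ((∑ k ∈ s, (∑' i, a i k) ^ p.toReal) ^ p.toReal⁻¹)) := by
    refine (ENNReal.continuous_rpow_const.tendsto _).comp (tendsto_finsetSum _ fun k _ => ?_)
    exact (ENNReal.continuous_rpow_const.tendsto _).comp ENNReal.summable.hasSum
  refine le_of_tendsto' hlim fun t => ?_
  have h1 := seqNorm_sum_le hp1 s t a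
  rw [one_div] at h1
  refine h1.trans ((Finset.sum_le_sum fun i _ => ?_).trans (ENNReal.sum_le_tsum t))
  gcongr
  exact ENNReal.sum_le_tsum s

theorem eLpNorm_sum_measure {α ι F : Type*} [MeasurableSpace α] [Countable ι]
    [NormedAddCommGroup F] {p : ℝ≥0∞} (hp : p ≠ 0) (f : α → F) (ν : ι → Measure α) :
    eLpNorm f p (Measure.sum ν) = seqNorm p (fun i => eLpNorm f p (ν i)) := by
  by_cases h : p = ⊤
  · subst h
    rw [seqNorm_top]
    simp only [eLpNorm_exponent_top]
    refine le_antisymm ?_ (iSup_le fun i => eLpNormEssSup_mono_measure f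
      (Measure.absolutelyContinuous_of_le (Measure.le_sum ν i)))
    refine essSup_le_of_ae_le _ ?_
    rw [Filter.EventuallyLE, Measure.ae_sum_iff]
    intro i
    filter_upwards [enorm_ae_le_eLpNormEssSup f (ν i)] with x hx
    exact hx.trans (le_iSup (fun i => eLpNormEssSup f (ν i)) i)
  · have h0 : 0 < p.toReal := ENNReal.toReal_pos hp h
    rw [seqNorm_of_ne_top h, eLpNorm_eq_lintegral_rpow_enorm_toReal hp h, lintegral_sum_measure]
    congr 1
    congr 1
    ext i
    rw [eLpNorm_eq_lintegral_rpow_enorm_toReal hp h, ← ENNReal.rpow_mul, one_div_mul_cancel h0.ne',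
      ENNReal.rpow_one]

/-- The sum over `ℤⁿ` of a product is the power of the one-dimensional sum. -/
theorem tsum_pi_prod (g : ℤ → ℝ≥0∞) (n : ℕ) :
    ∑' d : Fin n → ℤ, ∏ i, g (d i) = (∑' z, g z) ^ n := by
  induction n with
  | zero => simp [tsum_fintype]
  | succ n ih =>
    rw [← (Fin.consEquiv (fun _ : Fin (n + 1) => ℤ)).tsum_eq]
    simp only [Fin.consEquiv_apply, Fin.prod_univ_succ, Fin.cons_zero, Fin.cons_succ]
    rw [ENNReal.tsum_prod (f := fun z (d : Fin n → ℤ) => g z * ∏ i, g (d i))]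
    simp_rw [ENNReal.tsum_mul_left, ih]
    rw [ENNReal.tsum_mul_right, pow_succ']

theorem tsum_exp_neg_natAbs_ne_top {c : ℝ} (hc : 0 < c) :
    ∑' z : ℤ, ENNReal.ofReal (Real.exp (-(c * z.natAbs))) ≠ ⊤ := by
  have h : Summable fun m : ℕ => Real.exp (-(c * m)) := by
    have := Real.summable_exp_nat_mul_iff.mpr (neg_lt_zero.mpr hc)
    refine this.congr fun m => ?_
    congr 1; ring
  have h2 : Summable fun z : ℤ => Real.exp (-(c * z.natAbs)) :=
    Summable.of_nat_of_neg (by simpa using h) (by simpa using h)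
  rw [← ENNReal.ofReal_tsum_of_nonneg (fun _ => Real.exp_nonneg _) h2]
  exact ENNReal.ofReal_ne_top


/-! ### Dyadic cubes and the lattice -/

theorem mem_halfOpenCube_iff {k : ℕ} {m : Fin n → ℤ} {x : E n} :
    x ∈ halfOpenCube k m ↔ (fun i => ⌊x i * 2 ^ k⌋) = m := by
  rw [funext_iff]
  refine forall_congr' fun i => ?_
  rw [Int.floor_eq_iff, div_le_iff₀ (by positivity), lt_div_iff₀ (by positivity)]

theorem openCube_subset_halfOpenCube (k : ℕ) (m : Fin n → ℤ) :
    (openCube k m : Set (E n)) ⊆ halfOpenCube k m := fun _ hx i => ⟨(hx i).1.le, (hx i).2⟩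

theorem openCube_eq_preimage (k : ℕ) (m : Fin n → ℤ) :
    (openCube k m : Set (E n)) = WithLp.ofLp ⁻¹' (Set.univ.pi fun i : Fin n =>
      Set.Ioo ((m i : ℝ) / 2 ^ k) (((m i : ℝ) + 1) / 2 ^ k)) := by
  ext x; simp [openCube]

theorem halfOpenCube_eq_preimage (k : ℕ) (m : Fin n → ℤ) :
    (halfOpenCube k m : Set (E n)) = WithLp.ofLp ⁻¹' (Set.univ.pi fun i : Fin n =>
      Set.Ico ((m i : ℝ) / 2 ^ k) (((m i : ℝ) + 1) / 2 ^ k)) := by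
  ext x; simp [halfOpenCube]

theorem measurableSet_openCube (k : ℕ) (m : Fin n → ℤ) :
    MeasurableSet (openCube k m : Set (E n)) := by
  rw [openCube_eq_preimage]
  exact (PiLp.volume_preserving_ofLp (Fin n)).measurable
    (MeasurableSet.univ_pi fun _ => measurableSet_Ioo)

theorem measurableSet_halfOpenCube (k : ℕ) (m : Fin n → ℤ) :
    MeasurableSet (halfOpenCube k m : Set (E n)) := by
  rw [halfOpenCube_eq_preimage]
  exact (PiLp.volume_preserving_ofLp (Fin n)).measurable
    (MeasurableSet.univ_pi fun _ => measurableSet_Ico)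

theorem openCube_ae_eq_halfOpenCube (k : ℕ) (m : Fin n → ℤ) :
    (openCube k m : Set (E n)) =ᵐ[volume] halfOpenCube k m := by
  rw [openCube_eq_preimage, halfOpenCube_eq_preimage]
  exact (PiLp.volume_preserving_ofLp (Fin n)).quasiMeasurePreserving.preimage_ae_eq
    (Measure.univ_pi_Ioo_ae_eq_Icc.trans Measure.univ_pi_Ico_ae_eq_Icc.symm)

theorem volume_openCube (k : ℕ) (m : Fin n → ℤ) :
    volume (openCube k m : Set (E n)) = ((2 : ℝ≥0∞) ^ (k * n))⁻¹ := by
  rw [openCube_eq_preimage, (PiLp.volume_preserving_ofLp (Fin n)).measure_preimage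
    (MeasurableSet.univ_pi fun _ => measurableSet_Ioo).nullMeasurableSet, Real.volume_pi_Ioo]
  have h : ∀ i : Fin n, ENNReal.ofReal (((m i : ℝ) + 1) / 2 ^ k - (m i : ℝ) / 2 ^ k) =
      ((2 : ℝ≥0∞) ^ k)⁻¹ := fun i => by
    rw [← sub_div, add_sub_cancel_left, one_div, ENNReal.ofReal_inv_of_pos (by positivity),
      ENNReal.ofReal_pow (by norm_num), ENNReal.ofReal_ofNat]
  simp only [h, Finset.prod_const, Finset.card_univ, Fintype.card_fin]
  rw [← ENNReal.inv_pow, pow_mul]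

theorem sum_restrict_openCube (k : ℕ) :
    Measure.sum (fun m : Fin n → ℤ => (volume : Measure (E n)).restrict (openCube k m)) =
      volume := by
  have h1 : ∀ m : Fin n → ℤ, (volume : Measure (E n)).restrict (openCube k m) =
      volume.restrict (halfOpenCube k m) := fun m =>
    Measure.restrict_congr_set (openCube_ae_eq_halfOpenCube k m)
  simp_rw [h1]
  rw [← Measure.restrict_iUnion ?_ fun m => measurableSet_halfOpenCube k m]
  · have : (⋃ m : Fin n → ℤ, (halfOpenCube k m : Set (E n))) = Set.univ := by
      refine Set.eq_univ_of_forall fun x => Set.mem_iUnion.mpr ⟨_, mem_halfOpenCube_iff.mpr rfl⟩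
    rw [this, Measure.restrict_univ]
  · intro m m' hmm
    refine Set.disjoint_left.mpr fun x hx hx' => hmm ?_
    rw [mem_halfOpenCube_iff] at hx hx'
    exact hx.symm.trans hx'

/-- If the cubes meet, their endpoints, scaled to level j, satisfy strict inequalities between
integers; these improve by one and give the inclusion. -/
theorem openCube_subset_or_disjoint {k j : ℕ} (hkj : k ≤ j) (m m' : Fin n → ℤ) :
    (openCube j m' : Set (E n)) ⊆ openCube k m ∨
      Disjoint (openCube j m' : Set (E n)) (openCube k m) := by
  by_cases h : Disjoint (openCube j m' : Set (E n)) (openCube k m)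
  · exact Or.inr h
  · left
    obtain ⟨y, hy, hy'⟩ := Set.not_disjoint_iff.mp h
    obtain ⟨l, rfl⟩ := Nat.exists_eq_add_of_le hkj
    intro x hx i
    have hk : (0 : ℝ) < 2 ^ k := by positivity
    have hl : (0 : ℝ) < 2 ^ l := by positivity
    obtain ⟨a1, a2⟩ := hy i
    obtain ⟨b1, b2⟩ := hy' i
    obtain ⟨c1, c2⟩ := hx i
    rw [pow_add] at a1 a2 c1 c2
    rw [div_lt_iff₀ (by positivity)] at a1 b1 c1 ⊢
    rw [lt_div_iff₀ (by positivity)] at a2 b2 c2 ⊢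
    have e1 : (m i : ℝ) * 2 ^ l < m' i + 1 := by nlinarith
    have e2 : (m' i : ℝ) < (m i + 1) * 2 ^ l := by nlinarith
    have f1 : m i * 2 ^ l < m' i + 1 := by exact_mod_cast e1
    have f2 : m' i < (m i + 1) * 2 ^ l := by exact_mod_cast e2
    have g1 : (m i : ℝ) * 2 ^ l ≤ m' i := by exact_mod_cast Int.lt_add_one_iff.mp f1
    have g2 : (m' i : ℝ) + 1 ≤ (m i + 1) * 2 ^ l := by exact_mod_cast f2
    constructor
    · by_contra hc
      rw [not_lt] at hc
      have : x i * 2 ^ k * 2 ^ l ≤ m i * 2 ^ l := by gcongr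
      nlinarith
    · by_contra hc
      rw [not_lt] at hc
      have : ((m i : ℝ) + 1) * 2 ^ l ≤ x i * 2 ^ k * 2 ^ l := by gcongr
      nlinarith

/-- `2^{kn}` times Lebesgue measure on the cube `Q_{k,m}`. -/
def cubeMeasure (k : ℕ) (m : Fin n → ℤ) : Measure (E n) :=
  (2 : ℝ≥0∞) ^ (k * n) • volume.restrict (openCube k m)

instance (k : ℕ) (m : Fin n → ℤ) : IsProbabilityMeasure (cubeMeasure k m) := ⟨by
  rw [cubeMeasure, Measure.smul_apply, Measure.restrict_apply_univ, volume_openCube, smul_eq_mul,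
    ENNReal.mul_inv_cancel (by positivity) (by finiteness)]⟩

theorem sum_cubeMeasure (k : ℕ) :
    Measure.sum (fun m : Fin n → ℤ => cubeMeasure k m) =
      (2 : ℝ≥0∞) ^ (k * n) • (volume : Measure (E n)) := by
  conv_rhs => rw [← sum_restrict_openCube k]
  ext s hs
  simp only [Measure.sum_apply _ hs, Measure.smul_apply, cubeMeasure, smul_eq_mul]
  rw [ENNReal.tsum_mul_left]

theorem cubeMeasure_absolutelyContinuous (k : ℕ) (m : Fin n → ℤ) :
    cubeMeasure k m ≪ (volume : Measure (E n)) :=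
  (Measure.smul_absolutelyContinuous).trans Measure.absolutelyContinuous_restrict

theorem ae_cubeMeasure_mem (k : ℕ) (m : Fin n → ℤ) :
    ∀ᵐ x ∂cubeMeasure k m, x ∈ (openCube k m : Set (E n)) :=
  Measure.smul_absolutelyContinuous.ae_le (ae_restrict_mem (measurableSet_openCube k m))

theorem eLpNorm_cubeMeasure {F : Type*} [NormedAddCommGroup F] (s : ℝ≥0∞) (k : ℕ) (m : Fin n → ℤ)
    (g : E n → F) : eLpNorm g s (cubeMeasure k m) =
      ((2 : ℝ≥0∞) ^ (k * n)) ^ (1 / s).toReal * eLpNorm g s (volume.restrict (openCube k m)) :=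
  eLpNorm_smul_measure_of_ne_zero (by positivity) g s _

/-- A comparison on all subcubes gives the comparison on the cube. -/
theorem eLpNorm_restrict_openCube_mono {F G : Type*} [NormedAddCommGroup F] [NormedAddCommGroup G]
    {s : ℝ≥0∞} (hs : s ≠ 0) {k j : ℕ} (hkj : k ≤ j) (m : Fin n → ℤ) {f : E n → F} {g : E n → G}
    (h : ∀ m' : Fin n → ℤ, eLpNorm f s (volume.restrict (openCube j m')) ≤
      eLpNorm g s (volume.restrict (openCube j m'))) :
    eLpNorm f s (volume.restrict (openCube k m)) ≤ eLpNorm g s (volume.restrict (openCube k m)) := by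
  have h1 : (volume : Measure (E n)).restrict (openCube k m) = Measure.sum fun m' : Fin n → ℤ =>
      (volume.restrict (openCube j m')).restrict (openCube k m) := by
    conv_lhs => rw [← sum_restrict_openCube j]
    exact Measure.restrict_sum _ (measurableSet_openCube k m)
  rw [h1, eLpNorm_sum_measure hs, eLpNorm_sum_measure hs]
  refine seqNorm_mono _ fun m' => ?_
  rw [Measure.restrict_restrict (measurableSet_openCube k m), Set.inter_comm]
  rcases openCube_subset_or_disjoint hkj m m' with h2 | h2
  · rw [Set.inter_eq_left.mpr h2]; exact h m'
  · rw [h2.inter_eq]; simp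

/-- The `ℓ₁` distance on `ℤⁿ`. -/
def latDist (m m' : Fin n → ℤ) : ℕ := ∑ i, (m i - m' i).natAbs

/-- In each coordinate |m_i - m'_i| - 1 ≤ 2^k |x - z|. Summing over the n coordinates accounts for
the rate `n * b` and for the loss e^{bn}. -/
theorem expWeight_le_of_mem_openCube {b : ℝ} (hb : 0 ≤ b) {k : ℕ} {m m' : Fin n → ℤ} {x z : E n}
    (hx : x ∈ (openCube k m : Set (E n))) (hz : z ∈ (openCube k m' : Set (E n))) :
    expWeight (n * b) k x z ≤
      ENNReal.ofReal (Real.exp (b * n) * Real.exp (-(b * latDist m m'))) := by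
  rw [expWeight, ← Real.exp_add]
  refine ENNReal.ofReal_le_ofReal (Real.exp_le_exp.mpr ?_)
  have hk : (0 : ℝ) < 2 ^ k := by positivity
  have h1 : ∀ i, ((m i - m' i).natAbs : ℝ) - 1 ≤ 2 ^ k * ‖x - z‖ := fun i => by
    have h2 : |x i - z i| ≤ ‖x - z‖ := by
      simpa using PiLp.norm_apply_le (x - z) i
    obtain ⟨a1, a2⟩ := hx i
    obtain ⟨b1, b2⟩ := hz i
    rw [div_lt_iff₀ hk] at a1 b1
    rw [lt_div_iff₀ hk] at a2 b2
    have h3 : |((m i : ℝ) - m' i)| - 1 ≤ |x i - z i| * 2 ^ k := by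
      rw [← abs_of_pos hk, ← abs_mul, sub_mul, sub_le_iff_le_add]
      refine abs_le.mpr ⟨?_, ?_⟩
      · have := neg_abs_le (x i * 2 ^ k - z i * 2 ^ k); linarith
      · have := le_abs_self (x i * 2 ^ k - z i * 2 ^ k); linarith
    have h4 : ((m i - m' i).natAbs : ℝ) = |((m i : ℝ) - m' i)| := by
      rw [Nat.cast_natAbs]; push_cast; rfl
    rw [h4, mul_comm]
    exact h3.trans (by gcongr)
  have h5 : (latDist m m' : ℝ) - n ≤ n * (2 ^ k * ‖x - z‖) := by
    have := Finset.sum_le_sum fun i (_ : i ∈ Finset.univ) => h1 i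
    simpa [latDist, Finset.sum_sub_distrib] using this
  have h6 := mul_le_mul_of_nonneg_left h5 hb
  nlinarith

theorem tsum_exp_neg_latDist (c : ℝ) (n : ℕ) :
    ∑' d : Fin n → ℤ, ENNReal.ofReal (Real.exp (-(c * latDist d 0))) =
      (∑' z : ℤ, ENNReal.ofReal (Real.exp (-(c * z.natAbs)))) ^ n := by
  rw [← tsum_pi_prod]
  congr 1
  ext d
  rw [← ENNReal.ofReal_prod_of_nonneg fun _ _ => Real.exp_nonneg _, ← Real.exp_sum,
    Finset.sum_neg_distrib, ← Finset.mul_sum]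
  simp [latDist]

/-- Walk from m to m', moving every coordinate one unit towards its target at each step. -/
theorem le_pow_mul_of_neighbour {T : (Fin n → ℤ) → ℝ≥0∞} {κ : ℝ≥0∞}
    (h : ∀ m m' : Fin n → ℤ, (∀ i, |m i - m' i| ≤ 1) → T m ≤ κ * T m') (N : ℕ) :
    ∀ m m' : Fin n → ℤ, (∀ i, |m i - m' i| ≤ N) → T m ≤ κ ^ N * T m' := by
  induction N with
  | zero =>
    intro m m' hm
    have : m = m' := funext fun i => by
      have := hm i
      rw [Nat.cast_zero, abs_nonpos_iff] at this
      omega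
    simp [this]
  | succ N ih =>
    intro m m' hm
    set m'' : Fin n → ℤ := fun i =>
      if m i < m' i then m i + 1 else if m' i < m i then m i - 1 else m i with hm''
    have h1 : ∀ i, |m i - m'' i| ≤ 1 := fun i => by
      simp only [hm'']
      rw [abs_le]
      split_ifs <;> constructor <;> omega
    have h2 : ∀ i, |m'' i - m' i| ≤ N := fun i => by
      have := hm i
      simp only [hm'']
      rw [abs_le] at this ⊢
      push_cast at this
      split_ifs <;> constructor <;> omega
    calc T m ≤ κ * T m'' := h _ _ h1
      _ ≤ κ * (κ ^ N * T m') := by gcongr; exact ih _ _ h2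
      _ = _ := by ring

theorem le_pow_latDist_mul {T : (Fin n → ℤ) → ℝ≥0∞} {κ : ℝ≥0∞}
    (h : ∀ m m' : Fin n → ℤ, (∀ i, |m i - m' i| ≤ 1) → T m ≤ κ * T m') (m m' : Fin n → ℤ) :
    T m ≤ κ ^ latDist m m' * T m' := by
  refine le_pow_mul_of_neighbour h _ m m' fun i => ?_
  rw [Int.abs_eq_natAbs, latDist]
  exact_mod_cast Finset.single_le_sum (f := fun i => (m i - m' i).natAbs) (fun _ _ => Nat.zero_le _)
    (Finset.mem_univ i)


/-! ### From the Hardy condition to geometric growth -/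

theorem le_lqNorm {s : ℝ≥0∞} (hs : s ≠ 0) {I : Set ℕ} {k : ℕ} (hk : k ∈ I) (a : ℕ → ℝ≥0∞) :
    a k ≤ lqNorm s I a := by
  unfold lqNorm
  split_ifs with h
  · exact le_iSup₂ (f := fun k (_ : k ∈ I) => a k) k hk
  · have h0 : 0 < s.toReal := ENNReal.toReal_pos hs h
    rw [one_div, ENNReal.le_rpow_inv_iff h0]
    exact ENNReal.le_tsum (f := fun k : I => a k ^ s.toReal) ⟨k, hk⟩

theorem ratio_lt_one {κ : ℝ≥0∞} (hκ : κ ≠ ⊤) : κ / (κ + 1) < 1 := by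
  rw [ENNReal.div_lt_iff (Or.inl (by simp)) (Or.inl (by finiteness)), one_mul]
  exact ENNReal.lt_add_right hκ one_ne_zero

theorem le_ratio_mul {κ a b : ℝ≥0∞} (hκ : κ ≠ ⊤) (h : a * (κ + 1) ≤ κ * b) :
    a ≤ κ / (κ + 1) * b := by
  rw [div_eq_mul_inv, mul_right_comm, ← div_eq_mul_inv]
  rwa [ENNReal.le_div_iff_mul_le (Or.inl (by simp)) (Or.inl (by finiteness))]

/-- Tails dominated by their first term decay geometrically. -/
theorem geometric_of_tail_le {c : ℕ → ℝ≥0∞} {κ : ℝ≥0∞} (hκ : κ ≠ ⊤)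
    (h : ∀ N, 1 ≤ N → ∑' i, c (N + i) ≤ κ * c N) (N : ℕ) (hN : 1 ≤ N) (i : ℕ) :
    c (N + i) ≤ κ * (κ / (κ + 1)) ^ i * c N := by
  -- With S_N the tail sum, S_{N+1} ≤ κ c_N = κ (S_N - S_{N+1}), written without subtraction.
  have hstep : ∀ N, 1 ≤ N → ∑' i, c (N + 1 + i) ≤ κ / (κ + 1) * ∑' i, c (N + i) := fun N hN => by
    refine le_ratio_mul hκ ?_
    have hsplit : ∑' i, c (N + i) = c N + ∑' i, c (N + 1 + i) := by
      rw [tsum_eq_zero_add' ENNReal.summable, add_zero]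
      congr 2; ext i; congr 1; ring
    have h1 : ∑' i, c (N + 1 + i) ≤ κ * c N := by
      refine le_trans ?_ (h N hN)
      rw [hsplit]; exact le_add_self
    calc (∑' i, c (N + 1 + i)) * (κ + 1)
        = κ * (∑' i, c (N + 1 + i)) + ∑' i, c (N + 1 + i) := by ring
      _ ≤ κ * (∑' i, c (N + 1 + i)) + κ * c N := by gcongr
      _ = _ := by rw [hsplit]; ring
  have hiter : ∑' l, c (N + i + l) ≤ (κ / (κ + 1)) ^ i * ∑' l, c (N + l) := by
    induction i with
    | zero => simp
    | succ i ih =>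
      rw [← add_assoc]
      refine (hstep (N + i) (by omega)).trans ?_
      rw [pow_succ', mul_assoc]
      gcongr
  calc c (N + i) ≤ ∑' l, c (N + i + l) := ENNReal.le_tsum (f := fun l => c (N + i + l)) 0
    _ ≤ (κ / (κ + 1)) ^ i * ∑' l, c (N + l) := hiter
    _ ≤ (κ / (κ + 1)) ^ i * (κ * c N) := by gcongr; exact h N hN
    _ = _ := by ring

/-- Heads dominated by their last term grow geometrically. -/
theorem geometric_of_head_le {c : ℕ → ℝ≥0∞} {κ : ℝ≥0∞} (hκ : κ ≠ ⊤)
    (h : ∀ N, 1 ≤ N → ∑ i ∈ Finset.range (N + 1), c i ≤ κ * c N) (N : ℕ) (hN : 1 ≤ N) (i : ℕ) :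
    c N ≤ κ * (κ / (κ + 1)) ^ i * c (N + i) := by
  -- The mirror argument: the head sum H_N is at most κ c_{N+1} = κ (H_{N+1} - H_N).
  have hstep : ∀ N, ∑ i ∈ Finset.range (N + 1), c i ≤
      κ / (κ + 1) * ∑ i ∈ Finset.range (N + 1 + 1), c i := fun N => by
    refine le_ratio_mul hκ ?_
    have h1 : ∑ i ∈ Finset.range (N + 1), c i ≤ κ * c (N + 1) := by
      refine le_trans ?_ (h (N + 1) (by omega))
      rw [Finset.sum_range_succ _ (N + 1)]; exact le_self_add
    rw [Finset.sum_range_succ _ (N + 1), mul_add, mul_one, mul_add, mul_comm _ κ]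
    gcongr
  have hiter : ∑ l ∈ Finset.range (N + 1), c l ≤
      (κ / (κ + 1)) ^ i * ∑ l ∈ Finset.range (N + i + 1), c l := by
    induction i with
    | zero => simp
    | succ i ih =>
      refine ih.trans ?_
      rw [pow_succ, mul_assoc]
      gcongr
      exact hstep (N + i)
  calc c N ≤ ∑ l ∈ Finset.range (N + 1), c l :=
        Finset.single_le_sum (f := c) (fun _ _ => zero_le) (Finset.self_mem_range_succ N)
    _ ≤ (κ / (κ + 1)) ^ i * ∑ l ∈ Finset.range (N + i + 1), c l := hiter
    _ ≤ (κ / (κ + 1)) ^ i * (κ * c (N + i)) := by gcongr; exact h _ (by omega)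
    _ = _ := by ring

/-- One factor of the Hardy product is reduced to its single term at N; the other then says that a
sum is dominated by its extreme term. For s' finite this is the tail of β^{-s'}, for s' = ∞ (so s =
1) the head of β. -/
theorem HardyTail.exists_geometric_of_one_le {s : ℝ≥0∞} (hs : 1 ≤ s) {β : ℕ → ℝ}
    (hβ : ∀ k, 0 < β k) (h : HardyTail s β) :
    ∃ D θ : ℝ≥0∞, D ≠ ⊤ ∧ θ < 1 ∧ ∀ k, 1 ≤ k → ∀ i,
      ENNReal.ofReal (β k) ≤ D * θ ^ i * ENNReal.ofReal (β (k + i)) := by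
  unfold HardyTail at h
  set K : ℝ≥0∞ := ⨆ N ∈ Set.Ici 1, lqNorm s (Set.Iic N) (fun k => ENNReal.ofReal (β k)) *
    lqNorm s.conjExponent (Set.Ici N) (fun k => ENNReal.ofReal (β k)⁻¹) with hK
  have hKN : ∀ N, 1 ≤ N → lqNorm s (Set.Iic N) (fun k => ENNReal.ofReal (β k)) *
      lqNorm s.conjExponent (Set.Ici N) (fun k => ENNReal.ofReal (β k)⁻¹) ≤ K := fun N hN =>
    le_iSup₂ (f := fun N (_ : N ∈ Set.Ici 1) =>
      lqNorm s (Set.Iic N) (fun k => ENNReal.ofReal (β k)) *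
      lqNorm s.conjExponent (Set.Ici N) (fun k => ENNReal.ofReal (β k)⁻¹)) N hN
  have hKt : K ≠ ⊤ := h.ne
  have hs0 : s ≠ 0 := (zero_lt_one.trans_le hs).ne'
  have hs'0 : s.conjExponent ≠ 0 := by simp [ENNReal.conjExponent]
  have hinv : ∀ k, ENNReal.ofReal (β k)⁻¹ = (ENNReal.ofReal (β k))⁻¹ := fun k =>
    ENNReal.ofReal_inv_of_pos (hβ k)
  have hb0 : ∀ k, ENNReal.ofReal (β k) ≠ 0 := fun k => by simpa using hβ k
  have hbt : ∀ k, ENNReal.ofReal (β k) ≠ ⊤ := fun k => ENNReal.ofReal_ne_top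
  by_cases htop : s.conjExponent = ⊤
  · have hs1 : s = 1 := by
      unfold ENNReal.conjExponent at htop
      rw [ENNReal.add_eq_top] at htop
      have : s - 1 = 0 := by simpa using htop
      exact le_antisymm (tsub_eq_zero_iff_le.mp this) hs
    refine ⟨K, K / (K + 1), hKt, ratio_lt_one hKt, fun k hk i => ?_⟩
    refine geometric_of_head_le (c := fun k => ENNReal.ofReal (β k)) hKt (fun N hN => ?_) k hk i
    have h1 : ∑ i ∈ Finset.range (N + 1), ENNReal.ofReal (β i) ≤
        lqNorm s (Set.Iic N) (fun k => ENNReal.ofReal (β k)) := by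
      rw [hs1, lqNorm, if_neg ENNReal.one_ne_top]
      simp only [ENNReal.toReal_one, ENNReal.rpow_one, div_one]
      rw [← Fin.sum_univ_eq_sum_range (fun i => ENNReal.ofReal (β i)), ← tsum_fintype (L := .unconditional _)]
      exact ENNReal.tsum_comp_le_tsum_of_injective
        (f := fun i : Fin (N + 1) => (⟨i, Nat.lt_succ_iff.mp i.2⟩ : Set.Iic N))
        (fun a b hab => Fin.ext (congrArg (fun z : Set.Iic N => (z : ℕ)) hab))
        (fun k : Set.Iic N => ENNReal.ofReal (β k))
    have h2 : (ENNReal.ofReal (β N))⁻¹ ≤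
        lqNorm s.conjExponent (Set.Ici N) (fun k => ENNReal.ofReal (β k)⁻¹) := by
      rw [← hinv]
      exact le_lqNorm hs'0 (Set.mem_Ici.mpr le_rfl) (fun k => ENNReal.ofReal (β k)⁻¹)
    have h3 := (mul_le_mul' h1 h2).trans (hKN N hN)
    rwa [← div_eq_mul_inv, ENNReal.div_le_iff (hb0 N) (hbt N)] at h3
  · set σ := s.conjExponent.toReal with hσ
    have hσ0 : 0 < σ := ENNReal.toReal_pos hs'0 htop
    set κ := K ^ σ with hκ
    have hκt : κ ≠ ⊤ := ENNReal.rpow_ne_top_of_nonneg hσ0.le hKt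
    have hc : ∀ N, 1 ≤ N → ∑' i, (ENNReal.ofReal (β (N + i)))⁻¹ ^ σ ≤
        κ * (ENNReal.ofReal (β N))⁻¹ ^ σ := fun N hN => by
      have h1 := le_lqNorm hs0 (Set.mem_Iic.mpr (le_refl N)) (fun k => ENNReal.ofReal (β k))
      have h2 : (∑' i, (ENNReal.ofReal (β (N + i)))⁻¹ ^ σ) ^ (1 / σ) ≤
          lqNorm s.conjExponent (Set.Ici N) (fun k => ENNReal.ofReal (β k)⁻¹) := by
        rw [lqNorm, if_neg htop]
        simp only [hinv]
        gcongr
        exact ENNReal.tsum_comp_le_tsum_of_injective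
          (f := fun i : ℕ => (⟨N + i, Nat.le_add_right N i⟩ : Set.Ici N))
          (fun a b hab => by
            have := congrArg (fun z : Set.Ici N => (z : ℕ)) hab
            exact Nat.add_left_cancel this)
          (fun k : Set.Ici N => (ENNReal.ofReal (β k))⁻¹ ^ σ)
      have h3 := (mul_le_mul' h1 h2).trans (hKN N hN)
      rw [mul_comm, ← ENNReal.le_div_iff_mul_le (Or.inl (hb0 N)) (Or.inl (hbt N)), one_div,
        ENNReal.rpow_inv_le_iff hσ0, div_eq_mul_inv, ENNReal.mul_rpow_of_nonneg _ _ hσ0.le] at h3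
      exact h3
    clear_value κ
    refine ⟨κ ^ σ⁻¹, (κ / (κ + 1)) ^ σ⁻¹, ENNReal.rpow_ne_top_of_nonneg (by positivity) hκt,
      ENNReal.rpow_lt_one (ratio_lt_one hκt) (by positivity), fun k hk i => ?_⟩
    have h4 := geometric_of_tail_le (c := fun k => (ENNReal.ofReal (β k))⁻¹ ^ σ) hκt hc k hk i
    rw [← ENNReal.le_rpow_inv_iff hσ0, ENNReal.mul_rpow_of_nonneg _ _ (by positivity),
      ENNReal.mul_rpow_of_nonneg _ _ (by positivity), ENNReal.rpow_rpow_inv hσ0.ne',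
      ← ENNReal.rpow_natCast, ← ENNReal.rpow_mul, mul_comm (i : ℝ), ENNReal.rpow_mul,
      ENNReal.rpow_natCast] at h4
    rw [← div_eq_mul_inv, ENNReal.le_div_iff_mul_le (Or.inl (hb0 k)) (Or.inl (hbt k)), mul_comm,
      ← div_eq_mul_inv, ENNReal.div_le_iff (hb0 _) (hbt _)] at h4
    exact h4

/-- The Hardy tail condition forces geometric growth. -/
theorem HardyTail.exists_geometric {s : ℝ≥0∞} (hs : 1 ≤ s) {β : ℕ → ℝ}
    (hβ : ∀ k, 0 < β k) (h : HardyTail s β) :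
    ∃ D θ : ℝ≥0∞, D ≠ ⊤ ∧ θ < 1 ∧ ∀ k i,
      ENNReal.ofReal (β k) ≤ D * θ ^ i * ENNReal.ofReal (β (k + i)) := by
  obtain ⟨D, θ, hD, hθ, hb⟩ := h.exists_geometric_of_one_le hs hβ
  have hb0 : ∀ k, ENNReal.ofReal (β k) ≠ 0 := fun k => by simpa using hβ k
  -- The supremum runs over N ≥ 1, so k = 0 is reached through β_1 at the price of R = β_0/β_1 and
  -- one missing power of the ratio. Raising the ratio to at least 1/2 permits division by it.
  set θ' := max θ 2⁻¹ with hθ'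
  have hθ0 : θ' ≠ 0 := (lt_max_of_lt_right (by simp)).ne'
  have hθt : θ' < 1 := max_lt hθ (by simp)
  set R := ENNReal.ofReal (β 0) / ENNReal.ofReal (β 1) with hR
  have hRt : R ≠ ⊤ := ENNReal.div_ne_top ENNReal.ofReal_ne_top (hb0 1)
  refine ⟨D + 1 + R * D / θ', θ', ?_, hθt, fun k i => ?_⟩
  · have := ENNReal.div_ne_top (ENNReal.mul_ne_top hRt hD) hθ0
    finiteness
  rcases Nat.eq_zero_or_pos k with rfl | hk
  · rcases Nat.eq_zero_or_pos i with rfl | hi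
    · rw [pow_zero, mul_one, add_zero]
      calc ENNReal.ofReal (β 0) = 1 * ENNReal.ofReal (β 0) := (one_mul _).symm
        _ ≤ _ := by gcongr; exact le_add_right le_add_self
    · obtain ⟨l, rfl⟩ := Nat.exists_eq_add_of_le hi
      have h1 := hb 1 le_rfl l
      calc ENNReal.ofReal (β 0) = R * ENNReal.ofReal (β 1) :=
            (ENNReal.div_mul_cancel (hb0 1) ENNReal.ofReal_ne_top).symm
        _ ≤ R * (D * θ' ^ l * ENNReal.ofReal (β (1 + l))) := by
          gcongr
          exact h1.trans (by gcongr; exact le_max_left _ _)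
        _ = R * D / θ' * θ' ^ (1 + l) * ENNReal.ofReal (β (1 + l)) := by
          rw [pow_add, pow_one, ← mul_assoc (R * D / θ'),
            ENNReal.div_mul_cancel hθ0 (hθt.trans ENNReal.one_lt_top).ne]
          ring
        _ ≤ _ := by
          rw [zero_add]
          gcongr
          exact le_add_self
  · refine (hb k hk i).trans ?_
    gcongr
    · rw [add_assoc]; exact le_self_add
    · exact le_max_left _ _


/-! ### Hölder on cubes and the estimate of one frequency level -/

/-- The exponent σ₁ is designed for 1/r = 1/p + 1/σ₁: for r < p one has 1/σ₁ = (1/r)(1 - r/p), and r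
= p gives σ₁ = ∞. -/
theorem holderTriple_sigmaOne {p r : ℝ≥0∞} (hr : 0 < r) (hrp : r ≤ p) :
    ENNReal.HolderTriple p (sigmaOne p r) r := by
  refine ⟨?_⟩
  unfold sigmaOne ratioExp
  split_ifs with h
  · subst h
    simp [ENNReal.conjExponent, ENNReal.mul_top hr.ne']
  · have hlt : r < p := lt_of_le_of_ne hrp (Ne.symm h)
    have hrt : r ≠ ⊤ := (hlt.trans_le le_top).ne
    have h1 : 1 ≤ p / r := by
      rw [ENNReal.le_div_iff_mul_le (Or.inl hr.ne') (Or.inl hrt), one_mul]; exact hrp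
    have h2 := (ENNReal.HolderConjugate.conjExponent h1).inv_add_inv_eq_one
    have h3 : p⁻¹ = r⁻¹ * (p / r)⁻¹ := by
      rw [ENNReal.inv_div (Or.inl hrt) (Or.inl hr.ne'), div_eq_mul_inv, ← mul_assoc,
        ENNReal.inv_mul_cancel hr.ne' hrt, one_mul]
    rw [ENNReal.mul_inv (Or.inl hr.ne') (Or.inl hrt), h3, ← mul_add, h2, mul_one]

theorem sigmaOne_ne_zero {p r : ℝ≥0∞} (hr : 0 < r) : sigmaOne p r ≠ 0 :=
  mul_ne_zero hr.ne' (by simp [ENNReal.conjExponent])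

/-- Hölder's inequality on a cube with a positive weight. -/
theorem eLpNorm_cubeMeasure_le_mul {p r : ℝ≥0∞} (hr : 0 < r) (hrp : r ≤ p) {s : ℝ≥0∞} (hs : s ≤ r)
    {u : E n → ℝ} (hum : AEMeasurable u volume) (hup : ∀ᵐ x, 0 < u x) {F : E n → 𝕜}
    (hF : Continuous F) (k : ℕ) (m : Fin n → ℤ) :
    eLpNorm F s (cubeMeasure k m) ≤
      eLpNorm (fun x => (u x)⁻¹) (sigmaOne p r) (cubeMeasure k m) *
        eLpNorm (fun x => u x • F x) p (cubeMeasure k m) := by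
  have hac := cubeMeasure_absolutelyContinuous (n := n) k m
  have := holderTriple_sigmaOne hr hrp
  have : ENNReal.HolderTriple (sigmaOne p r) p r := ENNReal.HolderTriple.symm
  have hum' : AEStronglyMeasurable u (cubeMeasure k m) := (hum.mono_ac hac).aestronglyMeasurable
  have hui : AEStronglyMeasurable (fun x => (u x)⁻¹) (cubeMeasure k m) :=
    ((hum.mono_ac hac).inv).aestronglyMeasurable
  have hFm : AEStronglyMeasurable F (cubeMeasure k m) := hF.aestronglyMeasurable
  calc eLpNorm F s (cubeMeasure k m) ≤ eLpNorm F r (cubeMeasure k m) :=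
        eLpNorm_le_eLpNorm_of_exponent_le hs hFm
    _ = eLpNorm ((fun x => (u x)⁻¹) • fun x => u x • F x) r (cubeMeasure k m) := by
        refine eLpNorm_congr_ae ?_
        filter_upwards [hac.ae_le hup] with x hx
        simp only [Pi.smul_apply']
        rw [inv_smul_smul₀ hx.ne']
    _ ≤ _ := eLpNorm_smul_le_mul_eLpNorm (hum'.smul hFm) hui

theorem eLpNorm_smul_cubeMeasure_le {p : ℝ≥0∞} {v : E n → ℝ} {F : E n → 𝕜} {k : ℕ} {m : Fin n → ℤ}
    (hv : eLpNorm v p (cubeMeasure k m) ≠ 0) :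
    eLpNorm (fun x => v x • F x) p (cubeMeasure k m) ≤
      ⨆ x ∈ (openCube k m : Set (E n)), eLpNorm v p (cubeMeasure k m) * ‖F x‖ₑ := by
  simp_rw [← ENNReal.mul_iSup]
  set S := ⨆ x ∈ (openCube k m : Set (E n)), ‖F x‖ₑ with hS
  -- With an infinite supremum, `hv` excludes the product 0 · ∞ = 0.
  by_cases h : S = ⊤
  · rw [h, ENNReal.mul_top hv]; exact le_top
  lift S to ℝ≥0 using h with S'
  have h1 := eLpNorm_le_nnreal_smul_eLpNorm_of_ae_le_mul (f := fun x => v x • F x) (g := v)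
    (c := S') (μ := cubeMeasure k m) (by
      filter_upwards [ae_cubeMeasure_mem k m] with x hx
      have h2 : ‖F x‖ₑ ≤ S' := hS ▸ le_iSup₂ (f := fun x (_ : x ∈ (openCube k m : Set (E n))) =>
        ‖F x‖ₑ) x hx
      rw [nnnorm_smul, mul_comm]
      gcongr
      exact_mod_cast h2) p
  rw [mul_comm]
  exact h1

theorem lintegral_rpow_eq_eLpNorm {α F : Type*} [MeasurableSpace α] [NormedAddCommGroup F]
    {μ : ℝ} (hμ : 0 < μ) (f : α → F) (ν : Measure α) :
    ∫⁻ x, ‖f x‖ₑ ^ μ ∂ν = eLpNorm f (ENNReal.ofReal μ) ν ^ μ := by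
  rw [eLpNorm_eq_lintegral_rpow_enorm_toReal (by simpa using hμ) ENNReal.ofReal_ne_top,
    ENNReal.toReal_ofReal hμ.le, ← ENNReal.rpow_mul, one_div_mul_cancel hμ.ne', ENNReal.rpow_one]

theorem two_pow_mul_lintegral_eq_tsum (k : ℕ) (g : E n → ℝ≥0∞) :
    (2 : ℝ≥0∞) ^ (k * n) * ∫⁻ z, g z = ∑' m : Fin n → ℤ, ∫⁻ z, g z ∂cubeMeasure k m := by
  rw [← lintegral_sum_measure, sum_cubeMeasure, lintegral_smul_measure, smul_eq_mul]

/-- Integrals against the exponential weight, cube by cube. -/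
theorem two_pow_mul_lintegral_le_tsum {μ b : ℝ} (hμ : 0 < μ) (hb : 0 ≤ b) {k : ℕ} {m : Fin n → ℤ}
    {x : E n} (hx : x ∈ (openCube k m : Set (E n))) (c : ℝ≥0∞) (hc : c ≠ ⊤) (F : E n → 𝕜) :
    (2 : ℝ≥0∞) ^ (k * n) * ∫⁻ z, (c * ‖F z‖ₑ * expWeight (n * b) k x z) ^ μ ≤
      c ^ μ * ∑' m' : Fin n → ℤ,
        (ENNReal.ofReal (Real.exp (b * n) * Real.exp (-(b * latDist m m'))) *
          eLpNorm F (ENNReal.ofReal μ) (cubeMeasure k m')) ^ μ := by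
  rw [two_pow_mul_lintegral_eq_tsum, ← ENNReal.tsum_mul_left]
  refine ENNReal.tsum_le_tsum fun m' => ?_
  set w := ENNReal.ofReal (Real.exp (b * n) * Real.exp (-(b * latDist m m'))) with hw
  have hcw : (c * w) ^ μ ≠ ⊤ :=
    ENNReal.rpow_ne_top_of_nonneg hμ.le (ENNReal.mul_ne_top hc ENNReal.ofReal_ne_top)
  rw [ENNReal.mul_rpow_of_nonneg _ _ hμ.le, ← lintegral_rpow_eq_eLpNorm hμ, ← mul_assoc,
    ← ENNReal.mul_rpow_of_nonneg _ _ hμ.le, ← lintegral_const_mul' _ _ hcw]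
  refine lintegral_mono_ae ?_
  filter_upwards [ae_cubeMeasure_mem k m'] with z hz
  rw [← ENNReal.mul_rpow_of_nonneg _ _ hμ.le]
  refine ENNReal.rpow_le_rpow ?_ hμ.le
  calc c * ‖F z‖ₑ * expWeight (n * b) k x z ≤ c * ‖F z‖ₑ * w := by
        gcongr; exact expWeight_le_of_mem_openCube hb hx hz
    _ = _ := by ring

/-- Convolution with a summable sequence on the lattice is bounded on `ℓ_s`. -/
theorem seqNorm_tsum_latDist_le {s : ℝ≥0∞} (hs : 1 ≤ s) (g : ℕ → ℝ≥0∞) (N : (Fin n → ℤ) → ℝ≥0∞) :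
    seqNorm s (fun m => ∑' m' : Fin n → ℤ, g (latDist m m') * N m') ≤
      (∑' d : Fin n → ℤ, g (latDist d 0)) * seqNorm s N := by
  have hs0 : s ≠ 0 := (zero_lt_one.trans_le hs).ne'
  have h1 : ∀ m : Fin n → ℤ, ∑' m' : Fin n → ℤ, g (latDist m m') * N m' =
      ∑' d : Fin n → ℤ, g (latDist d 0) * N (m - d) := fun m => by
    rw [← (Equiv.subLeft m).tsum_eq]
    simp [latDist]
  simp_rw [h1]
  refine (seqNorm_tsum_le hs _).trans ?_
  rw [← ENNReal.tsum_mul_right]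
  refine ENNReal.tsum_le_tsum fun d => ?_
  rw [seqNorm_const_mul hs0]
  exact mul_le_mul_right (seqNorm_comp_equiv s (Equiv.subRight d) N).le _

/-- Estimate of one frequency level in the weight `v` by the higher levels in the weight `u`. -/
theorem exists_level_estimate (φ₀ : 𝓓((⊤ : Opens (E n)), 𝕜)) (hφ₀ : ∫ x, φ₀ x = 1)
    {p r : ℝ≥0∞} (hr : 0 < r) (hrp : r ≤ p) {μ : ℝ} (hμ : 0 < μ) (hμ1 : μ ≤ 1)
    (hμr : ENNReal.ofReal μ ≤ r) (M : ℕ) {v u : ℕ → E n → ℝ} {α : ℕ → ℝ} {α₃ C₁ : ℝ}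
    (hα₃ : 0 ≤ α₃) (hC₁ : 0 ≤ C₁)
    (hum : ∀ j, AEMeasurable (u j) volume) (hup : ∀ j, ∀ᵐ x, 0 < u j x)
    (hpos : ∀ k (m : Fin n → ℤ), avgNorm p k m (v k) ≠ 0)
    (hnb : ∀ k, ∀ m m' : Fin n → ℤ, (∀ i, |m i - m' i| ≤ 1) →
      avgNorm p k m (v k) ≤ (2 : ℝ≥0∞) ^ α₃ * avgNorm p k m' (v k))
    (hlow : ∀ k i, ∀ m : Fin n → ℤ, avgNorm p k m (v k) *
      avgNorm (sigmaOne p r) k m (fun x => (u (k + i) x)⁻¹) ≤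
        ENNReal.ofReal (C₁ * (α k / α (k + i)))) :
    ∃ C : ℝ≥0∞, C ≠ ⊤ ∧ ∀ f : Distr 𝕜 n, IsExpGrowth f → ∀ k,
      eLpNorm (fun x => v k x • conv φ₀ f k x) p volume ^ μ ≤
        C * ∑' i : ℕ, 2 ^ (i * n) * ((2 : ℝ≥0∞)⁻¹ ^ (M * i)) ^ μ *
          ENNReal.ofReal (α k / α (k + i)) ^ μ *
          eLpNorm (fun x => u (k + i) x • conv φ₀ f (k + i) x) p volume ^ μ := by
  have hp0 : p ≠ 0 := (hr.trans_le hrp).ne'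
  set s := p / ENNReal.ofReal μ with hs
  have hs1 : 1 ≤ s := by
    rw [hs, ENNReal.le_div_iff_mul_le (Or.inl (by simpa using hμ)) (Or.inl ENNReal.ofReal_ne_top),
      one_mul]
    exact hμr.trans hrp
  have hs0 : s ≠ 0 := (zero_lt_one.trans_le hs1).ne'
  -- The rate α₃ log 2 compensates the growth 2^{α₃ |m - m'|₁} of the means of v_k; the additional 1
  -- leaves the summable decay e^{-|m - m'|₁}.
  set b : ℝ := α₃ * Real.log 2 + 1 with hb
  have hb0 : 0 ≤ b := by have := Real.log_nonneg one_le_two; positivity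
  obtain ⟨C, hC⟩ := exists_enorm_conv_rpow_le_meanSum φ₀ hφ₀ hμ hμ1 M (B := n * b) (by positivity)
  set e := ENNReal.ofReal (Real.exp (b * n)) with he
  set Ω : ℝ≥0∞ := ∑' d : Fin n → ℤ, ENNReal.ofReal (Real.exp (-(μ * latDist d 0))) with hΩ
  have hΩt : Ω ≠ ⊤ := by
    rw [hΩ, tsum_exp_neg_latDist]
    exact ENNReal.pow_ne_top (tsum_exp_neg_natAbs_ne_top hμ)
  refine ⟨C * (e * ENNReal.ofReal C₁) ^ μ * Ω, ?_, fun f hf k => ?_⟩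
  · refine ENNReal.mul_ne_top (ENNReal.mul_ne_top ENNReal.coe_ne_top
      (ENNReal.rpow_ne_top_of_nonneg hμ.le ?_)) hΩt
    exact ENNReal.mul_ne_top ENNReal.ofReal_ne_top ENNReal.ofReal_ne_top
  set T : (Fin n → ℤ) → ℝ≥0∞ := fun m => eLpNorm (v k) p (cubeMeasure k m) with hT
  set S : ℕ → (Fin n → ℤ) → ℝ≥0∞ := fun i m =>
    eLpNorm (fun x => u (k + i) x • conv φ₀ f (k + i) x) p (cubeMeasure k m) with hSdef
  set c : ℕ → ℝ≥0∞ := fun i => 2 ^ (i * n) * ((2 : ℝ≥0∞)⁻¹ ^ (M * i)) ^ μ *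
    ENNReal.ofReal (α k / α (k + i)) ^ μ with hc
  -- Ratio between L_p norms for the normalized cube measures and for Lebesgue measure. It occurs on
  -- both sides and is cancelled at the end.
  set lam : ℝ≥0∞ := ((2 : ℝ≥0∞) ^ (k * n)) ^ (1 / p).toReal with hlam
  have hlam0 : lam ^ μ ≠ 0 := by
    rw [hlam, ← ENNReal.rpow_mul]
    exact (ENNReal.rpow_pos (by positivity) (by finiteness)).ne'
  have hlamt : lam ^ μ ≠ ⊤ := by
    rw [hlam, ← ENNReal.rpow_mul]
    exact ENNReal.rpow_ne_top_of_nonneg (by positivity) (by finiteness)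
  -- the local estimate on a cube
  have hcell : ∀ (i : ℕ) (m m' : Fin n → ℤ),
      T m * (ENNReal.ofReal (Real.exp (b * n) * Real.exp (-(b * latDist m m'))) *
        eLpNorm (conv φ₀ f (k + i)) (ENNReal.ofReal μ) (cubeMeasure k m')) ≤
      e * ENNReal.ofReal C₁ * ENNReal.ofReal (α k / α (k + i)) *
        (ENNReal.ofReal (Real.exp (-(latDist m m' : ℝ))) * S i m') := by
    intro i m m'
    have h1 : T m ≤ ((2 : ℝ≥0∞) ^ α₃) ^ latDist m m' * T m' := le_pow_latDist_mul (hnb k) m m'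
    have h2 := eLpNorm_cubeMeasure_le_mul hr hrp hμr (hum (k + i)) (hup (k + i))
      (hf.continuous_conv φ₀ (k + i)) k m'
    have h3 : T m' * eLpNorm (fun x => (u (k + i) x)⁻¹) (sigmaOne p r) (cubeMeasure k m') ≤
        ENNReal.ofReal C₁ * ENNReal.ofReal (α k / α (k + i)) :=
      (hlow k i m').trans (le_of_eq (ENNReal.ofReal_mul hC₁))
    -- Here the choice of `b` takes effect.
    have h4 : ((2 : ℝ≥0∞) ^ α₃) ^ latDist m m' * ENNReal.ofReal (Real.exp (-(b * latDist m m'))) =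
        ENNReal.ofReal (Real.exp (-(latDist m m' : ℝ))) := by
      have h5 : ((2 : ℝ≥0∞) ^ α₃) = ENNReal.ofReal (Real.exp (α₃ * Real.log 2)) := by
        rw [mul_comm, ← Real.rpow_def_of_pos two_pos,
          ← ENNReal.ofReal_rpow_of_pos two_pos, ENNReal.ofReal_ofNat]
      rw [h5, ← ENNReal.ofReal_pow (Real.exp_nonneg _), ← Real.exp_nat_mul,
        ← ENNReal.ofReal_mul (Real.exp_nonneg _), ← Real.exp_add]
      congr 2
      rw [hb]; ring
    rw [ENNReal.ofReal_mul (Real.exp_nonneg _)]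
    calc _ ≤ (((2 : ℝ≥0∞) ^ α₃) ^ latDist m m' * T m') *
          (e * ENNReal.ofReal (Real.exp (-(b * latDist m m'))) *
            (eLpNorm (fun x => (u (k + i) x)⁻¹) (sigmaOne p r) (cubeMeasure k m') * S i m')) := by
          gcongr
      _ = e * (T m' * eLpNorm (fun x => (u (k + i) x)⁻¹) (sigmaOne p r) (cubeMeasure k m')) *
          ((((2 : ℝ≥0∞) ^ α₃) ^ latDist m m' *
            ENNReal.ofReal (Real.exp (-(b * latDist m m')))) * S i m') := by ring
      _ ≤ e * (ENNReal.ofReal C₁ * ENNReal.ofReal (α k / α (k + i))) *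
          (ENNReal.ofReal (Real.exp (-(latDist m m' : ℝ))) * S i m') := by rw [h4]; gcongr
      _ = _ := by ring
  set X : (Fin n → ℤ) → ℝ≥0∞ := fun m =>
    ⨆ x ∈ (openCube k m : Set (E n)), T m * ‖conv φ₀ f k x‖ₑ with hX
  have hXle : ∀ m, X m ^ μ ≤ ∑' i, C * (e * ENNReal.ofReal C₁) ^ μ * c i *
      ∑' m' : Fin n → ℤ, ENNReal.ofReal (Real.exp (-(μ * latDist m m'))) * S i m' ^ μ := by
    intro m
    rw [← ENNReal.le_rpow_inv_iff hμ]
    refine iSup₂_le fun x hx => ?_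
    rw [ENNReal.le_rpow_inv_iff hμ, ENNReal.mul_rpow_of_nonneg _ _ hμ.le]
    refine (mul_le_mul_right (hC f hf k x) _).trans ?_
    rw [meanSum, ← ENNReal.tsum_mul_left, ← ENNReal.tsum_mul_left]
    refine ENNReal.tsum_le_tsum fun i => ?_
    have h1 := two_pow_mul_lintegral_le_tsum hμ hb0 hx ((2 : ℝ≥0∞)⁻¹ ^ (M * i))
      (by finiteness) (conv φ₀ f (k + i))
    have h2 : T m ^ μ * ∑' m' : Fin n → ℤ,
        (ENNReal.ofReal (Real.exp (b * n) * Real.exp (-(b * latDist m m'))) *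
          eLpNorm (conv φ₀ f (k + i)) (ENNReal.ofReal μ) (cubeMeasure k m')) ^ μ ≤
        (e * ENNReal.ofReal C₁ * ENNReal.ofReal (α k / α (k + i))) ^ μ *
        ∑' m' : Fin n → ℤ, ENNReal.ofReal (Real.exp (-(μ * latDist m m'))) * S i m' ^ μ := by
      rw [← ENNReal.tsum_mul_left, ← ENNReal.tsum_mul_left]
      refine ENNReal.tsum_le_tsum fun m' => ?_
      rw [← ENNReal.mul_rpow_of_nonneg _ _ hμ.le]
      refine (ENNReal.rpow_le_rpow (hcell i m m') hμ.le).trans (le_of_eq ?_)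
      rw [ENNReal.mul_rpow_of_nonneg _ _ hμ.le, ENNReal.mul_rpow_of_nonneg _ (S i m') hμ.le,
        ENNReal.ofReal_rpow_of_pos (Real.exp_pos _), ← Real.exp_mul]
      congr 4
      ring
    -- The means of F_{k+i} are normalized at level k + i but evaluated on cubes of level k, which
    -- leaves the factor 2^{in}.
    calc _ = C * 2 ^ (i * n) * (T m ^ μ * (2 ^ (k * n) * ∫⁻ z, ((2 : ℝ≥0∞)⁻¹ ^ (M * i) *
            ‖conv φ₀ f (k + i) z‖ₑ * expWeight (n * b) k x z) ^ μ)) := by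
          rw [add_mul k, pow_add]; ring
      _ ≤ C * 2 ^ (i * n) * (T m ^ μ * (((2 : ℝ≥0∞)⁻¹ ^ (M * i)) ^ μ * ∑' m' : Fin n → ℤ,
          (ENNReal.ofReal (Real.exp (b * n) * Real.exp (-(b * latDist m m'))) *
          eLpNorm (conv φ₀ f (k + i)) (ENNReal.ofReal μ) (cubeMeasure k m')) ^ μ)) := by
          gcongr
      _ = C * 2 ^ (i * n) * ((2 : ℝ≥0∞)⁻¹ ^ (M * i)) ^ μ * (T m ^ μ * ∑' m' : Fin n → ℤ,
          (ENNReal.ofReal (Real.exp (b * n) * Real.exp (-(b * latDist m m'))) *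
          eLpNorm (conv φ₀ f (k + i)) (ENNReal.ofReal μ) (cubeMeasure k m')) ^ μ) := by ring
      _ ≤ C * 2 ^ (i * n) * ((2 : ℝ≥0∞)⁻¹ ^ (M * i)) ^ μ *
          ((e * ENNReal.ofReal C₁ * ENNReal.ofReal (α k / α (k + i))) ^ μ *
          ∑' m' : Fin n → ℤ, ENNReal.ofReal (Real.exp (-(μ * latDist m m'))) * S i m' ^ μ) := by
          gcongr
      _ = _ := by
          rw [ENNReal.mul_rpow_of_nonneg (e * ENNReal.ofReal C₁) _ hμ.le, hc]; ring
  have hsum : ∀ {G : E n → 𝕜}, seqNorm p (fun m => eLpNorm G p (cubeMeasure k m)) =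
      lam * eLpNorm G p volume := fun {G} => by
    rw [← eLpNorm_sum_measure hp0, sum_cubeMeasure,
      eLpNorm_smul_measure_of_ne_zero (by positivity), smul_eq_mul]
  have hleft : lam * eLpNorm (fun x => v k x • conv φ₀ f k x) p volume ≤ seqNorm p X := by
    rw [← hsum]
    exact seqNorm_mono p fun m => eLpNorm_smul_cubeMeasure_le (hpos k m)
  have hmain : lam ^ μ * eLpNorm (fun x => v k x • conv φ₀ f k x) p volume ^ μ ≤
      lam ^ μ * (C * (e * ENNReal.ofReal C₁) ^ μ * Ω * ∑' i : ℕ, c i *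
        eLpNorm (fun x => u (k + i) x • conv φ₀ f (k + i) x) p volume ^ μ) := by
    calc _ = (lam * eLpNorm (fun x => v k x • conv φ₀ f k x) p volume) ^ μ :=
          (ENNReal.mul_rpow_of_nonneg _ _ hμ.le).symm
      _ ≤ seqNorm p X ^ μ := by gcongr
      _ = seqNorm s (fun m => X m ^ μ) := (seqNorm_rpow hp0 hμ X).symm
      _ ≤ seqNorm s (fun m => ∑' i, C * (e * ENNReal.ofReal C₁) ^ μ * c i *
          ∑' m' : Fin n → ℤ, ENNReal.ofReal (Real.exp (-(μ * latDist m m'))) * S i m' ^ μ) :=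
        seqNorm_mono s hXle
      _ ≤ ∑' i, C * (e * ENNReal.ofReal C₁) ^ μ * c i * (Ω * seqNorm s (fun m => S i m ^ μ)) := by
        refine (seqNorm_tsum_le hs1 _).trans (ENNReal.tsum_le_tsum fun i => ?_)
        rw [seqNorm_const_mul hs0]
        gcongr
        exact seqNorm_tsum_latDist_le hs1 (fun N => ENNReal.ofReal (Real.exp (-(μ * N))))
          (fun m => S i m ^ μ)
      _ = ∑' i, lam ^ μ * (C * (e * ENNReal.ofReal C₁) ^ μ * Ω * (c i *
        eLpNorm (fun x => u (k + i) x • conv φ₀ f (k + i) x) p volume ^ μ)) := by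
        congr 1; ext i
        rw [seqNorm_rpow hp0 hμ, hSdef, hsum, ENNReal.mul_rpow_of_nonneg lam _ hμ.le]
        ring
      _ = _ := by rw [ENNReal.tsum_mul_left, ENNReal.tsum_mul_left]
  exact (ENNReal.mul_le_mul_iff_right hlam0 hlamt).mp hmain


/-! ### The averaged weights t̄ -/

theorem eLpNorm_const_cubeMeasure {p : ℝ≥0∞} (hp : p ≠ 0) (k : ℕ) (m : Fin n → ℤ) (c : ℝ) :
    eLpNorm (fun _ : E n => c) p (cubeMeasure k m) = ‖c‖ₑ := by
  rw [eLpNorm_const c hp (IsProbabilityMeasure.ne_zero _)]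
  simp

/-- The factor 2^{kn/p} is exactly the normalization of the mean norm, so t̄_k is constant on each
cube, equal to the mean of t_k there; for p = ∞ the exponent is 0. -/
theorem tbar_eq_of_mem {p : ℝ≥0∞} {t : ℕ → E n → ℝ} {k : ℕ} {m : Fin n → ℤ} {x : E n}
    (hx : x ∈ (halfOpenCube k m : Set (E n))) :
    tbar p t k x = (avgNorm p k m (t k)).toReal := by
  have h1 : avgNorm p k m (t k) =
      ((2 : ℝ≥0∞) ^ (k * n)) ^ (1 / p).toReal * cubeNorm p t k m :=
    eLpNorm_cubeMeasure p k m (t k)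
  rw [tbar, tsum_eq_single m fun m' hm' => Set.indicator_of_notMem (fun hx' => hm' ?_) _,
    Set.indicator_of_mem hx, h1, ENNReal.toReal_mul]
  · congr 1
    rw [← ENNReal.toReal_rpow, ENNReal.toReal_pow, ENNReal.toReal_ofNat, one_div, Real.rpow_mul two_pos.le]
    norm_cast
  · rw [mem_halfOpenCube_iff] at hx hx'
    exact hx'.symm.trans hx

theorem measurable_tbar (p : ℝ≥0∞) (t : ℕ → E n → ℝ) (k : ℕ) : Measurable (tbar p t k) := by
  have h : tbar p t k = fun x : E n =>
      (avgNorm p k (fun i => ⌊x i * 2 ^ k⌋) (t k)).toReal := by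
    ext x
    exact tbar_eq_of_mem (mem_halfOpenCube_iff.mpr rfl)
  rw [h]
  have h2 : Measurable fun x : E n => fun i => ⌊x i * 2 ^ k⌋ := by
    fun_prop
  exact (measurable_of_countable fun m : Fin n → ℤ => (avgNorm p k m (t k)).toReal).comp h2

theorem exists_isCompact_openCube_subset (k : ℕ) (m : Fin n → ℤ) :
    ∃ K : Set (E n), IsCompact K ∧ openCube k m ⊆ K := by
  refine ⟨WithLp.toLp 2 '' (Set.univ.pi fun i : Fin n =>
      Set.Icc ((m i : ℝ) / 2 ^ k) (((m i : ℝ) + 1) / 2 ^ k)),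
    (isCompact_univ_pi fun _ => isCompact_Icc).image (PiLp.continuous_toLp 2 _), fun x hx => ?_⟩
  exact ⟨WithLp.ofLp x, fun i _ => ⟨(hx i).1.le, (hx i).2.le⟩, rfl⟩

namespace MemX

variable {p σ₁ σ₂ : ℝ≥0∞} {α₁ α₂ : ℕ → ℝ} {α₃ : ℝ} {t : ℕ → E n → ℝ}

theorem avgNorm_ne_top (ht : MemX p σ₁ σ₂ α₁ α₂ α₃ t) (k : ℕ) (m : Fin n → ℤ) :
    avgNorm p k m (t k) ≠ ⊤ := by
  obtain ⟨K, hK, hmK⟩ := exists_isCompact_openCube_subset (n := n) k m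
  have h1 : eLpNorm (t k) p (cubeMeasure k m) ≠ ⊤ := by
    rw [eLpNorm_cubeMeasure]
    refine ENNReal.mul_ne_top (ENNReal.rpow_ne_top_of_nonneg ENNReal.toReal_nonneg (by finiteness)) ?_
    exact ((eLpNorm_mono_measure _ (Measure.restrict_mono_set _ hmK)).trans_lt
      (ht.admissible k K hK).2).ne
  exact h1

theorem avgNorm_ne_zero (ht : MemX p σ₁ σ₂ α₁ α₂ α₃ t) (k : ℕ) (m : Fin n → ℤ) :
    avgNorm p k m (t k) ≠ 0 := by
  have h1 : eLpNorm (t k) p (cubeMeasure k m) ≠ 0 := by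
    rw [eLpNorm_cubeMeasure]
    refine mul_ne_zero (ENNReal.rpow_pos (by positivity) (by finiteness)).ne'
      (ht.neighbour k m m (by simp)).1.ne'
  exact h1

theorem avgNorm_le_neighbour (ht : MemX p σ₁ σ₂ α₁ α₂ α₃ t) (k : ℕ) (m m' : Fin n → ℤ)
    (h : ∀ i, |m i - m' i| ≤ 1) :
    avgNorm p k m (t k) ≤ (2 : ℝ≥0∞) ^ α₃ * avgNorm p k m' (t k) := by
  have h1 : eLpNorm (t k) p (cubeMeasure k m) ≤
      (2 : ℝ≥0∞) ^ α₃ * eLpNorm (t k) p (cubeMeasure k m') := by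
    rw [eLpNorm_cubeMeasure, eLpNorm_cubeMeasure, mul_left_comm]
    exact mul_le_mul_right (ht.neighbour k m m' h).2 _
  exact h1

theorem tbar_pos (ht : MemX p σ₁ σ₂ α₁ α₂ α₃ t) (k : ℕ) (x : E n) : 0 < tbar p t k x := by
  rw [tbar_eq_of_mem (mem_halfOpenCube_iff.mpr rfl)]
  exact ENNReal.toReal_pos (ht.avgNorm_ne_zero k _) (ht.avgNorm_ne_top k _)

/-- On its own scale the averaging preserves L_p means, so finiteness, positivity, the neighbour
condition and the first factor of condition 1 pass from t to t̄. -/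
theorem avgNorm_tbar (ht : MemX p σ₁ σ₂ α₁ α₂ α₃ t) (hp : p ≠ 0) (k : ℕ) (m : Fin n → ℤ) :
    avgNorm p k m (tbar p t k) = avgNorm p k m (t k) := by
  have h1 : eLpNorm (tbar p t k) p (cubeMeasure k m) = avgNorm p k m (t k) := by
    rw [eLpNorm_congr_ae (g := fun _ => (avgNorm p k m (t k)).toReal),
      eLpNorm_const_cubeMeasure hp, Real.enorm_of_nonneg ENNReal.toReal_nonneg,
      ENNReal.ofReal_toReal (ht.avgNorm_ne_top k m)]
    filter_upwards [ae_cubeMeasure_mem k m] with x hx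
    exact tbar_eq_of_mem (openCube_subset_halfOpenCube k m hx)
  exact h1

/-- The reciprocal of the averaged weight is dominated in mean by that of the weight. -/
theorem avgNorm_tbar_inv_le {r : ℝ≥0∞} (hr : 0 < r) (hrp : r ≤ p)
    (ht : MemX p (sigmaOne p r) σ₂ α₁ α₂ α₃ t) {k j : ℕ} (hkj : k ≤ j) (m : Fin n → ℤ) :
    avgNorm (sigmaOne p r) k m (fun x => (tbar p t j x)⁻¹) ≤
      avgNorm (sigmaOne p r) k m (fun x => (t j x)⁻¹) := by
  have hσ : sigmaOne p r ≠ 0 := sigmaOne_ne_zero hr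
  have h1 : ∀ m' : Fin n → ℤ, eLpNorm (fun x => (tbar p t j x)⁻¹) (sigmaOne p r) (cubeMeasure j m') ≤
      eLpNorm (fun x => (t j x)⁻¹) (sigmaOne p r) (cubeMeasure j m') := fun m' => by
    set T := avgNorm p j m' (t j) with hT
    have hT0 : T ≠ 0 := ht.avgNorm_ne_zero j m'
    have hTt : T ≠ ⊤ := ht.avgNorm_ne_top j m'
    have h2 : eLpNorm (fun x => (tbar p t j x)⁻¹) (sigmaOne p r) (cubeMeasure j m') = T⁻¹ := by
      rw [eLpNorm_congr_ae (g := fun _ => T.toReal⁻¹), eLpNorm_const_cubeMeasure hσ,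
        Real.enorm_of_nonneg (by positivity), ENNReal.ofReal_inv_of_pos (ENNReal.toReal_pos hT0 hTt),
        ENNReal.ofReal_toReal hTt]
      filter_upwards [ae_cubeMeasure_mem j m'] with x hx
      rw [tbar_eq_of_mem (openCube_subset_halfOpenCube j m' hx)]
    -- Hölder for 1 = t_j^{-1} t_j on a probability space gives 1 ≤ ‖t_j^{-1}‖_{σ₁} ‖t_j‖_p, that
    -- is, the claim on a cube of level j; larger cubes follow by decomposition.
    have h3 := eLpNorm_cubeMeasure_le_mul hr hrp le_rfl (ht.measurable j) (ht.pos j)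
      (F := fun _ : E n => (1 : ℝ)) continuous_const j m'
    rw [eLpNorm_const_cubeMeasure hr.ne', enorm_one] at h3
    simp only [smul_eq_mul, mul_one] at h3
    rw [h2]
    rwa [← one_div, ENNReal.div_le_iff hT0 hTt]
  have hc0 : ((2 : ℝ≥0∞) ^ (j * n)) ^ (1 / sigmaOne p r).toReal ≠ 0 :=
    (ENNReal.rpow_pos (by positivity) (by finiteness)).ne'
  have hct : ((2 : ℝ≥0∞) ^ (j * n)) ^ (1 / sigmaOne p r).toReal ≠ ⊤ :=
    ENNReal.rpow_ne_top_of_nonneg ENNReal.toReal_nonneg (by finiteness)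
  change eLpNorm _ _ (cubeMeasure k m) ≤ eLpNorm _ _ (cubeMeasure k m)
  rw [eLpNorm_cubeMeasure, eLpNorm_cubeMeasure]
  refine mul_le_mul_right (eLpNorm_restrict_openCube_mono hσ hkj m fun m' => ?_) _
  have h4 := h1 m'
  rwa [eLpNorm_cubeMeasure, eLpNorm_cubeMeasure, ENNReal.mul_le_mul_iff_right hc0 hct] at h4

end MemX

/-! ### Comparison of two weight sequences -/

/-- Under the Hardy condition, a large power of two absorbs the growth of the weights. -/
theorem exists_coeff_le {s : ℝ≥0∞} (hs : 1 ≤ s) {α : ℕ → ℝ} (hα : ∀ k, 0 < α k) {A μ : ℝ}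
    (hμ : 0 < μ) (h : HardyTail s (fun k => ((2 : ℝ) ^ ((k : ℝ) * A) * α k) ^ μ)) (n : ℕ) :
    ∃ (M : ℕ) (D θ : ℝ≥0∞), D ≠ ⊤ ∧ θ < 1 ∧ ∀ k i : ℕ,
      2 ^ (i * n) * ((2 : ℝ≥0∞)⁻¹ ^ (M * i)) ^ μ * ENNReal.ofReal (α k / α (k + i)) ^ μ ≤
        D * θ ^ i := by
  obtain ⟨D, θ, hD, hθ, hb⟩ := h.exists_geometric hs fun k => by have := hα k; positivity
  -- Mμ ≥ n + Aμ: the decay 2^{-Miμ} must beat 2^{in} from the μ-means and 2^{iAμ} from the factor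
  -- 2^{kA} in the Hardy condition.
  obtain ⟨M, hM⟩ := exists_nat_ge ((n + A * μ) / μ)
  rw [div_le_iff₀ hμ] at hM
  refine ⟨M, D, θ, hD, hθ, fun k i => ?_⟩
  have hk := hα k
  have hki := hα (k + i)
  refine le_trans ?_ (ENNReal.div_le_of_le_mul (hb k i))
  rw [← ENNReal.ofReal_div_of_pos (by positivity)]
  have h1 : 2 ^ (i * n) * ((2 : ℝ≥0∞)⁻¹ ^ (M * i)) ^ μ =
      ENNReal.ofReal (2 ^ (((i : ℝ) * n) - M * i * μ)) := by
    rw [← ENNReal.ofReal_rpow_of_pos two_pos, ENNReal.ofReal_ofNat,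
      ENNReal.rpow_sub _ _ two_ne_zero ENNReal.ofNat_ne_top, ENNReal.rpow_mul _ (M * i : ℝ) μ,
      div_eq_mul_inv, ← ENNReal.inv_rpow, ← ENNReal.inv_rpow]
    norm_cast
  rw [h1, ENNReal.ofReal_rpow_of_pos (by positivity), ← ENNReal.ofReal_mul (by positivity),
    ← Real.div_rpow (by positivity) (by positivity), mul_div_mul_comm,
    Real.mul_rpow (by positivity) (by positivity), ← Real.rpow_sub two_pos, ← Real.rpow_mul two_pos.le]
  refine ENNReal.ofReal_le_ofReal (mul_le_mul_of_nonneg_right ?_ (by positivity))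
  refine Real.rpow_le_rpow_of_exponent_le one_le_two ?_
  push_cast
  nlinarith [mul_le_mul_of_nonneg_left hM (Nat.cast_nonneg (α := ℝ) i)]

/-- Comparison of Besov quasi-norms with respect to two weight sequences. -/
theorem exists_besovNorm_le (φ₀ : 𝓓((⊤ : Opens (E n)), 𝕜)) (hφ₀ : ∫ x, φ₀ x = 1)
    {p q r : ℝ≥0∞} (hr : 0 < r) (hrp : r ≤ p) (hq : 0 < q) {A μ : ℝ} (hμ : 0 < μ)
    (hμ_le : ENNReal.ofReal μ ≤ min 1 (min q r)) {v u : ℕ → E n → ℝ} {α : ℕ → ℝ}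
    (hα : ∀ k, 0 < α k)
    (h_tail : HardyTail (q / ENNReal.ofReal μ) (fun k => ((2 : ℝ) ^ ((k : ℝ) * A) * α k) ^ μ))
    {α₃ C₁ : ℝ} (hα₃ : 0 ≤ α₃) (hC₁ : 0 ≤ C₁)
    (hum : ∀ j, AEMeasurable (u j) volume) (hup : ∀ j, ∀ᵐ x, 0 < u j x)
    (hpos : ∀ k (m : Fin n → ℤ), avgNorm p k m (v k) ≠ 0)
    (hnb : ∀ k, ∀ m m' : Fin n → ℤ, (∀ i, |m i - m' i| ≤ 1) →
      avgNorm p k m (v k) ≤ (2 : ℝ≥0∞) ^ α₃ * avgNorm p k m' (v k))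
    (hlow : ∀ k i, ∀ m : Fin n → ℤ, avgNorm p k m (v k) *
      avgNorm (sigmaOne p r) k m (fun x => (u (k + i) x)⁻¹) ≤
        ENNReal.ofReal (C₁ * (α k / α (k + i)))) :
    ∃ C : ℝ≥0, ∀ f : Distr 𝕜 n, IsExpGrowth f →
      besovNorm φ₀ p q v f ≤ C * besovNorm φ₀ p q u f := by
  obtain ⟨hμ1, hμq, hμr⟩ : ENNReal.ofReal μ ≤ 1 ∧ ENNReal.ofReal μ ≤ q ∧ ENNReal.ofReal μ ≤ r := by
    simpa only [le_min_iff] using hμ_le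
  rw [ENNReal.ofReal_le_one] at hμ1
  set s := q / ENNReal.ofReal μ with hs
  have hs1 : 1 ≤ s := by
    rw [hs, ENNReal.le_div_iff_mul_le (Or.inl (by simpa using hμ)) (Or.inl ENNReal.ofReal_ne_top),
      one_mul]
    exact hμq
  have hs0 : s ≠ 0 := (zero_lt_one.trans_le hs1).ne'
  obtain ⟨M, D, θ, hD, hθ, hcoeff⟩ := exists_coeff_le hs1 hα hμ h_tail n
  obtain ⟨C, hC, hlevel⟩ := exists_level_estimate φ₀ hφ₀ hr hrp hμ hμ1 hμr M hα₃ hC₁ hum hup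
    hpos hnb hlow
  -- Sum of the geometric series of coefficients, with the μ-th root undoing the passage to μ-th
  -- powers.
  set K : ℝ≥0∞ := (C * (D * (1 - θ)⁻¹)) ^ μ⁻¹ with hK
  have hKt : K ≠ ⊤ := by
    refine ENNReal.rpow_ne_top_of_nonneg (by positivity) ?_
    refine ENNReal.mul_ne_top hC (ENNReal.mul_ne_top hD ?_)
    exact ENNReal.inv_ne_top.mpr (tsub_pos_of_lt hθ).ne'
  refine ⟨K.toNNReal, fun f hf => ?_⟩
  rw [ENNReal.coe_toNNReal hKt, besovNorm, besovNorm, lqNorm_univ, lqNorm_univ]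
  set a : ℕ → ℝ≥0∞ := fun k => eLpNorm (fun x => v k x • conv φ₀ f k x) p volume with ha
  set b : ℕ → ℝ≥0∞ := fun k => eLpNorm (fun x => u k x • conv φ₀ f k x) p volume with hb
  rw [← ENNReal.rpow_le_rpow_iff hμ, ENNReal.mul_rpow_of_nonneg _ _ hμ.le, hK,
    ENNReal.rpow_inv_rpow hμ.ne']
  calc seqNorm q a ^ μ = seqNorm s (fun k => a k ^ μ) := (seqNorm_rpow hq.ne' hμ a).symm
    _ ≤ seqNorm s (fun k => ∑' i, C * (D * θ ^ i) * b (k + i) ^ μ) := by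
      refine seqNorm_mono s fun k => (hlevel f hf k).trans ?_
      rw [← ENNReal.tsum_mul_left]
      refine ENNReal.tsum_le_tsum fun i => ?_
      rw [← mul_assoc C]
      exact mul_le_mul_left (mul_le_mul_right (hcoeff k i) _) _
    _ ≤ ∑' i, C * (D * θ ^ i) * seqNorm s (fun k => b (k + i) ^ μ) := by
      refine (seqNorm_tsum_le hs1 _).trans (ENNReal.tsum_le_tsum fun i => ?_)
      rw [seqNorm_const_mul hs0]
    _ ≤ ∑' i, C * (D * θ ^ i) * seqNorm q b ^ μ := by
      refine ENNReal.tsum_le_tsum fun i => mul_le_mul_right ?_ _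
      rw [← seqNorm_rpow hq.ne' hμ b]
      exact seqNorm_comp_le s (add_left_injective i) (fun k => b k ^ μ)
    _ = _ := by
      rw [ENNReal.tsum_mul_right, ENNReal.tsum_mul_left, ENNReal.tsum_mul_left,
        ENNReal.tsum_geometric]

end VarBesov
end

theorem theorem3p3 {𝕜 : Type*} [RCLike 𝕜] (n : ℕ) (hn : 1 ≤ n)
    (p q r : ℝ≥0∞) (hp : 0 < p) (hq : 0 < q) (hr : 0 < r) (hrp : r ≤ p)
    (α₁ α₂ : ℕ → ℝ) (hα₁ : ∀ k, 0 < α₁ k) (hα₂ : ∀ k, 0 < α₂ k)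
    (α₃ : ℝ) (hα₃ : 0 ≤ α₃)
    (t : ℕ → E n → ℝ) (ht : MemX p (sigmaOne p r) p α₁ α₂ α₃ t)
    (φ₀ : 𝓓((⊤ : Opens (E n)), 𝕜)) (hφ₀ : ∫ x, φ₀ x = 1)
    (L : ℕ) (hL : IsMomentOrder (phi φ₀) L)
    (A μ : ℝ) (hA : 0 < A) (hμ : 0 < μ)
    (hμ_le : ENNReal.ofReal μ ≤ min 1 (min q r))
    (h_tail : HardyTail (q / ENNReal.ofReal μ)
      (fun k => ((2 : ℝ) ^ ((k : ℝ) * A) * α₁ k) ^ μ))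
    (h_head : HardyHead (q / ENNReal.ofReal μ)
      (fun k => ((2 : ℝ) ^ (-((k : ℝ) * (1 + L))) * α₂ k) ^ μ)) :
    besovSpace φ₀ p q t = besovSpace φ₀ p q (tbar p t) ∧
      ∃ c C : ℝ≥0, 0 < c ∧ 0 < C ∧ ∀ f ∈ besovSpace φ₀ p q t,
        c * besovNorm φ₀ p q t f ≤ besovNorm φ₀ p q (tbar p t) f ∧
        besovNorm φ₀ p q (tbar p t) f ≤ C * besovNorm φ₀ p q t f := by
  obtain ⟨C₁, hC₁, hlow⟩ := ht.lower
  have hp0 : p ≠ 0 := hp.ne'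
  -- For v = t̄, u = t the mixed condition 1 is the original one, as only the L_p mean of v_k occurs
  -- in it. In the reverse direction the σ₁-mean of t̄_j^{-1} is first dominated by that of
  -- t_j^{-1}.
  obtain ⟨K₁, hK₁⟩ := exists_besovNorm_le (v := tbar p t) (u := t) φ₀ hφ₀ hr hrp hq hμ hμ_le hα₁
    h_tail hα₃ hC₁.le ht.measurable ht.pos
    (fun k m => by rw [ht.avgNorm_tbar hp0]; exact ht.avgNorm_ne_zero k m)
    (fun k m m' h => by
      rw [ht.avgNorm_tbar hp0, ht.avgNorm_tbar hp0]; exact ht.avgNorm_le_neighbour k m m' h)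
    (fun k i m => by
      rw [ht.avgNorm_tbar hp0]; exact hlow k (k + i) (Nat.le_add_right k i) m)
  obtain ⟨K₂, hK₂⟩ := exists_besovNorm_le (v := t) (u := tbar p t) φ₀ hφ₀ hr hrp hq hμ hμ_le hα₁
    h_tail hα₃ hC₁.le (fun j => (measurable_tbar p t j).aemeasurable)
    (fun j => Filter.Eventually.of_forall (ht.tbar_pos j)) ht.avgNorm_ne_zero
    ht.avgNorm_le_neighbour
    (fun k i m => (mul_le_mul_right (MemX.avgNorm_tbar_inv_le hr hrp ht (Nat.le_add_right k i) m)
      _).trans (hlow k (k + i) (Nat.le_add_right k i) m))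
  -- Adding 1 ensures strictly positive constants even if K₁ or K₂ is 0.
  refine ⟨?_, (K₂ + 1)⁻¹, K₁ + 1, by positivity, by positivity, fun f hf => ⟨?_, ?_⟩⟩
  · ext f
    exact ⟨fun hf => ⟨hf.1, (hK₁ f hf.1).trans_lt (ENNReal.mul_lt_top ENNReal.coe_lt_top hf.2)⟩,
      fun hf => ⟨hf.1, (hK₂ f hf.1).trans_lt (ENNReal.mul_lt_top ENNReal.coe_lt_top hf.2)⟩⟩
  · rw [ENNReal.coe_inv (by positivity), ENNReal.inv_mul_le_iff (by simp) ENNReal.coe_ne_top]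
    exact (hK₂ f hf.1).trans (mul_le_mul_left (by simp) _)
  · exact (hK₁ f hf.1).trans (mul_le_mul_left (by simp) _)
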